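/- **Theorem (Generalised Mackey theorem).** Let $G$ be a locally compact, second countable Hausdorff group, $H\subset G$ a closed subgroup, $X=G/H$ with its Borel sets, $p:G\to X$ the canonical projection, $\mu_G,\mu_H$ left Haar measures, and $\Delta_G,\Delta_H$ the modular functions ($\mu_G(Ag)=\Delta_G(g)\mu_G(A)$, and likewise for $H$). Hilbert spaces are complex and separable; representations are strongly continuous and unitary. A *localisation observable* on $X$ covariant with respect to a representation $\pi$ of $G$ on $\mathcal H$ is a map $E$ from the Borel sets of $X$ to the positive bounded operators on $\mathcal H$ such that $E(\emptyset)=0$, $E(X)$ is injective, $E$ is countably additive in the strong operator topology, and $\pi(g)E(Y)\pi(g)^{-1}=E(gY)$ for all $g\in G$ and all Borel $Y$ (it is not required that $E(X)=I$). It is *projective* if every $E(Y)$ is an orthogonal projection. Two such observables $E$ (for $\pi$) and $E'$ (for $\pi'$) are *equivalent* if some unitary operator $T$ intertwines $\pi$ and $\pi'$ and satisfies $E'(Y)T=TE(Y)$ for all Borel $Y$. There exist continuous functions $\theta:G\to[0,\infty)$ with $\int_H\theta(gh)\,d\mu_H(h)=1$ for all $g\in G$ and $KH\cap\operatorname{supp}\theta$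 compact for every compact $K\subset G$. Fix any such $\theta$. For a representation $\sigma$ of $H$ on $\mathcal K$ let $\mathcal F^\sigma$ be the Hilbert space of (classes of) $\mu_G$-measurable functions $F:G\to\mathcal K$ such that, for every $h\in H$, $F(gh)=\sqrt{\Delta_H(h)/\Delta_G(h)}\,\sigma(h^{-1})F(g)$ for $\mu_G$-almost all $g$, and $\|F\|^2=\int_G\|F(g)\|^2\theta(g)\,d\mu_G(g)<\infty$. On $\mathcal F^\sigma$ let $(L^\sigma(g)F)(g')=F(g^{-1}g')$ be the induced representation and $(E^\sigma(Y)F)(g)=\chi_Y(p(g))F(g)$. Let $\pi$ be a representation of $G$ on $\mathcal H$ and $E$ a localisation observable on $X$ covariant with respect to $\pi$. Then there are a representation $\sigma_E$ of $H$ and an isometry $W:\mathcal H\to\mathcal F^{\sigma_E}$ such that $$W\pi(g)=L^{\sigma_E}(g)W\quad(g\in G),\tag{1}$$ $$E(Y)=E(X)^{1/2}\,W^*\,E^{\sigma_E}(Y)\,W\,E(X)^{1/2}\quad(Y\subset X\text{ Borel}),\tag{2}$$ $$\mathcal F^{\sigma_E}=\overline{\operatorname{span}}\{E^{\sigma_E}(Y)Wv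 : Y\subset X\text{ Borel},\ v\in\mathcal H\},\tag{3}$$ and $\sigma_E$ is unique up to unitary equivalence: any two representations of $H$ that admit isometries satisfying (1)–(3) are equivalent. Moreover, for every $(\sigma_E,W)$ satisfying (1)–(3), $E$ is projective if and only if $WE(X)^{1/2}:\mathcal H\to\mathcal F^{\sigma_E}$ is unitary. Finally, if $E'$ is another localisation observable (covariant with respect to some $\pi'$) equivalent to $E$, then $\sigma_{E'}$ is equivalent to $\sigma_E$. -/

import Mathlib

open MeasureTheory MeasureTheory.Measure
open scoped NNReal ENNReal Topology Pointwise

noncomputable section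
namespace Imprimitivity

set_option linter.unusedSectionVars false

section Modular
variable {G : Type*} [Group G] [TopologicalSpace G] [IsTopologicalGroup G] [LocallyCompactSpace G]

/-- The modular function `Δ` of `G`, with `μ (A * g) = Δ g * μ A` for a left Haar measure `μ`.
The modular character of Mathlib describes `μ (A * g⁻¹)` instead. -/
def modularFunction (g : G) : ℝ≥0 := modularCharacter g⁻¹

theorem modularFunction_mul (g h : G) :
    modularFunction (g * h) = modularFunction g * modularFunction h := by
  simp [modularFunction, mul_comm]

theorem modularFunction_one : modularFunction (1 : G) = 1 := by
  simp [modularFunction]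

theorem modularFunction_pos (g : G) : 0 < modularFunction g := modularCharacterFun_pos _

variable [T2Space G] [SecondCountableTopology G] [MeasurableSpace G] [BorelSpace G]

theorem map_mul_right_haar (μ : Measure G) [μ.IsHaarMeasure] (g : G) :
    map (· * g) μ = modularFunction g⁻¹ • μ := by
  rw [modularFunction, inv_inv]
  exact map_right_mul_eq_modularCharacterFun_smul μ g

theorem modularFunction_spec (μ : Measure G) [μ.IsHaarMeasure] (g : G) (A : Set G) :
    μ ((fun a => a * g) '' A) = modularFunction g * μ A := by
  have h := congrArg (fun ν : Measure G => ν A) (map_mul_right_haar μ g⁻¹)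
  simp only [inv_inv] at h
  have e : map (· * g⁻¹) μ A = μ ((· * g⁻¹) ⁻¹' A) :=
    (MeasurableEquiv.mulRight g⁻¹).map_apply A
  rw [e] at h
  rw [show (fun a => a * g) '' A = (· * g⁻¹) ⁻¹' A from ?_, h]
  · rfl
  · ext x
    simp only [Set.mem_image, Set.mem_preimage]
    constructor
    · rintro ⟨a, ha, rfl⟩
      simpa using ha
    · intro hx
      exact ⟨_, hx, by simp⟩

theorem lintegral_mul_right_haar (μ : Measure G) [μ.IsHaarMeasure] (g : G) (f : G → ℝ≥0∞) :
    ∫⁻ x, f (x * g) ∂μ = modularFunction g⁻¹ * ∫⁻ x, f x ∂μ := by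
  have h := lintegral_map_equiv f (MeasurableEquiv.mulRight g) (μ := μ)
  have e : map (MeasurableEquiv.mulRight g) μ = modularFunction g⁻¹ • μ := map_mul_right_haar μ g
  rw [e, lintegral_smul_measure] at h
  rw [ENNReal.smul_def, smul_eq_mul] at h
  exact h.symm

theorem measurable_modularFunction : Measurable (modularFunction : G → ℝ≥0) := by
  obtain ⟨K⟩ : Nonempty (TopologicalSpace.PositiveCompacts G) := inferInstance
  have h0 : haar (K : Set G) ≠ 0 :=
    (measure_pos_of_nonempty_interior _ K.interior_nonempty).ne'
  have h1 : haar (K : Set G) ≠ ∞ := K.isCompact.measure_lt_top.ne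
  have hK : MeasurableSet (K : Set G) := K.isCompact.measurableSet
  have key : ∀ g : G, modularFunction g =
      ((haar ((fun a => a * g⁻¹) ⁻¹' (K : Set G)) : ℝ≥0∞) / haar (K : Set G)).toNNReal := by
    intro g
    have h := congrArg (fun ν : Measure G => ν K) (map_mul_right_haar haar g⁻¹)
    simp only [inv_inv] at h
    rw [map_apply (by fun_prop) hK] at h
    rw [h, Measure.smul_apply, ENNReal.smul_def, smul_eq_mul, ENNReal.mul_div_cancel_right h0 h1,
      ENNReal.toNNReal_coe]
  rw [funext key]
  refine Measurable.ennreal_toNNReal (Measurable.div_const ?_ _)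
  exact (measurable_measure_mul_right haar hK).comp measurable_inv

/-- `d(h⁻¹) = Δ(h⁻¹) dh`. -/
theorem lintegral_inv_haar (μ : Measure G) [μ.IsHaarMeasure] (f : G → ℝ≥0∞) :
    ∫⁻ h, modularFunction h⁻¹ * f h⁻¹ ∂μ = ∫⁻ h, f h ∂μ := by
  have hmeas : Measurable fun h : G => modularFunction h⁻¹ :=
    measurable_modularFunction.comp measurable_inv
  have hmeas' : Measurable fun h : G => (modularFunction h⁻¹ : ℝ≥0∞) := hmeas.coe_nnreal_ennreal
  let ν : Measure G := map (MeasurableEquiv.inv G)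
    (μ.withDensity fun h => (modularFunction h⁻¹ : ℝ≥0∞))
  have hν : ∀ f : G → ℝ≥0∞, ∫⁻ h, f h ∂ν = ∫⁻ h, modularFunction h⁻¹ * f h⁻¹ ∂μ := by
    intro f
    rw [lintegral_map_equiv f (MeasurableEquiv.inv G),
      lintegral_withDensity_eq_lintegral_mul_non_measurable _ hmeas'
        (Filter.Eventually.of_forall fun x => ENNReal.coe_lt_top)]
    rfl
  have : SigmaFinite ν := (MeasurableEquiv.inv G).sigmaFinite_map
  have : ν.IsMulLeftInvariant := by
    refine ⟨fun k => ?_⟩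
    refine Measure.ext_of_lintegral _ fun f hf => ?_
    rw [(show Measurable (fun x : G => k * x) by fun_prop) |> lintegral_map hf, hν, hν]
    have := lintegral_mul_right_haar μ k⁻¹
      (fun h => (modularFunction h⁻¹ : ℝ≥0∞) * (modularFunction k⁻¹ : ℝ≥0∞) * f h⁻¹)
    have h2 : ∀ h : G, (modularFunction h⁻¹ : ℝ≥0∞) * f (k * h⁻¹) =
        (modularFunction (h * k⁻¹)⁻¹ : ℝ≥0∞) * (modularFunction k⁻¹ : ℝ≥0∞) * f (h * k⁻¹)⁻¹ := by
      intro h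
      rw [← ENNReal.coe_mul, mul_inv_rev, inv_inv, modularFunction_mul, mul_right_comm, ← modularFunction_mul,
        mul_inv_cancel, modularFunction_one, one_mul]
    simp_rw [h2]
    rw [this, inv_inv, ← lintegral_const_mul' _ _ ENNReal.coe_ne_top]
    refine lintegral_congr fun h => ?_
    have : (modularFunction k : ℝ≥0∞) * modularFunction k⁻¹ = 1 := by
      rw [← ENNReal.coe_mul, ← modularFunction_mul, mul_inv_cancel, modularFunction_one,
        ENNReal.coe_one]
    calc _ = ((modularFunction k : ℝ≥0∞) * modularFunction k⁻¹) *
          ((modularFunction h⁻¹ : ℝ≥0∞) * f h⁻¹) := by ring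
      _ = _ := by rw [this, one_mul]
  obtain ⟨K⟩ : Nonempty (TopologicalSpace.PositiveCompacts G) := inferInstance
  have h0 : μ (K : Set G) ≠ 0 :=
    (measure_pos_of_nonempty_interior _ K.interior_nonempty).ne'
  have h1 : μ (K : Set G) ≠ ∞ := K.isCompact.measure_lt_top.ne
  have hc := measure_eq_div_smul ν μ h0 h1
  set c := ν K / μ K
  have hc' : ∀ f : G → ℝ≥0∞, ∫⁻ h, modularFunction h⁻¹ * f h⁻¹ ∂μ = c * ∫⁻ h, f h ∂μ := by
    intro f
    rw [← hν, hc, lintegral_smul_measure, smul_eq_mul]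
  have hcc : c * c = 1 := by
    have e := hc' (fun h => modularFunction h⁻¹ * (K : Set G).indicator 1 h⁻¹)
    rw [hc'] at e
    have e2 : ∀ h : G, (modularFunction h⁻¹ : ℝ≥0∞) *
        (modularFunction h⁻¹⁻¹ * (K : Set G).indicator 1 h⁻¹⁻¹) =
        (K : Set G).indicator 1 h := by
      intro h
      rw [← mul_assoc, ← ENNReal.coe_mul, ← modularFunction_mul]
      simp [modularFunction_one]
    simp_rw [e2] at e
    rw [lintegral_indicator_one K.isCompact.measurableSet, ← mul_assoc] at e
    exact ((ENNReal.mul_left_inj h0 h1).1 (by rw [one_mul]; exact e)).symm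
  have c1 : c = 1 := by
    rcases le_total c 1 with h | h
    · refine le_antisymm h ?_
      calc 1 = c * c := hcc.symm
        _ ≤ c * 1 := by gcongr
        _ = c := mul_one c
    · refine le_antisymm ?_ h
      calc c = c * 1 := (mul_one c).symm
        _ ≤ c * c := by gcongr
        _ = 1 := hcc
  rw [hc', c1, one_mul]

end Modular

section Weights
variable {G : Type*} [Group G] [TopologicalSpace G] [IsTopologicalGroup G] [LocallyCompactSpace G]

instance instLocallyCompactSpaceClosedSubgroup (H : Subgroup G) [hH : IsClosed (H : Set G)] :
    LocallyCompactSpace H :=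
  hH.isClosedEmbedding_subtypeVal.locallyCompactSpace

instance instSecondCountableTopologySubgroup [SecondCountableTopology G] (H : Subgroup G) :
    SecondCountableTopology H :=
  TopologicalSpace.Subtype.secondCountableTopology (H : Set G)

/-- The ratio `Δ_H h / Δ_G h` of the modular functions of a closed subgroup and of the group. -/
def modularRatio (H : Subgroup G) [IsClosed (H : Set G)] (h : H) : ℝ≥0 :=
  modularFunction h / modularFunction (h : G)

/-- A continuous function `θ : G → [0, ∞)` with `∫_H θ (g h) dh = 1` for all `g` such that
`K H ∩ supp θ` is compact for every compact `K`. -/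
structure BruhatFunction [MeasurableSpace G] (H : Subgroup G) (μH : Measure H) where
  toFun : G → ℝ≥0
  continuous_toFun : Continuous toFun
  lintegral_toFun : ∀ g : G, ∫⁻ h : H, (toFun (g * h) : ℝ≥0∞) ∂μH = 1
  isCompact_inter_tsupport : ∀ K : Set G, IsCompact K →
    IsCompact (K * (H : Set G) ∩ tsupport toFun)

theorem modularRatio_mul {H : Subgroup G} [IsClosed (H : Set G)] (h k : H) :
    modularRatio H (h * k) = modularRatio H h * modularRatio H k := by
  simp only [modularRatio, modularFunction_mul, Subgroup.coe_mul]
  rw [mul_div_mul_comm]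

theorem modularRatio_mul_inv {H : Subgroup G} [IsClosed (H : Set G)] (h : H) : modularRatio H h * modularRatio H h⁻¹ = 1 := by
  rw [← modularRatio_mul]
  simp [modularRatio, modularFunction_one]

variable [T2Space G] [SecondCountableTopology G] [MeasurableSpace G] [BorelSpace G]
  {H : Subgroup G} [IsClosed (H : Set G)]
  (μG : Measure G) [μG.IsHaarMeasure] (μH : Measure H) [μH.IsHaarMeasure]

/-- Integrals of covariant functions against a weight do not depend on the weight. -/
theorem lintegral_mul_weight_eq {φ : G → ℝ≥0∞} (hφm : AEMeasurable φ μG)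
    (hφ : ∀ h : H, ∀ᵐ g ∂μG, φ (g * h) = modularRatio H h * φ g) {θ₁ θ₂ : G → ℝ≥0}
    (hc₁ : Continuous θ₁) (hc₂ : Continuous θ₂)
    (h₁ : ∀ g : G, ∫⁻ h : H, (θ₁ (g * h) : ℝ≥0∞) ∂μH = 1)
    (h₂ : ∀ g : G, ∫⁻ h : H, (θ₂ (g * h) : ℝ≥0∞) ∂μH = 1) :
    ∫⁻ g, φ g * θ₁ g ∂μG = ∫⁻ g, φ g * θ₂ g ∂μG := by
  have m₁ : Measurable fun g => (θ₁ g : ℝ≥0∞) := hc₁.measurable.coe_nnreal_ennreal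
  have m₂ : Measurable fun g => (θ₂ g : ℝ≥0∞) := hc₂.measurable.coe_nnreal_ennreal
  have mΔ : Measurable fun h : H => (modularFunction h⁻¹ : ℝ≥0∞) :=
    (measurable_modularFunction.comp measurable_inv).coe_nnreal_ennreal
  have hinner : ∀ h : H, ∫⁻ g, φ g * θ₁ g * θ₂ (g * h) ∂μG =
      ∫⁻ g, φ g * θ₂ g * (modularFunction h⁻¹ * θ₁ (g * (h⁻¹ : H))) ∂μG := by
    intro h
    have e := lintegral_mul_right_haar μG (h : G)
      (fun g => φ (g * (h⁻¹ : H)) * θ₁ (g * (h⁻¹ : H)) * θ₂ g)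
    simp only [Subgroup.coe_inv, mul_inv_cancel_right] at e
    rw [e, ← lintegral_const_mul' _ _ ENNReal.coe_ne_top]
    refine lintegral_congr_ae ?_
    filter_upwards [hφ h⁻¹] with g hg
    simp only [Subgroup.coe_inv] at hg ⊢
    rw [hg]
    have hr : modularFunction (h : G)⁻¹ * modularRatio H h⁻¹ = modularFunction h⁻¹ := by
      rw [modularRatio, Subgroup.coe_inv, mul_comm, div_mul_cancel₀ _ (modularFunction_pos _).ne']
    rw [← hr, ENNReal.coe_mul]
    ring
  calc ∫⁻ g, φ g * θ₁ g ∂μG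
      = ∫⁻ g, ∫⁻ h : H, φ g * θ₁ g * θ₂ (g * h) ∂μH ∂μG := by
        refine lintegral_congr fun g => ?_
        rw [lintegral_const_mul _ (by fun_prop), h₂, mul_one]
    _ = ∫⁻ h : H, ∫⁻ g, φ g * θ₁ g * θ₂ (g * h) ∂μG ∂μH := by
        refine lintegral_lintegral_swap ?_
        refine (hφm.comp_fst.mul (by fun_prop)).mul ?_
        exact (m₂.comp (by fun_prop)).aemeasurable
    _ = ∫⁻ h : H, ∫⁻ g, φ g * θ₂ g * (modularFunction h⁻¹ * θ₁ (g * (h⁻¹ : H))) ∂μG ∂μH :=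
        lintegral_congr hinner
    _ = ∫⁻ g, ∫⁻ h : H, φ g * θ₂ g * (modularFunction h⁻¹ * θ₁ (g * (h⁻¹ : H))) ∂μH ∂μG := by
        refine (lintegral_lintegral_swap ?_).symm
        refine (hφm.comp_fst.mul (by fun_prop)).mul ?_
        exact ((mΔ.comp measurable_snd).mul (m₁.comp (by fun_prop))).aemeasurable
    _ = ∫⁻ g, φ g * θ₂ g ∂μG := by
        refine lintegral_congr fun g => ?_
        have hm : Measurable fun h : H => (modularFunction h⁻¹ * θ₁ (g * (h⁻¹ : H)) : ℝ≥0∞) :=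
          mΔ.mul (by fun_prop)
        rw [lintegral_const_mul _ hm,
          lintegral_inv_haar μH (fun h => (θ₁ (g * (h : H)) : ℝ≥0∞)), h₁, mul_one]

/-- A right `H`-invariant property that holds `θ μ`-almost everywhere holds `μ`-almost
everywhere. -/
theorem ae_of_ae_withDensity {p : G → Prop} (hm : NullMeasurableSet {g | ¬ p g} μG)
    (hp : ∀ h : H, ∀ᵐ g ∂μG, p (g * h) → p g) (θ : BruhatFunction H μH)
    (h : ∀ᵐ g ∂(μG.withDensity fun g => (θ.toFun g : ℝ≥0∞)), p g) : ∀ᵐ g ∂μG, p g := by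
  have m : Measurable fun g => (θ.toFun g : ℝ≥0∞) :=
    θ.continuous_toFun.measurable.coe_nnreal_ennreal
  rw [ae_withDensity_iff m] at h
  have hi : AEMeasurable (Set.indicator {g | ¬ p g} (1 : G → ℝ≥0∞)) μG :=
    (aemeasurable_indicator_const_iff (1 : ℝ≥0∞)).2 hm
  change μG {g | ¬ p g} = 0
  rw [← lintegral_indicator_one₀ hm]
  calc ∫⁻ g, Set.indicator {g | ¬ p g} (1 : G → ℝ≥0∞) g ∂μG
      = ∫⁻ g, ∫⁻ h : H, Set.indicator {g | ¬ p g} (1 : G → ℝ≥0∞) g * θ.toFun (g * h) ∂μH ∂μG := by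
        refine lintegral_congr fun g => ?_
        have hc := θ.continuous_toFun
        rw [lintegral_const_mul _ (by fun_prop), θ.lintegral_toFun, mul_one]
    _ = ∫⁻ h : H, ∫⁻ g, Set.indicator {g | ¬ p g} (1 : G → ℝ≥0∞) g * θ.toFun (g * h) ∂μG ∂μH := by
        refine lintegral_lintegral_swap ?_
        exact hi.comp_fst.mul (m.comp (by fun_prop)).aemeasurable
    _ = ∫⁻ _ : H, 0 ∂μH := by
        refine lintegral_congr fun k => ?_
        refine (lintegral_congr_ae ?_).trans lintegral_zero
        filter_upwards [hp k, (quasiMeasurePreserving_mul_right μG (k : G)).ae h] with g h1 h2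
        by_cases hg : p g
        · simp [hg]
        · have : (θ.toFun (g * k) : ℝ≥0∞) = 0 := by
            by_contra hne
            exact hg (h1 (h2 hne))
          simp [this]
    _ = 0 := lintegral_zero

end Weights

section UnitaryRepresentations
variable {G : Type*} [Group G] [TopologicalSpace G]

/-- A strongly continuous unitary representation of `G` on `V`. -/
structure UnitaryRep (G : Type*) [Group G] [TopologicalSpace G] (V : Type*)
    [NormedAddCommGroup V] [InnerProductSpace ℂ V] where
  toHom : G →* (V ≃ₗᵢ[ℂ] V)
  continuous_apply : ∀ v : V, Continuous fun g => toHom g v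

variable {V V' : Type*} [NormedAddCommGroup V] [InnerProductSpace ℂ V]
  [NormedAddCommGroup V'] [InnerProductSpace ℂ V']

instance : CoeFun (UnitaryRep G V) fun _ => G → (V ≃ₗᵢ[ℂ] V) := ⟨fun π => π.toHom⟩

/-- `T` intertwines `π` and `π'`. -/
def Intertwines (π : UnitaryRep G V) (π' : UnitaryRep G V') (T : V → V') : Prop :=
  ∀ (g : G) (v : V), T (π g v) = π' g (T v)

/-- Unitary equivalence of representations. -/
def UnitaryRep.Equivalent (π : UnitaryRep G V) (π' : UnitaryRep G V') : Prop :=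
  ∃ T : V ≃ₗᵢ[ℂ] V', Intertwines π π' T

end UnitaryRepresentations

section Induced
variable {G : Type*} [Group G] [TopologicalSpace G] [IsTopologicalGroup G] [LocallyCompactSpace G]
  [T2Space G] [SecondCountableTopology G] [MeasurableSpace G] [BorelSpace G]
  {H : Subgroup G} [IsClosed (H : Set G)]
  (μG : Measure G) [μG.IsHaarMeasure] {μH : Measure H} [μH.IsHaarMeasure]
  (θ : BruhatFunction H μH)
  {K : Type*} [NormedAddCommGroup K] [InnerProductSpace ℂ K] (σ : UnitaryRep H K)

/-- The covariance property of the functions in the induced space: for each `h ∈ H`,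
`F (g h) = √(Δ_H h / Δ_G h) σ(h⁻¹) F g` for almost all `g`. -/
def IsCovariant (F : G → K) : Prop :=
  ∀ h : H, ∀ᵐ g ∂μG, F (g * h) = ((√(modularRatio H h : ℝ) : ℝ) : ℂ) • σ h⁻¹ (F g)

/-- The measure with density `θ` with respect to `μG`. -/
abbrev weightedMeasure : Measure G := μG.withDensity fun g => (θ.toFun g : ℝ≥0∞)

/-- The Hilbert space of the induced representation: the classes in `L²(G, θ μG; K)` of
`μG`-measurable covariant functions. -/
def inducedSpace : Submodule ℂ (Lp K 2 (weightedMeasure μG θ)) where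
  carrier := {f | ∃ F : G → K, AEStronglyMeasurable F μG ∧ IsCovariant μG σ F ∧
    (f : G → K) =ᵐ[weightedMeasure μG θ] F}
  add_mem' := by
    rintro f f' ⟨F, hF, hc, he⟩ ⟨F', hF', hc', he'⟩
    refine ⟨F + F', hF.add hF', fun h => ?_, ?_⟩
    · filter_upwards [hc h, hc' h] with g h1 h2
      simp [h1, h2]
    · exact (Lp.coeFn_add f f').trans (he.add he')
  zero_mem' := by
    refine ⟨0, aestronglyMeasurable_zero, fun h => ?_, Lp.coeFn_zero _ _ _⟩
    exact Filter.Eventually.of_forall fun g => by simp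
  smul_mem' := by
    rintro c f ⟨F, hF, hc, he⟩
    refine ⟨c • F, hF.const_smul c, fun h => ?_, ?_⟩
    · filter_upwards [hc h] with g h1
      simp only [Pi.smul_apply, h1, map_smul]
      rw [smul_comm]
    · exact (Lp.coeFn_smul c f).trans (he.const_smul c)

variable {μG θ σ}

theorem weightedMeasure_absolutelyContinuous : weightedMeasure μG θ ≪ μG :=
  withDensity_absolutelyContinuous _ _

theorem eLpNorm_two_sq {α : Type*} [MeasurableSpace α] (μ : Measure α) (F : α → K) :
    eLpNorm F 2 μ ^ 2 = ∫⁻ x, ‖F x‖ₑ ^ 2 ∂μ := by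
  have := eLpNorm_nnreal_pow_eq_lintegral (μ := μ) (f := F) (p := 2) two_ne_zero
  simpa using this

theorem eLpNorm_weighted_sq (F : G → K) :
    eLpNorm F 2 (weightedMeasure μG θ) ^ 2 = ∫⁻ g, ‖F g‖ₑ ^ 2 * θ.toFun g ∂μG := by
  rw [eLpNorm_two_sq, lintegral_withDensity_eq_lintegral_mul_non_measurable _
    θ.continuous_toFun.measurable.coe_nnreal_ennreal
    (Filter.Eventually.of_forall fun x => ENNReal.coe_lt_top)]
  exact lintegral_congr fun g => mul_comm (θ.toFun g : ℝ≥0∞) (‖F g‖ₑ ^ 2)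

theorem IsCovariant.ae_eq {F F' : G → K} (hF : AEStronglyMeasurable F μG)
    (hF' : AEStronglyMeasurable F' μG) (hc : IsCovariant μG σ F) (hc' : IsCovariant μG σ F')
    (θ : BruhatFunction H μH) (he : F =ᵐ[weightedMeasure μG θ] F') : F =ᵐ[μG] F' := by
  refine ae_of_ae_withDensity μG μH (p := fun g => F g = F' g)
    (hF.nullMeasurableSet_eq_fun hF').compl (fun h => ?_) θ he
  filter_upwards [hc h, hc' h] with g h1 h2 h3
  rw [h1, h2] at h3
  have hpos : (0 : ℝ) < modularRatio H h :=
    NNReal.coe_pos.2 (div_pos (modularFunction_pos _) (modularFunction_pos _))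
  have hne : ((√(modularRatio H h : ℝ) : ℝ) : ℂ) ≠ 0 :=
    Complex.ofReal_ne_zero.2 (Real.sqrt_pos.2 hpos).ne'
  exact (σ h⁻¹).injective (smul_right_injective K hne h3)

theorem IsCovariant.congr {F F' : G → K} (hc : IsCovariant μG σ F) (he : F =ᵐ[μG] F') :
    IsCovariant μG σ F' := by
  intro h
  filter_upwards [hc h, he, (quasiMeasurePreserving_mul_right μG (h : G)).ae he] with g h1 h2 h3
  rw [← h2, ← h3, h1]

theorem IsCovariant.enorm_sq {F : G → K} (hc : IsCovariant μG σ F) (h : H) :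
    ∀ᵐ g ∂μG, ‖F (g * h)‖ₑ ^ 2 = modularRatio H h * ‖F g‖ₑ ^ 2 := by
  filter_upwards [hc h] with g hg
  rw [hg, enorm_smul, mul_pow, LinearIsometryEquiv.enorm_map]
  congr 1
  have : ‖((√(modularRatio H h : ℝ) : ℝ) : ℂ)‖ₑ = ENNReal.ofReal (√(modularRatio H h : ℝ)) := by
    rw [← ofReal_norm, Complex.norm_real, Real.norm_of_nonneg (Real.sqrt_nonneg _)]
  rw [this, ← ENNReal.ofReal_pow (Real.sqrt_nonneg _), Real.sq_sqrt NNReal.zero_le_coe,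
    ENNReal.ofReal_coe_nnreal]

/-- A covariant representative of an element of the induced space. -/
def inducedRepr (f : inducedSpace μG θ σ) : G → K := f.2.choose

theorem aestronglyMeasurable_inducedRepr (f : inducedSpace μG θ σ) :
    AEStronglyMeasurable (inducedRepr f) μG := f.2.choose_spec.1

theorem isCovariant_inducedRepr (f : inducedSpace μG θ σ) :
    IsCovariant μG σ (inducedRepr f) := f.2.choose_spec.2.1

theorem coe_ae_eq_inducedRepr (f : inducedSpace μG θ σ) :
    ((f : Lp K 2 (weightedMeasure μG θ)) : G → K) =ᵐ[weightedMeasure μG θ] inducedRepr f :=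
  f.2.choose_spec.2.2

theorem memLp_inducedRepr (f : inducedSpace μG θ σ) :
    MemLp (inducedRepr f) 2 (weightedMeasure μG θ) :=
  (memLp_congr_ae (coe_ae_eq_inducedRepr f)).1 (Lp.memLp _)

/-- The element of the induced space given by a covariant function. -/
def inducedMk (θ : BruhatFunction H μH) (F : G → K) (hm : AEStronglyMeasurable F μG)
    (hc : IsCovariant μG σ F) (hL : MemLp F 2 (weightedMeasure μG θ)) : inducedSpace μG θ σ :=
  ⟨hL.toLp F, F, hm, hc, hL.coeFn_toLp⟩

theorem inducedRepr_ae_eq {f : inducedSpace μG θ σ} {F : G → K} (hm : AEStronglyMeasurable F μG)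
    (hc : IsCovariant μG σ F)
    (he : ((f : Lp K 2 (weightedMeasure μG θ)) : G → K) =ᵐ[weightedMeasure μG θ] F) :
    inducedRepr f =ᵐ[μG] F :=
  (isCovariant_inducedRepr f).ae_eq (aestronglyMeasurable_inducedRepr f) hm hc θ
    ((coe_ae_eq_inducedRepr f).symm.trans he)

theorem inducedRepr_inducedMk {F : G → K} (hm : AEStronglyMeasurable F μG)
    (hc : IsCovariant μG σ F) (hL : MemLp F 2 (weightedMeasure μG θ)) :
    inducedRepr (inducedMk θ F hm hc hL) =ᵐ[μG] F :=
  inducedRepr_ae_eq hm hc hL.coeFn_toLp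

theorem inducedSpace_ext {f f' : inducedSpace μG θ σ}
    (h : inducedRepr f =ᵐ[μG] inducedRepr f') : f = f' := by
  refine Subtype.ext (Lp.ext ?_)
  exact ((coe_ae_eq_inducedRepr f).trans
    (weightedMeasure_absolutelyContinuous.ae_le h)).trans (coe_ae_eq_inducedRepr f').symm

theorem inducedRepr_add (f f' : inducedSpace μG θ σ) :
    inducedRepr (f + f') =ᵐ[μG] inducedRepr f + inducedRepr f' := by
  refine inducedRepr_ae_eq
    ((aestronglyMeasurable_inducedRepr f).add (aestronglyMeasurable_inducedRepr f')) ?_ ?_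
  · intro h
    filter_upwards [isCovariant_inducedRepr f h, isCovariant_inducedRepr f' h] with g h1 h2
    simp [h1, h2]
  · exact (Lp.coeFn_add _ _).trans ((coe_ae_eq_inducedRepr f).add (coe_ae_eq_inducedRepr f'))

theorem inducedRepr_smul (c : ℂ) (f : inducedSpace μG θ σ) :
    inducedRepr (c • f) =ᵐ[μG] c • inducedRepr f := by
  refine inducedRepr_ae_eq ((aestronglyMeasurable_inducedRepr f).const_smul c) ?_ ?_
  · intro h
    filter_upwards [isCovariant_inducedRepr f h] with g h1
    simp only [Pi.smul_apply, h1, map_smul]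
    rw [smul_comm]
  · exact (Lp.coeFn_smul _ _).trans ((coe_ae_eq_inducedRepr f).const_smul c)

theorem enorm_eq (f : inducedSpace μG θ σ) :
    ‖f‖ₑ = eLpNorm (f : Lp K 2 (weightedMeasure μG θ)) 2 (weightedMeasure μG θ) :=
  (show ‖f‖ₑ = ‖(f : Lp K 2 (weightedMeasure μG θ))‖ₑ from rfl).trans (Lp.enorm_def _)

theorem enorm_eq_inducedRepr (f : inducedSpace μG θ σ) :
    ‖f‖ₑ = eLpNorm (inducedRepr f) 2 (weightedMeasure μG θ) := by
  rw [enorm_eq, eLpNorm_congr_ae (coe_ae_eq_inducedRepr f)]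

theorem enorm_sq_eq (f : inducedSpace μG θ σ) :
    ‖f‖ₑ ^ 2 = ∫⁻ g, ‖inducedRepr f g‖ₑ ^ 2 * θ.toFun g ∂μG := by
  rw [← eLpNorm_weighted_sq, enorm_eq_inducedRepr]

section Complete
variable [CompleteSpace K]

theorem isClosed_inducedSpace :
    IsClosed (inducedSpace μG θ σ : Set (Lp K 2 (weightedMeasure μG θ))) := by
  refine IsSeqClosed.isClosed fun f f₀ hf hlim => ?_
  obtain ⟨ns, -, hns⟩ := (tendstoInMeasure_of_tendsto_Lp hlim).exists_seq_tendsto_ae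
  choose F₁ hm₁ hc₁ he₁ using fun i => hf (ns i)
  let F : ℕ → G → K := fun i => (hm₁ i).mk
  have hm : ∀ i, StronglyMeasurable (F i) := fun i => (hm₁ i).stronglyMeasurable_mk
  have hc : ∀ i, IsCovariant μG σ (F i) := fun i => (hc₁ i).congr (hm₁ i).ae_eq_mk
  have he : ∀ i, (f (ns i) : G → K) =ᵐ[weightedMeasure μG θ] F i := fun i =>
    (he₁ i).trans (weightedMeasure_absolutelyContinuous.ae_le (hm₁ i).ae_eq_mk)
  have hconv : ∀ᵐ g ∂(weightedMeasure μG θ),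
      Filter.Tendsto (fun i => F i g) Filter.atTop (𝓝 (f₀ g)) := by
    filter_upwards [hns, ae_all_iff.2 he] with g h1 h2
    exact h1.congr h2
  have hcov : ∀ h : H, ∀ᵐ g ∂μG, ∀ i,
      F i (g * h) = ((√(modularRatio H h : ℝ) : ℝ) : ℂ) • σ h⁻¹ (F i g) :=
    fun h => ae_all_iff.2 fun i => hc i h
  have hex : ∀ᵐ g ∂μG, ∃ c, Filter.Tendsto (fun i => F i g) Filter.atTop (𝓝 c) := by
    refine ae_of_ae_withDensity μG μH ?_ (fun h => ?_) θ ?_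
    · exact (StronglyMeasurable.measurableSet_exists_tendsto hm).compl.nullMeasurableSet
    · filter_upwards [hcov h⁻¹, (quasiMeasurePreserving_mul_right μG (h : G)).ae (hcov h⁻¹)]
        with g _ h2
      rintro ⟨c, hcc⟩
      refine ⟨((√(modularRatio H h⁻¹ : ℝ) : ℝ) : ℂ) • σ h⁻¹⁻¹ c, ?_⟩
      simp only [Subgroup.coe_inv, mul_inv_cancel_right] at h2
      simp_rw [h2]
      exact (((σ h⁻¹⁻¹).continuous.tendsto c).comp hcc).const_smul _
    · exact hconv.mono fun g hg => ⟨_, hg⟩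
  let F₀ : G → K := fun g => Filter.atTop.limUnder fun i => F i g
  have hF₀ : ∀ᵐ g ∂μG, Filter.Tendsto (fun i => F i g) Filter.atTop (𝓝 (F₀ g)) :=
    hex.mono fun g hg => by
      have : Nonempty K := ⟨0⟩
      exact tendsto_nhds_limUnder hg
  refine ⟨F₀, aestronglyMeasurable_of_tendsto_ae Filter.atTop
    (fun i => (hm i).aestronglyMeasurable) hF₀, fun h => ?_, ?_⟩
  · filter_upwards [hF₀, (quasiMeasurePreserving_mul_right μG (h : G)).ae hF₀, hcov h]
      with g h1 h2 h3
    simp_rw [h3] at h2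
    exact tendsto_nhds_unique h2 ((((σ h⁻¹).continuous.tendsto _).comp h1).const_smul _)
  · filter_upwards [hconv, weightedMeasure_absolutelyContinuous.ae_le hF₀] with g h1 h2
    exact tendsto_nhds_unique h1 h2

instance instCompleteSpaceInducedSpace : CompleteSpace (inducedSpace μG θ σ) :=
  isClosed_inducedSpace.completeSpace_coe

end Complete

theorem lintegral_translate (f : inducedSpace μG θ σ) (g : G) :
    ∫⁻ x, ‖inducedRepr f x‖ₑ ^ 2 * θ.toFun (g * x) ∂μG = ‖f‖ₑ ^ 2 := by
  rw [enorm_sq_eq]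
  have hc := θ.continuous_toFun
  refine lintegral_mul_weight_eq μG μH ((aestronglyMeasurable_inducedRepr f).enorm.pow_const 2)
    (isCovariant_inducedRepr f).enorm_sq (θ₁ := fun x => θ.toFun (g * x)) (by fun_prop) hc
    (fun x => ?_) θ.lintegral_toFun
  simp_rw [← mul_assoc]
  exact θ.lintegral_toFun (g * x)

theorem aestronglyMeasurable_translate (f : inducedSpace μG θ σ) (g : G) :
    AEStronglyMeasurable (fun x => inducedRepr f (g⁻¹ * x)) μG :=
  (aestronglyMeasurable_inducedRepr f).comp_measurePreserving (measurePreserving_mul_left μG g⁻¹)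

theorem isCovariant_translate (f : inducedSpace μG θ σ) (g : G) :
    IsCovariant μG σ (fun x => inducedRepr f (g⁻¹ * x)) := by
  intro h
  filter_upwards [(measurePreserving_mul_left μG g⁻¹).quasiMeasurePreserving.ae
    (isCovariant_inducedRepr f h)] with x hx
  rw [← mul_assoc]
  exact hx

theorem eLpNorm_translate (f : inducedSpace μG θ σ) (g : G) :
    eLpNorm (fun x => inducedRepr f (g⁻¹ * x)) 2 (weightedMeasure μG θ) = ‖f‖ₑ := by
  have : eLpNorm (fun x => inducedRepr f (g⁻¹ * x)) 2 (weightedMeasure μG θ) ^ 2 = ‖f‖ₑ ^ 2 := by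
    rw [eLpNorm_weighted_sq, ← lintegral_translate f g,
      ← lintegral_mul_left_eq_self (μ := μG) _ g]
    simp
  exact (ENNReal.pow_right_strictMono two_ne_zero).injective this

theorem memLp_translate (f : inducedSpace μG θ σ) (g : G) :
    MemLp (fun x => inducedRepr f (g⁻¹ * x)) 2 (weightedMeasure μG θ) :=
  ⟨(aestronglyMeasurable_translate f g).mono_ac weightedMeasure_absolutelyContinuous, by
    rw [eLpNorm_translate]; exact enorm_lt_top⟩

/-- Left translation `(L_g F)(x) = F (g⁻¹ x)` on the induced space. -/
def inducedTranslate (g : G) (f : inducedSpace μG θ σ) : inducedSpace μG θ σ :=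
  inducedMk θ (fun x => inducedRepr f (g⁻¹ * x)) (aestronglyMeasurable_translate f g)
    (isCovariant_translate f g) (memLp_translate f g)

theorem inducedRepr_inducedTranslate (g : G) (f : inducedSpace μG θ σ) :
    inducedRepr (inducedTranslate g f) =ᵐ[μG] fun x => inducedRepr f (g⁻¹ * x) :=
  inducedRepr_inducedMk _ _ _

theorem inducedTranslate_mul (g g' : G) (f : inducedSpace μG θ σ) :
    inducedTranslate (g * g') f = inducedTranslate g (inducedTranslate g' f) := by
  apply inducedSpace_ext
  refine (inducedRepr_inducedTranslate _ _).trans ?_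
  refine Filter.EventuallyEq.trans ?_ (inducedRepr_inducedTranslate _ _).symm
  filter_upwards [(measurePreserving_mul_left μG g⁻¹).quasiMeasurePreserving.ae
    (inducedRepr_inducedTranslate g' f)] with x hx
  rw [hx, mul_inv_rev, mul_assoc]

theorem inducedTranslate_one (f : inducedSpace μG θ σ) : inducedTranslate 1 f = f := by
  apply inducedSpace_ext
  refine (inducedRepr_inducedTranslate _ _).trans ?_
  simp

/-- Left translation by `g` as a unitary operator of the induced space. -/
def inducedTranslateₗᵢ (g : G) : inducedSpace μG θ σ ≃ₗᵢ[ℂ] inducedSpace μG θ σ where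
  toFun := inducedTranslate g
  invFun := inducedTranslate g⁻¹
  left_inv f := by rw [← inducedTranslate_mul, inv_mul_cancel, inducedTranslate_one]
  right_inv f := by rw [← inducedTranslate_mul, mul_inv_cancel, inducedTranslate_one]
  map_add' f f' := by
    apply inducedSpace_ext
    refine (inducedRepr_inducedTranslate _ _).trans ?_
    refine Filter.EventuallyEq.trans ?_ (inducedRepr_add _ _).symm
    have h3 : ∀ᵐ x ∂μG, inducedRepr (f + f') x = (inducedRepr f + inducedRepr f') x :=
      inducedRepr_add f f'
    filter_upwards [inducedRepr_inducedTranslate g f, inducedRepr_inducedTranslate g f',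
      (measurePreserving_mul_left μG g⁻¹).quasiMeasurePreserving.ae h3]
      with x h1 h2 h3
    rw [h3, Pi.add_apply, Pi.add_apply, h1, h2]
  map_smul' c f := by
    apply inducedSpace_ext
    refine (inducedRepr_inducedTranslate _ _).trans ?_
    refine Filter.EventuallyEq.trans ?_ (inducedRepr_smul _ _).symm
    have h3 : ∀ᵐ x ∂μG, inducedRepr (c • f) x = (c • inducedRepr f) x := inducedRepr_smul c f
    filter_upwards [inducedRepr_inducedTranslate g f,
      (measurePreserving_mul_left μG g⁻¹).quasiMeasurePreserving.ae h3]
      with x h1 h3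
    rw [h3, Pi.smul_apply, Pi.smul_apply, h1, RingHom.id_apply]
  norm_map' f := by
    have h : ‖inducedTranslate g f‖ₑ = ‖f‖ₑ := by
      rw [← eLpNorm_translate f g, enorm_eq_inducedRepr]
      exact eLpNorm_congr_ae
        (weightedMeasure_absolutelyContinuous.ae_le (inducedRepr_inducedTranslate g f))
    change ‖inducedTranslate g f‖ = ‖f‖
    rw [← toReal_enorm, h, toReal_enorm]


theorem inducedRepr_sub (f f' : inducedSpace μG θ σ) :
    inducedRepr (f - f') =ᵐ[μG] inducedRepr f - inducedRepr f' := by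
  have e : f - f' = f + (-1 : ℂ) • f' := by simp [sub_eq_add_neg]
  rw [e]
  filter_upwards [inducedRepr_add f ((-1 : ℂ) • f'), inducedRepr_smul (-1 : ℂ) f'] with x h1 h2
  rw [h1, Pi.add_apply, h2]
  simp [sub_eq_add_neg]

/-- `∫ |√θ(g x) - √θ(x)|² ‖F x‖² dx → 0` as `g → 1`. -/
theorem tendsto_lintegral_sqrt_sub (f : inducedSpace μG θ σ) :
    Filter.Tendsto (fun g : G => ∫⁻ x, ‖inducedRepr f x‖ₑ ^ 2 *
      ‖√(θ.toFun (g * x) : ℝ) - √(θ.toFun x : ℝ)‖ₑ ^ 2 ∂μG) (𝓝 1) (𝓝 0) := by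
  have hc := θ.continuous_toFun
  have hF : AEMeasurable (fun x => ‖inducedRepr f x‖ₑ ^ 2) μG :=
    (aestronglyMeasurable_inducedRepr f).enorm.pow_const 2
  have hfin : ‖f‖ₑ ^ 2 ≠ ∞ := ENNReal.pow_ne_top enorm_ne_top
  have hmin : Filter.Tendsto (fun g : G => ∫⁻ x, ‖inducedRepr f x‖ₑ ^ 2 *
      (min (θ.toFun (g * x)) (θ.toFun x) : ℝ≥0) ∂μG) (𝓝 1) (𝓝 (‖f‖ₑ ^ 2)) := by
    rw [enorm_sq_eq] at hfin ⊢
    refine tendsto_lintegral_filter_of_dominated_convergence' _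
      (Filter.Eventually.of_forall fun g => ?_)
      (Filter.Eventually.of_forall fun g => Filter.Eventually.of_forall fun x => ?_) hfin
      (Filter.Eventually.of_forall fun x => ?_)
    · exact hF.mul (by fun_prop)
    · gcongr
      exact min_le_right _ _
    · have h1 : Filter.Tendsto (fun g : G => ((min (θ.toFun (g * x)) (θ.toFun x) : ℝ≥0) : ℝ≥0∞))
          (𝓝 1) (𝓝 (θ.toFun x : ℝ≥0∞)) := by
        have : Continuous fun g : G => ((min (θ.toFun (g * x)) (θ.toFun x) : ℝ≥0) : ℝ≥0∞) := by
          fun_prop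
        simpa using this.tendsto 1
      exact ENNReal.Tendsto.const_mul h1 (Or.inr (ENNReal.pow_ne_top enorm_ne_top))
  have hlim : Filter.Tendsto (fun g : G => (‖f‖ₑ ^ 2 + ‖f‖ₑ ^ 2) - 2 * ∫⁻ x, ‖inducedRepr f x‖ₑ ^ 2 *
      (min (θ.toFun (g * x)) (θ.toFun x) : ℝ≥0) ∂μG) (𝓝 1) (𝓝 0) := by
    have h2 := ENNReal.Tendsto.const_mul hmin (a := 2) (Or.inr (by simp))
    have h3 := ENNReal.Tendsto.sub (tendsto_const_nhds (x := ‖f‖ₑ ^ 2 + ‖f‖ₑ ^ 2)) h2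
      (Or.inl (by simp [hfin]))
    rwa [show ‖f‖ₑ ^ 2 + ‖f‖ₑ ^ 2 - 2 * ‖f‖ₑ ^ 2 = 0 by rw [two_mul, tsub_self]] at h3
  refine tendsto_of_tendsto_of_tendsto_of_le_of_le tendsto_const_nhds hlim (fun _ => zero_le)
    fun g => ?_
  have hmfin : 2 * ∫⁻ x, ‖inducedRepr f x‖ₑ ^ 2 *
      (min (θ.toFun (g * x)) (θ.toFun x) : ℝ≥0) ∂μG ≠ ∞ := by
    refine ENNReal.mul_ne_top (by simp) (ne_top_of_le_ne_top hfin ?_)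
    rw [enorm_sq_eq]
    gcongr
    exact min_le_right _ _
  refine ENNReal.le_sub_of_add_le_right hmfin ?_
  nth_rewrite 1 [← lintegral_translate f g]
  have m₁ : AEMeasurable (fun x => ‖inducedRepr f x‖ₑ ^ 2 *
      ‖√(θ.toFun (g * x) : ℝ) - √(θ.toFun x : ℝ)‖ₑ ^ 2) μG := hF.mul (by fun_prop)
  have m₂ : AEMeasurable (fun x => ‖inducedRepr f x‖ₑ ^ 2 * (θ.toFun (g * x) : ℝ≥0∞)) μG :=
    hF.mul (by fun_prop)
  rw [enorm_sq_eq, ← lintegral_const_mul' _ _ (by simp), ← lintegral_add_left' m₁,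
    ← lintegral_add_left' m₂]
  refine lintegral_mono fun x => ?_
  have key : ∀ a b : ℝ≥0, ‖√(a : ℝ) - √(b : ℝ)‖ₑ ^ 2 + 2 * ((min a b : ℝ≥0) : ℝ≥0∞) ≤ a + b := by
    intro a b
    have e : ‖√(a : ℝ) - √(b : ℝ)‖ₑ ^ 2 = ENNReal.ofReal ((√(a : ℝ) - √(b : ℝ)) ^ 2) := by
      rw [← ofReal_norm, ← ENNReal.ofReal_pow (norm_nonneg _), Real.norm_eq_abs, sq_abs]
    rw [e, ← ENNReal.ofReal_coe_nnreal (p := a), ← ENNReal.ofReal_coe_nnreal (p := b),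
      ← ENNReal.ofReal_coe_nnreal (p := min a b), ← ENNReal.ofReal_ofNat 2,
      ← ENNReal.ofReal_mul (by norm_num), ← ENNReal.ofReal_add (sq_nonneg _) (by positivity),
      ← ENNReal.ofReal_add (by positivity) (by positivity)]
    apply ENNReal.ofReal_le_ofReal
    have ha := Real.sq_sqrt (NNReal.coe_nonneg a)
    have hb := Real.sq_sqrt (NNReal.coe_nonneg b)
    have h0 := Real.sqrt_nonneg (a : ℝ)
    have h1 := Real.sqrt_nonneg (b : ℝ)
    rw [NNReal.coe_min]
    rcases le_total (a : ℝ) b with h | h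
    · rw [min_eq_left h]
      nlinarith [Real.sqrt_le_sqrt h]
    · rw [min_eq_right h]
      nlinarith [Real.sqrt_le_sqrt h]
  calc _ = ‖inducedRepr f x‖ₑ ^ 2 * (‖√(θ.toFun (g * x) : ℝ) - √(θ.toFun x : ℝ)‖ₑ ^ 2 +
        2 * ((min (θ.toFun (g * x)) (θ.toFun x) : ℝ≥0) : ℝ≥0∞)) := by ring
    _ ≤ ‖inducedRepr f x‖ₑ ^ 2 * (θ.toFun (g * x) + θ.toFun x) := by
        exact mul_le_mul' le_rfl (key _ _)
    _ = _ := by ring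

theorem tendsto_inducedTranslate_one (f : inducedSpace μG θ σ) :
    Filter.Tendsto (fun g : G => ‖inducedTranslate g f - f‖ₑ) (𝓝 1) (𝓝 0) := by
  have hc := θ.continuous_toFun
  let s : G → ℝ := fun x => √(θ.toFun x : ℝ)
  have hs : Continuous s := by fun_prop
  have hsn : ∀ x, ‖((s x : ℝ) : ℂ)‖ₑ ^ 2 = θ.toFun x := by
    intro x
    rw [← ofReal_norm, Complex.norm_real, Real.norm_of_nonneg (Real.sqrt_nonneg _),
      ← ENNReal.ofReal_pow (Real.sqrt_nonneg _), Real.sq_sqrt NNReal.zero_le_coe,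
      ENNReal.ofReal_coe_nnreal]
  have hsw : ∀ F : G → K, eLpNorm F 2 (weightedMeasure μG θ) =
      eLpNorm (fun x => ((s x : ℝ) : ℂ) • F x) 2 μG := by
    intro F
    refine (ENNReal.pow_right_strictMono two_ne_zero).injective ?_
    rw [eLpNorm_weighted_sq, eLpNorm_two_sq]
    refine lintegral_congr fun x => ?_
    rw [enorm_smul, mul_pow, hsn, mul_comm]
  let F := inducedRepr f
  have hFm : AEStronglyMeasurable F μG := aestronglyMeasurable_inducedRepr f
  let Q : G → K := fun x => ((s x : ℝ) : ℂ) • F x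
  have hsm : Continuous fun x => ((s x : ℝ) : ℂ) := Complex.continuous_ofReal.comp hs
  have hQ : MemLp Q 2 μG := by
    refine ⟨hsm.aestronglyMeasurable.smul hFm, ?_⟩
    rw [← hsw, ← enorm_eq_inducedRepr]
    exact enorm_lt_top
  have hA : Filter.Tendsto (fun g : G => eLpNorm (fun x => Q (g⁻¹ * x) - Q x) 2 μG) (𝓝 1)
      (𝓝 0) := by
    let c : C(G, C(G, G)) :=
      (ContinuousMap.mk (fun a : G × G => a.1⁻¹ * a.2) (by fun_prop)).curry
    have h1 := (continuous_const (y := hQ.toLp Q)).compMeasurePreservingLp c.continuous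
      (fun g => measurePreserving_mul_left μG g⁻¹) (by simp)
    have h2 := ((h1.sub (continuous_const (y := hQ.toLp Q))).enorm).tendsto 1
    have h3 : ∀ g : G, ‖Lp.compMeasurePreserving (c g) (measurePreserving_mul_left μG g⁻¹)
        (hQ.toLp Q) - hQ.toLp Q‖ₑ = eLpNorm (fun x => Q (g⁻¹ * x) - Q x) 2 μG := by
      intro g
      rw [Lp.enorm_def]
      refine eLpNorm_congr_ae ?_
      refine (Lp.coeFn_sub _ _).trans (Filter.EventuallyEq.sub ?_ hQ.coeFn_toLp)
      refine (Lp.coeFn_compMeasurePreserving _ _).trans ?_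
      exact (measurePreserving_mul_left μG g⁻¹).quasiMeasurePreserving.ae_eq_comp hQ.coeFn_toLp
    have h5 : ‖Lp.compMeasurePreserving (c 1) (measurePreserving_mul_left μG 1⁻¹)
        (hQ.toLp Q) - hQ.toLp Q‖ₑ = 0 := by rw [h3 1]; simp
    rw [← h5]
    exact h2.congr h3
  have hB : Filter.Tendsto (fun g : G =>
      eLpNorm (fun x => ((s x - s (g⁻¹ * x) : ℝ) : ℂ) • F (g⁻¹ * x)) 2 μG) (𝓝 1) (𝓝 0) := by
    have h1 := ((ENNReal.continuous_rpow_const (y := (1 / 2 : ℝ))).tendsto 0).comp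
      (tendsto_lintegral_sqrt_sub f)
    rw [ENNReal.zero_rpow_of_pos (by norm_num)] at h1
    refine h1.congr fun g => ?_
    have h2 : eLpNorm (fun x => ((s x - s (g⁻¹ * x) : ℝ) : ℂ) • F (g⁻¹ * x)) 2 μG ^ 2 =
        ∫⁻ x, ‖F x‖ₑ ^ 2 * ‖s (g * x) - s x‖ₑ ^ 2 ∂μG := by
      rw [eLpNorm_two_sq, ← lintegral_mul_left_eq_self (μ := μG) _ g]
      refine lintegral_congr fun x => ?_
      rw [inv_mul_cancel_left, enorm_smul, mul_pow, mul_comm, ← ofReal_norm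
        ((s (g * x) - s x : ℝ) : ℂ), Complex.norm_real, ofReal_norm]
    simp only [Function.comp_apply]
    rw [← h2, ← ENNReal.rpow_natCast, ← ENNReal.rpow_mul]
    norm_num
  have hAB := hA.add hB
  rw [add_zero] at hAB
  refine tendsto_of_tendsto_of_tendsto_of_le_of_le tendsto_const_nhds hAB
    (fun _ => zero_le) fun g => ?_
  have e : ‖inducedTranslate g f - f‖ₑ =
      eLpNorm (fun x => ((s x : ℝ) : ℂ) • (F (g⁻¹ * x) - F x)) 2 μG := by
    rw [enorm_eq_inducedRepr, hsw]
    refine eLpNorm_congr_ae ?_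
    filter_upwards [inducedRepr_sub (inducedTranslate g f) f, inducedRepr_inducedTranslate g f]
      with x h1 h2
    rw [h1, Pi.sub_apply, h2]
  have e2 : (fun x => ((s x : ℝ) : ℂ) • (F (g⁻¹ * x) - F x)) =
      (fun x => Q (g⁻¹ * x) - Q x) + fun x => ((s x - s (g⁻¹ * x) : ℝ) : ℂ) • F (g⁻¹ * x) := by
    funext x
    simp only [Pi.add_apply, Q, Complex.ofReal_sub, sub_smul, smul_sub]
    abel
  have mp := (measurePreserving_mul_left μG g⁻¹)
  rw [e, e2]
  have a₁ : AEStronglyMeasurable (fun x => Q (g⁻¹ * x) - Q x) μG :=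
    (hQ.1.comp_measurePreserving mp).sub hQ.1
  have a₂ : AEStronglyMeasurable (fun x => ((s x - s (g⁻¹ * x) : ℝ) : ℂ) • F (g⁻¹ * x)) μG := by
    have hcc : Continuous fun x => ((s x - s (g⁻¹ * x) : ℝ) : ℂ) :=
      Complex.continuous_ofReal.comp (by fun_prop)
    exact hcc.aestronglyMeasurable.smul (hFm.comp_measurePreserving mp)
  exact eLpNorm_add_le a₁ a₂ one_le_two

theorem continuous_inducedTranslate (f : inducedSpace μG θ σ) :
    Continuous fun g : G => inducedTranslate g f := by
  rw [continuous_iff_continuousAt]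
  intro g₀
  rw [ContinuousAt, tendsto_iff_edist_tendsto_0]
  have h1 : Filter.Tendsto (fun g : G => g₀⁻¹ * g) (𝓝 g₀) (𝓝 1) := by
    have : Continuous fun g : G => g₀⁻¹ * g := by fun_prop
    simpa using this.tendsto g₀
  refine ((tendsto_inducedTranslate_one f).comp h1).congr fun g => ?_
  have h2 : inducedTranslate g f = inducedTranslate g₀ (inducedTranslate (g₀⁻¹ * g) f) := by
    rw [← inducedTranslate_mul, mul_inv_cancel_left]
  rw [h2, Function.comp_apply, ← edist_eq_enorm_sub]
  exact ((inducedTranslateₗᵢ (μG := μG) (θ := θ) (σ := σ) g₀).isometry.edist_eq _ _).symm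

variable (μG θ σ)

/-- The representation of `G` induced by the representation `σ` of `H`. -/
def inducedRep : UnitaryRep G (inducedSpace μG θ σ) where
  toHom :=
    { toFun := inducedTranslateₗᵢ
      map_one' := LinearIsometryEquiv.ext inducedTranslate_one
      map_mul' := fun g g' => LinearIsometryEquiv.ext (inducedTranslate_mul g g') }
  continuous_apply := continuous_inducedTranslate

theorem measurableSet_preimage_mk {Y : Set (G ⧸ H)} (hY : MeasurableSet[borel (G ⧸ H)] Y) :
    MeasurableSet ((QuotientGroup.mk : G → G ⧸ H) ⁻¹' Y) := by
  borelize (G ⧸ H)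
  exact QuotientGroup.continuous_mk.measurable hY

theorem isCovariant_indicator {μG : Measure G} {σ : UnitaryRep H K} (Y : Set (G ⧸ H)) {F : G → K}
    (hc : IsCovariant μG σ F) :
    IsCovariant μG σ (((QuotientGroup.mk : G → G ⧸ H) ⁻¹' Y).indicator F) := by
  intro h
  filter_upwards [hc h] with g hg
  have e : (QuotientGroup.mk (g * h) : G ⧸ H) = QuotientGroup.mk g :=
    QuotientGroup.mk_mul_of_mem g h.2
  by_cases hx : g ∈ (QuotientGroup.mk : G → G ⧸ H) ⁻¹' Y
  · rw [Set.indicator_of_mem (by rwa [Set.mem_preimage, e]), Set.indicator_of_mem hx, hg]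
  · rw [Set.indicator_of_notMem (by rwa [Set.mem_preimage, e]), Set.indicator_of_notMem hx,
      map_zero, smul_zero]

variable {μG θ σ}

/-- Multiplication of an element of the induced space by `g ↦ χ_Y(gH)`. -/
def inducedCutoff (Y : Set (G ⧸ H)) (hY : MeasurableSet[borel (G ⧸ H)] Y)
    (f : inducedSpace μG θ σ) : inducedSpace μG θ σ :=
  inducedMk θ (((QuotientGroup.mk : G → G ⧸ H) ⁻¹' Y).indicator (inducedRepr f))
    ((aestronglyMeasurable_inducedRepr f).indicator (measurableSet_preimage_mk hY))
    (isCovariant_indicator Y (isCovariant_inducedRepr f))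
    ((memLp_inducedRepr f).indicator (measurableSet_preimage_mk hY))

theorem inducedRepr_inducedCutoff (Y : Set (G ⧸ H)) (hY : MeasurableSet[borel (G ⧸ H)] Y)
    (f : inducedSpace μG θ σ) :
    inducedRepr (inducedCutoff Y hY f) =ᵐ[μG]
      ((QuotientGroup.mk : G → G ⧸ H) ⁻¹' Y).indicator (inducedRepr f) :=
  inducedRepr_inducedMk _ _ _

variable (μG θ σ)

/-- The projection-valued measure of the induced representation on the Borel sets of `G ⧸ H`:
`(E^σ(Y) F)(g) = χ_Y(gH) F(g)`. -/
def inducedPVM (Y : Set (G ⧸ H)) (hY : MeasurableSet[borel (G ⧸ H)] Y) :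
    inducedSpace μG θ σ →L[ℂ] inducedSpace μG θ σ :=
  LinearMap.mkContinuous
    { toFun := inducedCutoff Y hY
      map_add' := fun f f' => by
        apply inducedSpace_ext
        refine (inducedRepr_inducedCutoff _ _ _).trans ?_
        refine Filter.EventuallyEq.trans ?_ (inducedRepr_add _ _).symm
        filter_upwards [inducedRepr_add f f', inducedRepr_inducedCutoff Y hY f,
          inducedRepr_inducedCutoff Y hY f'] with x h1 h2 h3
        rw [Pi.add_apply, h2, h3]
        by_cases hx : x ∈ (QuotientGroup.mk : G → G ⧸ H) ⁻¹' Y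
        · rw [Set.indicator_of_mem hx, Set.indicator_of_mem hx, Set.indicator_of_mem hx, h1,
            Pi.add_apply]
        · rw [Set.indicator_of_notMem hx, Set.indicator_of_notMem hx,
            Set.indicator_of_notMem hx, add_zero]
      map_smul' := fun c f => by
        apply inducedSpace_ext
        refine (inducedRepr_inducedCutoff _ _ _).trans ?_
        refine Filter.EventuallyEq.trans ?_ (inducedRepr_smul _ _).symm
        filter_upwards [inducedRepr_smul c f, inducedRepr_inducedCutoff Y hY f] with x h1 h2
        rw [RingHom.id_apply, Pi.smul_apply, h2]
        by_cases hx : x ∈ (QuotientGroup.mk : G → G ⧸ H) ⁻¹' Y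
        · rw [Set.indicator_of_mem hx, Set.indicator_of_mem hx, h1, Pi.smul_apply]
        · rw [Set.indicator_of_notMem hx, Set.indicator_of_notMem hx, smul_zero] }
    1 (fun f => by
      rw [one_mul]
      have h : ‖inducedCutoff Y hY f‖ₑ ≤ ‖f‖ₑ := by
        rw [enorm_eq_inducedRepr, enorm_eq_inducedRepr, eLpNorm_congr_ae
          (weightedMeasure_absolutelyContinuous.ae_le (inducedRepr_inducedCutoff Y hY f))]
        exact eLpNorm_indicator_le _
      change ‖inducedCutoff Y hY f‖ ≤ ‖f‖
      rw [← toReal_enorm, ← toReal_enorm]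
      exact ENNReal.toReal_mono enorm_ne_top h)

end Induced

section Observables
variable {G : Type*} [Group G] [TopologicalSpace G] {H : Subgroup G}
  {V : Type*} [NormedAddCommGroup V] [InnerProductSpace ℂ V]
  {V' : Type*} [NormedAddCommGroup V'] [InnerProductSpace ℂ V']

/-- A localisation observable on the Borel sets of `G ⧸ H` covariant with respect to `π`: a
positive operator valued measure (not necessarily normalised) with injective total operator.
The values of `toFun` on sets that are not Borel are irrelevant. -/
structure LocalisationObservable (H : Subgroup G) (π : UnitaryRep G V) where
  toFun : Set (G ⧸ H) → (V →L[ℂ] V)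
  isPositive : ∀ Y, MeasurableSet[borel (G ⧸ H)] Y → (toFun Y).IsPositive
  empty : toFun ∅ = 0
  injective_univ : Function.Injective (toFun Set.univ)
  hasSum_iUnion : ∀ Y : ℕ → Set (G ⧸ H), (∀ n, MeasurableSet[borel (G ⧸ H)] (Y n)) →
    Pairwise (Function.onFun Disjoint Y) → ∀ v : V, HasSum (fun n => toFun (Y n) v)
      (toFun (⋃ n, Y n) v)
  covariant : ∀ (g : G) (Y : Set (G ⧸ H)), MeasurableSet[borel (G ⧸ H)] Y →
    ∀ v : V, π g (toFun Y (π g⁻¹ v)) = toFun (g • Y) v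

instance (π : UnitaryRep G V) :
    CoeFun (LocalisationObservable H π) fun _ => Set (G ⧸ H) → (V →L[ℂ] V) := ⟨fun E => E.toFun⟩

/-- All values on Borel sets are orthogonal projections. -/
def LocalisationObservable.IsProjective [CompleteSpace V] {π : UnitaryRep G V}
    (E : LocalisationObservable H π) : Prop :=
  ∀ Y, MeasurableSet[borel (G ⧸ H)] Y → IsStarProjection (E Y)

/-- Equivalence of localisation observables through a unitary intertwining operator. -/
def LocalisationObservable.Equivalent {π : UnitaryRep G V} {π' : UnitaryRep G V'}
    (E : LocalisationObservable H π) (E' : LocalisationObservable H π') : Prop :=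
  ∃ T : V ≃ₗᵢ[ℂ] V', Intertwines π π' T ∧
    ∀ Y, MeasurableSet[borel (G ⧸ H)] Y → ∀ v : V, E' Y (T v) = T (E Y v)

end Observables

section Mackey
variable {G : Type*} [Group G] [TopologicalSpace G] [IsTopologicalGroup G] [LocallyCompactSpace G]
  [T2Space G] [SecondCountableTopology G] [MeasurableSpace G] [BorelSpace G]
  {H : Subgroup G} [IsClosed (H : Set G)]
  {V : Type*} [NormedAddCommGroup V] [InnerProductSpace ℂ V] [CompleteSpace V]
  {K : Type*} [NormedAddCommGroup K] [InnerProductSpace ℂ K] [CompleteSpace K]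

/-- The square root `E(X)^{1/2}` of the total operator. -/
def LocalisationObservable.sqrtTotal {π : UnitaryRep G V} (E : LocalisationObservable H π) :
    V →L[ℂ] V := CFC.sqrt (E Set.univ)

/-- `(σ, W)` represents the observable `E`: the isometry `W` intertwines `π` with the induced
representation, `E(Y) = E(X)^{1/2} W* E^σ(Y) W E(X)^{1/2}` for all Borel `Y`, and the vectors
`E^σ(Y) W v` span a dense subspace of the induced space. -/
structure IsMackeyPair (μG : Measure G) [μG.IsHaarMeasure] {μH : Measure H} [μH.IsHaarMeasure]
    (θ : BruhatFunction H μH) {π : UnitaryRep G V} (E : LocalisationObservable H π)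
    (σ : UnitaryRep H K) (W : V →ₗᵢ[ℂ] inducedSpace μG θ σ) : Prop where
  intertwines : Intertwines π (inducedRep μG θ σ) W
  eq_compression : ∀ (Y : Set (G ⧸ H)) (hY : MeasurableSet[borel (G ⧸ H)] Y),
    E Y = E.sqrtTotal ∘L ContinuousLinearMap.adjoint W.toContinuousLinearMap ∘L
      inducedPVM μG θ σ Y hY ∘L W.toContinuousLinearMap ∘L E.sqrtTotal
  closure_span : (Submodule.span ℂ {F : inducedSpace μG θ σ | ∃ (Y : Set (G ⧸ H))
    (hY : MeasurableSet[borel (G ⧸ H)] Y) (v : V),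
      F = inducedPVM μG θ σ Y hY (W v)}).topologicalClosure = ⊤

end Mackey
end Imprimitivity

end

universe v

open Imprimitivity MeasureTheory

/-!
# The generalised Mackey theorem

Let `X = G ⧸ H`. A covariant localisation observable `E` defines, for every vector `v`, a finite
measure `Y ↦ ⟨E(Y) v, v⟩` on `X` (`LocalisationObservable.measure`). The proof represents these
measures by densities along `G`. For a compactly supported continuous function `a` on `G` let
`a♭(gH) = ∫_H a(gh) dh` (`fold`) and `E(a♭) = ∫ a♭ dE` (`LocalisationObservable.lift`). For
*smoothed* vectors `π(f) v = ∫ f(x) π(x) v dx` covariance of `E` and Fubini's theorem give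

`⟨π(f) v, E(a♭) π(f') v'⟩ = ∫_G a(g) B_g dg`

with an explicit *continuous* density `B_g` (`LocalisationObservable.integral_mul_form`).
Positivity of `E` makes `B_1` a positive semidefinite form on pairs `(f, v)`. Its separated
completion is the Hilbert space of the inducing representation `σ` of `H`, which acts by left
translation of `f`, corrected by the square root of `Δ_H / Δ_G`
(`LocalisationObservable.exists_fibre`). The value at `g` of the covariant function of `π(f) v` is
the class of `(f(g ·), v)`, so that this function defines on `X` the measure
`⟨E(·) π(f) v, π(f) v⟩` (`cosetMeasure_fibreFun`). Hence `E(X)^{1/2} π(f) v ↦` this function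
extends to the isometry `W`.

The other parts rest on the fact that a covariant function `F` is determined in norm, almost
everywhere, by the measure `Y ↦ ‖E^σ(Y) F‖²` on `X` (`IsCovariant.enorm_ae_eq`, a consequence of
Weil's formula `lintegral_mul_eq_lintegral_bruhat`). By polarisation, if `F` is orthogonal to all
`E^σ(Y) W v`, then its values are orthogonal almost everywhere to those of a family of functions
that are total at every point, which proves that the vectors `E^σ(Y) W v` are total. For
uniqueness, two pairs give a unitary operator `S` between the induced spaces that respects
translations and projections. It preserves the pointwise inner products `⟨F(g), F'(g)⟩`, and,
after a translation and Fubini's theorem, `⟨F(g), F'(g')⟩` for almost all `g` and `g'`. So the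
averages `∫ k(g) F(g) dg` have the same Gram matrix as the averages of `S F`. They are total
(`dense_span_average`), and `H` acts on them by a change of the weight `k` alone, so matching them
gives the equivalence (`equivalent_of_inducedSpace_equiv`).
-/

open MeasureTheory MeasureTheory.Measure
open scoped NNReal ENNReal Topology Pointwise

noncomputable section
namespace Imprimitivity

set_option linter.unusedSectionVars false

/-! ### Isometries of Hilbert spaces determined on total families -/

section Hilbert
open scoped InnerProductSpace

variable {V₁ V₂ : Type*} [NormedAddCommGroup V₁] [InnerProductSpace ℂ V₁]
  [NormedAddCommGroup V₂] [InnerProductSpace ℂ V₂]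

theorem exists_linearIsometry_of_norm_eq {S : Type*} [AddCommGroup S] [Module ℂ S]
    [CompleteSpace V₂] (A : S →ₗ[ℂ] V₁) (B : S →ₗ[ℂ] V₂) (hA : DenseRange A)
    (h : ∀ s, ‖B s‖ = ‖A s‖) : ∃ U : V₁ →ₗᵢ[ℂ] V₂, ∀ s, U (A s) = B s := by
  have hb : ∃ C : ℝ, ∀ s, ‖B s‖ ≤ C * ‖A s‖ := ⟨1, fun s => by rw [one_mul, h]⟩
  have he := LinearMap.extendOfNorm_eq hA hb
  refine ⟨⟨(B.extendOfNorm A).toLinearMap, fun x => ?_⟩, he⟩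
  refine hA.induction_on (p := fun x => ‖B.extendOfNorm A x‖ = ‖x‖) x ?_ fun s => ?_
  · exact isClosed_eq (by fun_prop) (by fun_prop)
  · rw [he, h]

theorem exists_linearIsometryEquiv_of_norm_eq {S : Type*} [AddCommGroup S] [Module ℂ S]
    [CompleteSpace V₁] [CompleteSpace V₂] (A : S →ₗ[ℂ] V₁) (B : S →ₗ[ℂ] V₂) (hA : DenseRange A)
    (hB : DenseRange B) (h : ∀ s, ‖B s‖ = ‖A s‖) :
    ∃ U : V₁ ≃ₗᵢ[ℂ] V₂, ∀ s, U (A s) = B s := by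
  obtain ⟨U, hU⟩ := exists_linearIsometry_of_norm_eq A B hA h
  refine ⟨LinearIsometryEquiv.ofSurjective U ?_, hU⟩
  have hc : IsClosed (Set.range U) := U.isometry.isClosedEmbedding.isClosed_range
  refine Set.range_eq_univ.1 (hc.closure_eq.symm.trans (Dense.closure_eq ?_))
  refine hB.mono ?_
  rintro _ ⟨s, rfl⟩
  exact ⟨A s, hU s⟩

theorem norm_linearCombination_eq {Ω : Type*} {κ₁ : Ω → V₁} {κ₂ : Ω → V₂}
    (h : ∀ ω ω', ⟪κ₁ ω, κ₁ ω'⟫_ℂ = ⟪κ₂ ω, κ₂ ω'⟫_ℂ) (s : Ω →₀ ℂ) :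
    ‖Finsupp.linearCombination ℂ κ₂ s‖ = ‖Finsupp.linearCombination ℂ κ₁ s‖ := by
  have e : ⟪Finsupp.linearCombination ℂ κ₂ s, Finsupp.linearCombination ℂ κ₂ s⟫_ℂ =
      ⟪Finsupp.linearCombination ℂ κ₁ s, Finsupp.linearCombination ℂ κ₁ s⟫_ℂ := by
    simp only [Finsupp.linearCombination_apply, Finsupp.sum_inner, Finsupp.inner_sum,
      inner_smul_left, inner_smul_right, h]
  rw [@norm_eq_sqrt_re_inner ℂ, @norm_eq_sqrt_re_inner ℂ, e]

theorem denseRange_linearCombination {Ω : Type*} {κ : Ω → V₁}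
    (h : Dense (Submodule.span ℂ (Set.range κ) : Set V₁)) :
    DenseRange (Finsupp.linearCombination ℂ κ) := by
  rw [DenseRange, ← LinearMap.coe_range, Finsupp.range_linearCombination]
  exact h

/-- Two total families with the same Gram matrix are related by a unitary operator. -/
theorem exists_linearIsometryEquiv_of_inner_eq {Ω : Type*} [CompleteSpace V₁] [CompleteSpace V₂]
    {κ₁ : Ω → V₁} {κ₂ : Ω → V₂} (h₁ : Dense (Submodule.span ℂ (Set.range κ₁) : Set V₁))
    (h₂ : Dense (Submodule.span ℂ (Set.range κ₂) : Set V₂))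
    (h : ∀ ω ω', ⟪κ₁ ω, κ₁ ω'⟫_ℂ = ⟪κ₂ ω, κ₂ ω'⟫_ℂ) :
    ∃ U : V₁ ≃ₗᵢ[ℂ] V₂, ∀ ω, U (κ₁ ω) = κ₂ ω := by
  obtain ⟨U, hU⟩ := exists_linearIsometryEquiv_of_norm_eq _ _ (denseRange_linearCombination h₁)
    (denseRange_linearCombination h₂) (norm_linearCombination_eq h)
  exact ⟨U, fun ω => by simpa using hU (Finsupp.single ω 1)⟩

/-- Continuous linear maps that agree on a total family agree. -/
theorem eq_of_eqOn_total {F : Type*} [NormedAddCommGroup F] [NormedSpace ℂ F] {Ω : Type*}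
    {κ : Ω → V₁} (h : Dense (Submodule.span ℂ (Set.range κ) : Set V₁)) {S T : V₁ →L[ℂ] F}
    (he : ∀ ω, S (κ ω) = T (κ ω)) (v : V₁) : S v = T v := by
  have : S = T := by
    refine ContinuousLinearMap.ext_on h ?_
    rintro _ ⟨ω, rfl⟩
    exact he ω
  rw [this]

theorem eq_zero_of_inner_total {Ω : Type*} {κ : Ω → V₁}
    (h : Dense (Submodule.span ℂ (Set.range κ) : Set V₁)) {u : V₁}
    (hu : ∀ ω, ⟪u, κ ω⟫_ℂ = 0) : u = 0 := by
  have := eq_of_eqOn_total h (S := innerSL ℂ u) (T := 0) (by simpa using hu) u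
  simpa using this

theorem dense_span_of_inner_eq_zero [CompleteSpace V₁] {Ω : Type*} {κ : Ω → V₁}
    (h : ∀ u : V₁, (∀ ω, ⟪u, κ ω⟫_ℂ = 0) → u = 0) :
    Dense (Submodule.span ℂ (Set.range κ) : Set V₁) := by
  rw [Submodule.dense_iff_topologicalClosure_eq_top,
    Submodule.topologicalClosure_eq_top_iff, Submodule.eq_bot_iff]
  intro u hu
  refine h u fun ω => ?_
  exact Submodule.inner_left_of_mem_orthogonal (Submodule.subset_span (Set.mem_range_self ω)) hu

/-- A bound for the quadratic form of an operator bounds the operator. -/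
theorem opNorm_le_of_quadratic_le {T : V₁ →L[ℂ] V₁} {C : ℝ} (hC : 0 ≤ C)
    (h : ∀ v, ‖⟪T v, v⟫_ℂ‖ ≤ C * ‖v‖ ^ 2) : ‖T‖ ≤ 2 * C := by
  have key : ∀ x y : V₁, ‖⟪T y, x⟫_ℂ‖ ≤ C * (‖x‖ ^ 2 + ‖y‖ ^ 2) := by
    intro x y
    have e := inner_map_polarization (T : V₁ →ₗ[ℂ] V₁) x y
    simp only [ContinuousLinearMap.coe_coe] at e
    have h1 := h (x + y)
    have h2 := h (x - y)
    have h3 := h (x + Complex.I • y)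
    have h4 := h (x - Complex.I • y)
    have p1 := parallelogram_law_with_norm ℂ x y
    have p2 := parallelogram_law_with_norm ℂ x (Complex.I • y)
    rw [norm_smul, Complex.norm_I, one_mul] at p2
    have hn : ‖⟪T (x + y), x + y⟫_ℂ - ⟪T (x - y), x - y⟫_ℂ +
        Complex.I * ⟪T (x + Complex.I • y), x + Complex.I • y⟫_ℂ -
        Complex.I * ⟪T (x - Complex.I • y), x - Complex.I • y⟫_ℂ‖ ≤
        C * ‖x + y‖ ^ 2 + C * ‖x - y‖ ^ 2 + C * ‖x + Complex.I • y‖ ^ 2 +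
          C * ‖x - Complex.I • y‖ ^ 2 := by
      refine (norm_sub_le _ _).trans (add_le_add ((norm_add_le _ _).trans (add_le_add
        ((norm_sub_le _ _).trans (add_le_add h1 h2)) ?_)) ?_)
      · rw [norm_mul, Complex.norm_I, one_mul]; exact h3
      · rw [norm_mul, Complex.norm_I, one_mul]; exact h4
    rw [e, norm_div]
    have : ‖(4 : ℂ)‖ = 4 := by simp
    rw [this, div_le_iff₀ (by norm_num)]
    refine hn.trans (le_of_eq ?_)
    linear_combination C * p1 + C * p2
  refine T.opNorm_le_of_unit_norm (by positivity) fun x hx => ?_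
  have : ‖T x‖ ^ 2 = ‖⟪T x, T x⟫_ℂ‖ := by
    rw [inner_self_eq_norm_sq_to_K]; simp
  by_cases h0 : T x = 0
  · rw [h0, norm_zero]; positivity
  have hpos : 0 < ‖T x‖ := norm_pos_iff.2 h0
  -- test against the unit vector in the direction of `T x`
  have k := key ((‖T x‖⁻¹ : ℂ) • T x) x
  rw [inner_smul_right, inner_self_eq_norm_sq_to_K, norm_smul, hx] at k
  simp only [norm_mul, norm_inv, Complex.norm_real, norm_norm, norm_pow,
    Complex.coe_algebraMap] at k
  rw [inv_mul_cancel₀ hpos.ne'] at k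
  calc ‖T x‖ = ‖T x‖⁻¹ * ‖T x‖ ^ 2 := by field_simp
    _ ≤ _ := k
    _ = _ := by ring

/-- A separable Hilbert space is isometric to one in any prescribed universe. -/
theorem exists_linearIsometryEquiv_type.{u', v'} (V : Type u') [NormedAddCommGroup V]
    [InnerProductSpace ℂ V]
    [CompleteSpace V] [TopologicalSpace.SeparableSpace V] :
    ∃ (K : Type v') (_ : NormedAddCommGroup K) (_ : InnerProductSpace ℂ K) (_ : CompleteSpace K),
      Nonempty (V ≃ₗᵢ[ℂ] K) := by
  obtain ⟨w, b, hb⟩ := exists_hilbertBasis ℂ V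
  have hw : w.Countable := by
    have ho : Orthonormal ℂ ((↑) : w → V) := hb ▸ b.orthonormal
    refine Set.PairwiseDisjoint.countable_of_isOpen (s := fun x : V => Metric.ball x (1 / 2))
      (fun x hx y hy hxy => ?_) (fun _ _ => Metric.isOpen_ball) fun x _ => ⟨x, by simp⟩
    refine Metric.ball_disjoint_ball ?_
    have h1 : ⟪x, y⟫_ℂ = 0 := ho.2 (i := ⟨x, hx⟩) (j := ⟨y, hy⟩) (by simpa using hxy)
    have h2 := @norm_sub_sq ℂ V _ _ _ x y
    rw [h1, show ‖x‖ = 1 from ho.1 ⟨x, hx⟩, show ‖y‖ = 1 from ho.1 ⟨y, hy⟩] at h2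
    rw [dist_eq_norm]
    simp only [map_zero] at h2
    nlinarith [norm_nonneg (x - y)]
  have := hw.to_subtype
  obtain ⟨f, hf⟩ := exists_injective_nat w
  let e : ULift.{v'} (Set.range f) ≃ w := Equiv.ulift.trans (Equiv.ofInjective f hf).symm
  let b' : HilbertBasis (ULift.{v'} (Set.range f)) ℂ V :=
    HilbertBasis.mk (v := b ∘ e) (b.orthonormal.comp e e.injective) (by
      rw [e.surjective.range_comp]
      exact b.dense_span.ge)
  exact ⟨_, _, _, inferInstance, ⟨b'.repr⟩⟩

/-- A continuous positive semidefinite kernel on a separable space is the Gram matrix of a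
continuous total family in a separable Hilbert space. -/
theorem exists_hilbert_of_kernel.{u', v'} {Ω : Type u'} [TopologicalSpace Ω]
    [TopologicalSpace.SeparableSpace Ω] (k : Ω → Ω → ℂ)
    (hk : Continuous fun p : Ω × Ω => k p.1 p.2)
    (hsymm : ∀ a b, star (k a b) = k b a)
    (hpos : ∀ s : Ω →₀ ℂ, 0 ≤ (s.sum fun a z => s.sum fun b w => star z * k a b * w).re) :
    ∃ (K : Type v') (_ : NormedAddCommGroup K) (_ : InnerProductSpace ℂ K) (_ : CompleteSpace K)
      (_ : TopologicalSpace.SeparableSpace K) (κ : Ω → K), Continuous κ ∧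
      (∀ a b, ⟪κ a, κ b⟫_ℂ = k a b) ∧ Dense (Submodule.span ℂ (Set.range κ) : Set K) := by
  let M : Matrix Ω Ω (ℂ →L[ℂ] ℂ) := Matrix.of fun a b => k a b • (1 : ℂ →L[ℂ] ℂ)
  have hM : M.PosSemidef := by
    have h := (RKHS.posSemidef_tfae (K := M)).out 0 2
    refine h.2 ⟨?_, fun s => ?_⟩
    · ext a b
      simp [M, ← hsymm b a, Matrix.conjTranspose_apply]
    · refine (hpos s).trans (le_of_eq (congrArg Complex.re ?_))
      refine Finsupp.sum_congr fun a _ => Finsupp.sum_congr fun b _ => ?_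
      simp [M, ← hsymm a b]
      ring
  have : Fact M.PosSemidef := ⟨hM⟩
  let κ₀ : Ω → RKHS.OfKernel M := fun a => RKHS.kerFun (RKHS.OfKernel M) a 1
  have hκ : ∀ a b, ⟪κ₀ a, κ₀ b⟫_ℂ = k a b := by
    intro a b
    rw [← RKHS.kernel_inner, RKHS.OfKernel.kernel_ofKernel]
    simp [M, ← hsymm a b]
  have hd : Dense (Submodule.span ℂ (Set.range κ₀) : Set (RKHS.OfKernel M)) := by
    rw [Submodule.dense_iff_topologicalClosure_eq_top, ← RKHS.kerFun_dense]
    congr 1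
    refine le_antisymm (Submodule.span_mono ?_) (Submodule.span_le.2 ?_)
    · rintro _ ⟨a, rfl⟩
      exact ⟨a, 1, rfl⟩
    · rintro _ ⟨a, z, rfl⟩
      have : RKHS.kerFun (RKHS.OfKernel M) a z = z • κ₀ a := by
        rw [← map_smul, smul_eq_mul, mul_one]
      rw [this]
      exact Submodule.smul_mem _ _ (Submodule.subset_span ⟨a, rfl⟩)
  have hc : Continuous κ₀ := by
    rw [continuous_iff_continuousAt]
    intro a
    rw [ContinuousAt, tendsto_iff_norm_sub_tendsto_zero]
    have e : ∀ b, ‖κ₀ b - κ₀ a‖ = √(k b b - k b a - k a b + k a a).re := by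
      intro b
      rw [@norm_eq_sqrt_re_inner ℂ, inner_sub_left, inner_sub_right, inner_sub_right, hκ, hκ, hκ,
        hκ]
      rw [show k b b - k b a - k a b + k a a = k b b - k b a - (k a b - k a a) by ring]
      rfl
    simp_rw [e]
    have hcont : Continuous fun b => √(k b b - k b a - k a b + k a a).re := by
      have h1 : Continuous fun b => k b b := hk.comp (continuous_id.prodMk continuous_id)
      have h2 : Continuous fun b => k b a := hk.comp (continuous_id.prodMk continuous_const)
      have h3 : Continuous fun b => k a b := hk.comp (continuous_const.prodMk continuous_id)
      fun_prop
    simpa using hcont.tendsto a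
  have hs : TopologicalSpace.SeparableSpace (RKHS.OfKernel M) := by
    have h1 : TopologicalSpace.IsSeparable (Submodule.span ℂ (Set.range κ₀) :
        Set (RKHS.OfKernel M)) :=
      (TopologicalSpace.isSeparable_range hc).span
    rw [← TopologicalSpace.isSeparable_univ_iff, ← hd.closure_eq]
    exact h1.closure
  obtain ⟨K, i₁, i₂, hK, ⟨e⟩⟩ := exists_linearIsometryEquiv_type.{_, v'} (RKHS.OfKernel M)
  have hsK : TopologicalSpace.SeparableSpace K :=
    e.surjective.denseRange.separableSpace e.continuous
  refine ⟨K, i₁, i₂, hK, hsK, e ∘ κ₀, e.continuous.comp hc, fun a b => ?_, ?_⟩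
  · rw [Function.comp_apply, Function.comp_apply, LinearIsometryEquiv.inner_map_map, hκ]
  have : Submodule.span ℂ (Set.range (e ∘ κ₀)) =
      (Submodule.span ℂ (Set.range κ₀)).map (e : _ →ₗ[ℂ] K) := by
    rw [Submodule.map_span, Set.range_comp]
    rfl
  rw [this]
  exact e.surjective.denseRange.dense_image e.continuous hd

end Hilbert

/-! ### Integrals of compactly supported functions over cosets -/

section Parametric

theorem continuous_integral_of_locally_compact_support {Z Y F : Type*} [TopologicalSpace Z]
    [TopologicalSpace Y] [MeasurableSpace Y] [OpensMeasurableSpace Y]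
    [NormedAddCommGroup F] [NormedSpace ℝ F] {μ : Measure Y} [IsFiniteMeasureOnCompacts μ]
    {f : Z → Y → F} (hf : Continuous f.uncurry)
    (hs : ∀ z₀, ∃ k : Set Y, IsCompact k ∧ ∀ᶠ z in 𝓝 z₀, ∀ y ∉ k, f z y = 0) :
    Continuous fun z => ∫ y, f z y ∂μ := by
  rw [continuous_iff_continuousAt]
  intro z₀
  obtain ⟨k, hk, hz⟩ := hs z₀
  exact (continuousOn_integral_of_compact_support (s := {z | ∀ y ∉ k, f z y = 0}) hk
    hf.continuousOn fun z y hz hy => hz y hy).continuousAt hz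

end Parametric

section Fold
variable {G : Type*} [Group G] [TopologicalSpace G] [IsTopologicalGroup G] [LocallyCompactSpace G]
  [T2Space G] [SecondCountableTopology G] [MeasurableSpace G] [BorelSpace G]

theorem exists_bump {U : Set G} (hU : U ∈ 𝓝 (1 : G)) : ∃ f : G → ℝ, Continuous f ∧
    HasCompactSupport f ∧ (∀ x, 0 ≤ f x) ∧ f 1 = 1 ∧ tsupport f ⊆ U := by
  obtain ⟨K, hK, hKU, hKc⟩ := LocallyCompactSpace.local_compact_nhds (1 : G) U hU
  obtain ⟨f, hf1, hf2, hf3, hf4⟩ := exists_continuousMap_one_of_isCompact_subset_isOpen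
    (isCompact_singleton (x := (1 : G))) isOpen_interior
    (Set.singleton_subset_iff.2 (mem_interior_iff_mem_nhds.2 hK))
  exact ⟨f, f.continuous, hf2, fun x => (hf4 x).1, hf1 rfl,
    hf3.trans (interior_subset.trans hKU)⟩

/-- Compare the integral of a bump function with the integrals of its right translates. -/
@[fun_prop]
theorem continuous_modularFunction : Continuous (modularFunction : G → ℝ≥0) := by
  obtain ⟨f, hf, hfc, hf0, hf1, -⟩ := exists_bump (G := G) Filter.univ_mem
  let μ : Measure G := haar
  have hpos : 0 < ∫ x, f x ∂μ :=
    hf.integral_pos_of_hasCompactSupport_nonneg_nonzero (x := 1) hfc hf0 (by simp [hf1])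
  have h1 : Continuous fun g : G => ∫ x, f (x * g) ∂μ := by
    refine continuous_integral_of_locally_compact_support (by
      change Continuous fun p : G × G => f (p.2 * p.1)
      fun_prop) fun g₀ => ?_
    obtain ⟨C, hC, hg⟩ := exists_compact_mem_nhds g₀
    refine ⟨tsupport f * C⁻¹, hfc.mul hC.inv, Filter.mem_of_superset hg fun g hgC x hx => ?_⟩
    refine image_eq_zero_of_notMem_tsupport fun h => hx ?_
    exact ⟨x * g, h, g⁻¹, by simpa using hgC, by simp⟩
  have h2 : ∀ g : G, (modularFunction g : ℝ) = (∫ x, f (x * g⁻¹) ∂μ) / ∫ x, f x ∂μ := by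
    intro g
    have e := map_mul_right_haar μ g⁻¹
    rw [inv_inv] at e
    rw [← integral_map (φ := fun x => x * g⁻¹) (by fun_prop) (by fun_prop), e,
      integral_smul_nnreal_measure]
    field_simp
    rfl
  refine NNReal.isEmbedding_coe.continuous_iff.2 ?_
  refine (((h1.comp continuous_inv).div_const (∫ x, f x ∂μ))).congr fun g => ?_
  exact (h2 g).symm

variable {H : Subgroup G} [hH : IsClosed (H : Set G)]

theorem continuous_modularRatio : Continuous (modularRatio H) :=
  continuous_modularFunction.div (continuous_modularFunction.comp continuous_subtype_val)
    fun _ => (modularFunction_pos _).ne'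

theorem modularRatio_pos (h : H) : 0 < modularRatio H h :=
  div_pos (modularFunction_pos _) (modularFunction_pos _)

theorem hasCompactSupport_coset {F : Type*} [Zero F] {a : G → F} (ha : HasCompactSupport a)
    (g : G) : HasCompactSupport fun h : H => a (g * h) :=
  (ha.comp_homeomorph (Homeomorph.mulLeft g)).comp_isClosedEmbedding
    hH.isClosedEmbedding_subtypeVal

variable (μH : Measure H) [μH.IsHaarMeasure]

theorem integrable_coset {F : Type*} [NormedAddCommGroup F] {a : G → F} (ha : Continuous a)
    (hc : HasCompactSupport a) (g : G) : Integrable (fun h : H => a (g * h)) μH :=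
  Continuous.integrable_of_hasCompactSupport (by fun_prop) (hasCompactSupport_coset hc g)

/-- The integral of `a` over the fibres of `G → G ⧸ H`: the value at `gH` is `∫ a (g h) dh`. The
definition uses a representative of the coset; by invariance of `μH` any other gives the same. -/
def fold (a : G → ℝ) (x : G ⧸ H) : ℝ := ∫ h : H, a (x.out * h) ∂μH

theorem fold_mk (a : G → ℝ) (g : G) : fold μH a (g : G ⧸ H) = ∫ h : H, a (g * h) ∂μH := by
  obtain ⟨k, hk⟩ := QuotientGroup.mk_out_eq_mul H g
  rw [fold, hk, ← integral_mul_left_eq_self (μ := μH) (fun h : H => a (g * h)) k]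
  simp [mul_assoc]

theorem continuous_fold {a : G → ℝ} (ha : Continuous a) (hc : HasCompactSupport a) :
    Continuous (fold μH a : G ⧸ H → ℝ) := by
  refine (QuotientGroup.isQuotientMap_mk (N := H)).continuous_iff.2 ?_
  have : (fold μH a ∘ QuotientGroup.mk : G → ℝ) = fun g => ∫ h : H, a (g * h) ∂μH :=
    funext fun g => fold_mk μH a g
  rw [this]
  refine continuous_integral_of_locally_compact_support (by
      change Continuous fun p : G × H => a (p.1 * p.2)
      fun_prop) fun g₀ => ?_
  obtain ⟨C, hC, hg⟩ := exists_compact_mem_nhds g₀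
  refine ⟨(↑) ⁻¹' (C⁻¹ * tsupport a),
    hH.isClosedEmbedding_subtypeVal.isCompact_preimage (hC.inv.mul hc),
    Filter.mem_of_superset hg fun g hgC h hh => ?_⟩
  refine image_eq_zero_of_notMem_tsupport fun hm => hh ?_
  exact ⟨g⁻¹, by simpa using hgC, g * h, hm, by simp⟩

/-- The integrals over the cosets of functions supported in a fixed compact set are bounded
uniformly by the supremum norm. -/
theorem exists_fold_bound {C : Set G} (hC : IsCompact C) : ∃ c : ℝ, 0 ≤ c ∧ ∀ a : G → ℝ,
    (∀ x ∉ C, a x = 0) → ∀ M : ℝ, 0 ≤ M → (∀ x, |a x| ≤ M) →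
      ∀ x : G ⧸ H, |fold μH a x| ≤ c * M := by
  let D : Set H := (↑) ⁻¹' (C⁻¹ * C)
  have hD : IsCompact D := hH.isClosedEmbedding_subtypeVal.isCompact_preimage (hC.inv.mul hC)
  refine ⟨μH.real D, measureReal_nonneg, fun a ha M hM hb x => ?_⟩
  obtain ⟨g, rfl⟩ := QuotientGroup.mk_surjective x
  by_cases hne : ∃ k : H, g * k ∈ C
  · obtain ⟨k, hk⟩ := hne
    have e : fold μH a (g : G ⧸ H) = ∫ h in D, a (g * k * h) ∂μH := by
      rw [fold_mk, ← integral_mul_left_eq_self (μ := μH) (fun h : H => a (g * h)) k]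
      refine (setIntegral_eq_integral_of_forall_compl_eq_zero (s := D) fun h hh => ?_).symm.trans ?_
      · refine ha _ fun hm => hh ?_
        exact ⟨(g * k)⁻¹, by simpa using hk, _, hm, by simp [mul_assoc]⟩
      · simp [mul_assoc]
    rw [e, ← Real.norm_eq_abs, mul_comm]
    exact norm_setIntegral_le_of_norm_le_const hD.measure_lt_top fun h _ => hb _
  · push Not at hne
    rw [fold_mk]
    simp only [ha _ (hne _), integral_zero, abs_zero]
    positivity

theorem fold_add {a b : G → ℝ} (ha : Continuous a) (hac : HasCompactSupport a)
    (hb : Continuous b) (hbc : HasCompactSupport b) (x : G ⧸ H) :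
    fold μH (fun y => a y + b y) x = fold μH a x + fold μH b x :=
  integral_add (integrable_coset μH ha hac _) (integrable_coset μH hb hbc _)

theorem fold_sub {a b : G → ℝ} (ha : Continuous a) (hac : HasCompactSupport a)
    (hb : Continuous b) (hbc : HasCompactSupport b) (x : G ⧸ H) :
    fold μH (fun y => a y - b y) x = fold μH a x - fold μH b x :=
  integral_sub (integrable_coset μH ha hac _) (integrable_coset μH hb hbc _)

theorem fold_const_mul (c : ℝ) (a : G → ℝ) (x : G ⧸ H) :
    fold μH (fun y => c * a y) x = c * fold μH a x :=
  integral_const_mul c _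

theorem fold_comp_mul_left (a : G → ℝ) (g : G) (x : G ⧸ H) :
    fold μH (fun y => a (g * y)) x = fold μH a (g • x) := by
  obtain ⟨k, rfl⟩ := QuotientGroup.mk_surjective x
  change _ = fold μH a ((g * k : G) : G ⧸ H)
  rw [fold_mk, fold_mk]
  simp [mul_assoc]

theorem integral_mul_right_haar {F : Type*} [NormedAddCommGroup F] [NormedSpace ℝ F]
    (μ : Measure G) [μ.IsHaarMeasure] (f : G → F) (g : G) :
    ∫ x, f (x * g) ∂μ = (modularFunction g⁻¹ : ℝ) • ∫ x, f x ∂μ := by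
  have e := map_mul_right_haar μ g
  have h := integral_map_equiv (μ := μ) (MeasurableEquiv.mulRight g) f
  have e' : map (MeasurableEquiv.mulRight g) μ = modularFunction g⁻¹ • μ := e
  rw [e', integral_smul_nnreal_measure] at h
  exact h.symm

theorem fold_comp_mul_right (a : G → ℝ) (k : H) (x : G ⧸ H) :
    fold μH (fun y => a (y * k)) x = modularFunction k⁻¹ * fold μH a x := by
  rw [fold, fold, ← smul_eq_mul, ← integral_mul_right_haar μH]
  simp [mul_assoc]

theorem integral_bruhat (θ : BruhatFunction H μH) (g : G) :
    ∫ h : H, (θ.toFun (g * h) : ℝ) ∂μH = 1 := by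
  have hc := θ.continuous_toFun
  rw [integral_eq_lintegral_of_nonneg_ae (Filter.Eventually.of_forall fun _ => NNReal.coe_nonneg _)
    (by fun_prop)]
  simp [θ.lintegral_toFun]

theorem fold_bruhat_mul (θ : BruhatFunction H μH) (ψ : G ⧸ H → ℝ) (x : G ⧸ H) :
    fold μH (fun g => θ.toFun g * ψ (g : G ⧸ H)) x = ψ x := by
  obtain ⟨g, rfl⟩ := QuotientGroup.mk_surjective x
  rw [fold_mk]
  have : ∀ h : H, (QuotientGroup.mk (g * h) : G ⧸ H) = QuotientGroup.mk g := fun h =>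
    QuotientGroup.mk_mul_of_mem g h.2
  simp_rw [this]
  rw [integral_mul_const, integral_bruhat, one_mul]

/-- Every compact subset of `G ⧸ H` is the image of a compact subset of `G`. -/
theorem exists_isCompact_image_mk {C : Set (G ⧸ H)} (hC : IsCompact C) :
    ∃ K : Set G, IsCompact K ∧ C ⊆ (QuotientGroup.mk : G → G ⧸ H) '' K := by
  choose K hK hKn using fun g : G => exists_compact_mem_nhds g
  obtain ⟨t, ht⟩ := hC.elim_finite_subcover
    (fun g : G => (QuotientGroup.mk : G → G ⧸ H) '' interior (K g))
    (fun g => QuotientGroup.isOpenMap_coe _ isOpen_interior) (fun x _ => by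
      obtain ⟨g, rfl⟩ := QuotientGroup.mk_surjective x
      exact Set.mem_iUnion.2 ⟨g, g, mem_interior_iff_mem_nhds.2 (hKn g), rfl⟩)
  refine ⟨⋃ g ∈ t, K g, t.isCompact_biUnion fun g _ => hK g, ht.trans ?_⟩
  rw [Set.image_iUnion₂]
  exact Set.iUnion₂_mono fun g _ => Set.image_mono interior_subset

theorem hasCompactSupport_bruhat_mul (θ : BruhatFunction H μH) {ψ : G ⧸ H → ℝ}
    (hψ : HasCompactSupport ψ) :
    HasCompactSupport fun g => (θ.toFun g : ℝ) * ψ (g : G ⧸ H) := by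
  obtain ⟨K, hK, hKC⟩ := exists_isCompact_image_mk hψ
  refine HasCompactSupport.intro (θ.isCompact_inter_tsupport K hK) fun g hg => ?_
  by_contra hne
  have h1 : θ.toFun g ≠ 0 := fun h => hne (by simp [h])
  have h2 : ψ g ≠ 0 := fun h => hne (by simp [h])
  obtain ⟨k, hk, hkg⟩ := hKC (subset_tsupport _ h2)
  refine hg ⟨⟨k, hk, k⁻¹ * g, QuotientGroup.eq.1 hkg, by simp⟩, subset_tsupport _ h1⟩

end Fold

/-! ### Operator integrals against a localisation observable -/

section Observable
open scoped InnerProductSpace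

/-- The Borel structure of the coset space, given precedence over the quotient structure. -/
instance instMeasurableSpaceCosets {G : Type*} [Group G] [TopologicalSpace G] (H : Subgroup G) :
    MeasurableSpace (G ⧸ H) := borel _

instance instBorelSpaceCosets {G : Type*} [Group G] [TopologicalSpace G] (H : Subgroup G) :
    BorelSpace (G ⧸ H) := ⟨rfl⟩

variable {G : Type*} [Group G] [TopologicalSpace G] [IsTopologicalGroup G] [LocallyCompactSpace G]
  [T2Space G] [SecondCountableTopology G] [MeasurableSpace G] [BorelSpace G]
  {H : Subgroup G} [hH : IsClosed (H : Set G)]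
  {V : Type*} [NormedAddCommGroup V] [InnerProductSpace ℂ V] [CompleteSpace V]
  {π : UnitaryRep G V} (E : LocalisationObservable H π)

namespace UnitaryRep

theorem map_mul_apply (π : UnitaryRep G V) (g k : G) (v : V) : π (g * k) v = π g (π k v) := by
  rw [map_mul]; rfl

theorem map_one_apply (π : UnitaryRep G V) (v : V) : π 1 v = v := by
  rw [map_one]; rfl

theorem inv_apply_apply (π : UnitaryRep G V) (g : G) (v : V) : π g⁻¹ (π g v) = v := by
  rw [← map_mul_apply, inv_mul_cancel, map_one_apply]

theorem inner_apply_left (π : UnitaryRep G V) (g : G) (v w : V) :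
    ⟪π g v, w⟫_ℂ = ⟪v, π g⁻¹ w⟫_ℂ := by
  rw [← (π g⁻¹).inner_map_map, inv_apply_apply]

/-- Strong continuity, jointly in the group element and the vector. -/
theorem continuous_uncurry (π : UnitaryRep G V) : Continuous fun p : G × V => π p.1 p.2 := by
  rw [continuous_iff_continuousAt]
  rintro ⟨g₀, v₀⟩
  rw [ContinuousAt, tendsto_iff_norm_sub_tendsto_zero]
  have h1 : Filter.Tendsto (fun p : G × V => ‖p.2 - v₀‖ + ‖π p.1 v₀ - π g₀ v₀‖) (𝓝 (g₀, v₀))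
      (𝓝 0) := by
    have hc : Continuous fun p : G × V => ‖p.2 - v₀‖ + ‖π p.1 v₀ - π g₀ v₀‖ := by
      have := (π.continuous_apply v₀).comp (continuous_fst (X := G) (Y := V))
      simp only [Function.comp_def] at this
      fun_prop
    simpa using hc.tendsto (g₀, v₀)
  refine squeeze_zero (fun _ => norm_nonneg _) (fun p => ?_) h1
  calc ‖π p.1 p.2 - π g₀ v₀‖ = ‖π p.1 (p.2 - v₀) + (π p.1 v₀ - π g₀ v₀)‖ := by
        rw [map_sub]; congr 1; abel
    _ ≤ _ := (norm_add_le _ _).trans (by rw [LinearIsometryEquiv.norm_map])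

end UnitaryRep

namespace LocalisationObservable

theorem inner_self_nonneg {Y : Set (G ⧸ H)} (hY : MeasurableSet Y) (v : V) :
    0 ≤ (⟪E Y v, v⟫_ℂ).re :=
  (E.isPositive Y hY).re_inner_nonneg_left v

theorem inner_self_im {Y : Set (G ⧸ H)} (hY : MeasurableSet Y) (v : V) :
    (⟪E Y v, v⟫_ℂ).im = 0 := by
  have := (E.isPositive Y hY).isSelfAdjoint.isSymmetric.im_inner_apply_self v
  exact this

/-- The scalar measure `Y ↦ ⟨E(Y) v, v⟩`. -/
def measure (v : V) : Measure (G ⧸ H) :=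
  Measure.ofMeasurable (fun Y _ => ENNReal.ofReal (⟪E Y v, v⟫_ℂ).re) (by simp [E.empty])
    (fun Y hY hd => by
      have h2 : HasSum (fun n => (⟪E (Y n) v, v⟫_ℂ).re) (⟪E (⋃ n, Y n) v, v⟫_ℂ).re := by
        exact Complex.hasSum_re (HasSum.map (E.hasSum_iUnion Y hY hd v) ((innerSL ℂ).flip v)
          ((innerSL ℂ).flip v).continuous)
      rw [← h2.tsum_eq]
      exact ENNReal.ofReal_tsum_of_nonneg (fun n => E.inner_self_nonneg (hY n) v) h2.summable)

theorem measure_apply (v : V) {Y : Set (G ⧸ H)} (hY : MeasurableSet Y) :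
    E.measure v Y = ENNReal.ofReal (⟪E Y v, v⟫_ℂ).re :=
  Measure.ofMeasurable_apply Y hY

instance (v : V) : IsFiniteMeasure (E.measure v) :=
  ⟨by rw [measure_apply E v MeasurableSet.univ]; exact ENNReal.ofReal_lt_top⟩

theorem measureReal_eq (v : V) {Y : Set (G ⧸ H)} (hY : MeasurableSet Y) :
    (((E.measure v).real Y : ℝ) : ℂ) = ⟪E Y v, v⟫_ℂ := by
  rw [measureReal_def, measure_apply E v hY, ENNReal.toReal_ofReal (E.inner_self_nonneg hY v)]
  exact Complex.ext rfl (E.inner_self_im hY v).symm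

theorem measureReal_univ_le (v : V) : (E.measure v).real Set.univ ≤ ‖E Set.univ‖ * ‖v‖ ^ 2 := by
  rw [measureReal_def, measure_apply E v .univ, ENNReal.toReal_ofReal (E.inner_self_nonneg .univ v)]
  refine (Complex.re_le_norm _).trans ((norm_inner_le_norm _ _).trans ?_)
  rw [pow_two, ← mul_assoc]
  gcongr
  exact (E Set.univ).le_opNorm v

theorem measure_map_smul (g : G) (v : V) : E.measure (π g v) = map (g • ·) (E.measure v) := by
  have hm : Measurable fun x : G ⧸ H => g • x := (continuous_const_smul g).measurable
  refine Measure.ext fun Y hY => ?_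
  rw [map_apply hm hY, measure_apply E _ hY, measure_apply E _ (hm hY)]
  have e : (g • · : G ⧸ H → G ⧸ H) ⁻¹' Y = g⁻¹ • Y := Set.preimage_smul g Y
  rw [e, ← E.covariant g⁻¹ Y hY v, inv_inv, π.inner_apply_left, inv_inv]

theorem exists_operator_of_simpleFunc (s : SimpleFunc (G ⧸ H) ℝ) :
    ∃ T : V →L[ℂ] V, ∀ v, ⟪T v, v⟫_ℂ = ((∫ x, s x ∂(E.measure v) : ℝ) : ℂ) := by
  refine ⟨∑ r ∈ s.range, (r : ℂ) • E (s ⁻¹' {r}), fun v => ?_⟩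
  rw [← SimpleFunc.integral_eq_integral _ (s.integrable_of_isFiniteMeasure),
    SimpleFunc.integral_eq, _root_.sum_apply, sum_inner, Complex.ofReal_sum]
  refine Finset.sum_congr rfl fun r _ => ?_
  rw [_root_.smul_apply, inner_smul_left, smul_eq_mul, Complex.ofReal_mul,
    E.measureReal_eq v (s.measurableSet_fiber r), Complex.conj_ofReal, mul_comm]

theorem norm_integral_measure_le {ψ : G ⧸ H → ℝ} {M : ℝ} (hM : 0 ≤ M) (hb : ∀ x, |ψ x| ≤ M)
    (v : V) : |∫ x, ψ x ∂(E.measure v)| ≤ M * ‖E Set.univ‖ * ‖v‖ ^ 2 := by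
  rw [mul_assoc]
  exact (norm_integral_le_of_norm_le_const (f := ψ) (Filter.Eventually.of_forall hb)).trans
    (mul_le_mul_of_nonneg_left (E.measureReal_univ_le v) hM)

theorem integrable_of_bounded {ψ : G ⧸ H → ℝ} (hm : Measurable ψ) {M : ℝ} (hb : ∀ x, |ψ x| ≤ M)
    (v : V) : Integrable ψ (E.measure v) :=
  Integrable.of_bound hm.aestronglyMeasurable M (Filter.Eventually.of_forall hb)

theorem exists_simpleFunc_uniform_approx {X : Type*} [MeasurableSpace X] {ψ : X → ℝ}
    (hm : Measurable ψ) {M : ℝ} (hb : ∀ x, |ψ x| ≤ M) (n : ℕ) :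
    ∃ s : SimpleFunc X ℝ, ∀ x, |s x - ψ x| ≤ 1 / ((n : ℝ) + 1) := by
  have hn : (0 : ℝ) < (n : ℝ) + 1 := by positivity
  have hmeas : Measurable fun x => ⌊((n : ℝ) + 1) * ψ x⌋ := (hm.const_mul _).floor
  refine ⟨⟨fun x => (⌊((n : ℝ) + 1) * ψ x⌋ : ℝ) / ((n : ℝ) + 1), fun r => ?_, ?_⟩, fun x => ?_⟩
  · have h : Measurable fun x => (⌊((n : ℝ) + 1) * ψ x⌋ : ℝ) / ((n : ℝ) + 1) :=
      (measurable_from_top.comp hmeas).div_const _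
    exact h (measurableSet_singleton r)
  · refine ((Set.finite_Icc ⌊-(((n : ℝ) + 1) * M)⌋ ⌊((n : ℝ) + 1) * M⌋).image
      fun k : ℤ => (k : ℝ) / ((n : ℝ) + 1)).subset ?_
    rintro _ ⟨x, rfl⟩
    refine ⟨_, ⟨Int.floor_le_floor ?_, Int.floor_le_floor ?_⟩, rfl⟩
    · rw [← mul_neg]
      exact mul_le_mul_of_nonneg_left (abs_le.1 (hb x)).1 hn.le
    · exact mul_le_mul_of_nonneg_left (abs_le.1 (hb x)).2 hn.le
  · have h1 := Int.floor_le (((n : ℝ) + 1) * ψ x)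
    have h2 := Int.lt_floor_add_one (((n : ℝ) + 1) * ψ x)
    change |(⌊((n : ℝ) + 1) * ψ x⌋ : ℝ) / ((n : ℝ) + 1) - ψ x| ≤ _
    have : (⌊((n : ℝ) + 1) * ψ x⌋ : ℝ) / ((n : ℝ) + 1) - ψ x =
        ((⌊((n : ℝ) + 1) * ψ x⌋ : ℝ) - ((n : ℝ) + 1) * ψ x) / ((n : ℝ) + 1) := by
      field_simp
    rw [this, abs_div, abs_of_pos hn]
    gcongr
    rw [abs_le]
    constructor <;> linarith

/-- The operator integral `∫ ψ dE` of a bounded measurable function exists: it is the norm limit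
of the integrals of simple functions, because the norm of an operator is controlled by its
quadratic form. -/
theorem exists_operator_of_bounded {ψ : G ⧸ H → ℝ} (hm : Measurable ψ) {M : ℝ}
    (hb : ∀ x, |ψ x| ≤ M) :
    ∃ T : V →L[ℂ] V, ∀ v, ⟪T v, v⟫_ℂ = ((∫ x, ψ x ∂(E.measure v) : ℝ) : ℂ) := by
  choose s hs using exists_simpleFunc_uniform_approx hm hb
  choose T hT using fun n => E.exists_operator_of_simpleFunc (s n)
  have hi : ∀ n v, Integrable (s n) (E.measure v) := fun n v =>
    (s n).integrable_of_isFiniteMeasure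
  have hC : CauchySeq T := by
    refine cauchySeq_of_le_tendsto_0 (fun N => 2 * (2 * (1 / ((N : ℝ) + 1)) * ‖E Set.univ‖))
      (fun n m N hn hm => ?_) ?_
    · rw [dist_eq_norm]
      refine opNorm_le_of_quadratic_le (by positivity) fun v => ?_
      rw [_root_.sub_apply, inner_sub_left, hT, hT, ← Complex.ofReal_sub,
        ← integral_sub (hi n v) (hi m v), Complex.norm_real]
      refine E.norm_integral_measure_le (by positivity) (fun x => ?_) v
      have h1 := hs n x
      have h2 := hs m x
      have h3 : 1 / ((n : ℝ) + 1) ≤ 1 / ((N : ℝ) + 1) := Nat.one_div_le_one_div hn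
      have h4 : 1 / ((m : ℝ) + 1) ≤ 1 / ((N : ℝ) + 1) := Nat.one_div_le_one_div hm
      rw [abs_le] at h1 h2 ⊢
      constructor <;> linarith
    · have := (tendsto_one_div_add_atTop_nhds_zero_nat (𝕜 := ℝ)).const_mul (2 : ℝ)
      simpa using (this.mul_const ‖E Set.univ‖).const_mul 2
  obtain ⟨T₀, hT₀⟩ := cauchySeq_tendsto_of_complete hC
  refine ⟨T₀, fun v => ?_⟩
  have h1 : Filter.Tendsto (fun n => ⟪T n v, v⟫_ℂ) Filter.atTop (𝓝 ⟪T₀ v, v⟫_ℂ) := by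
    have hc : Continuous fun S : V →L[ℂ] V => ⟪S v, v⟫_ℂ := by fun_prop
    exact (hc.tendsto T₀).comp hT₀
  refine tendsto_nhds_unique h1 ?_
  simp_rw [hT]
  refine (Complex.continuous_ofReal.tendsto _).comp ?_
  rw [tendsto_iff_norm_sub_tendsto_zero]
  have h2 := (tendsto_one_div_add_atTop_nhds_zero_nat (𝕜 := ℝ)).mul_const
    (‖E Set.univ‖ * ‖v‖ ^ 2)
  rw [zero_mul] at h2
  refine squeeze_zero (fun _ => norm_nonneg _) (fun n => ?_) h2
  rw [← integral_sub (hi n v) (E.integrable_of_bounded hm hb v), ← mul_assoc]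
  exact E.norm_integral_measure_le (by positivity) (hs n) v

end LocalisationObservable
end Observable

/-! ### The observable lifted to compactly supported functions on the group -/

section Lift
open scoped InnerProductSpace

variable {G : Type*} [Group G] [TopologicalSpace G] [IsTopologicalGroup G] [LocallyCompactSpace G]
  [T2Space G] [SecondCountableTopology G] [MeasurableSpace G] [BorelSpace G]
  {H : Subgroup G} [hH : IsClosed (H : Set G)] (μH : Measure H) [μH.IsHaarMeasure]
  {V : Type*} [NormedAddCommGroup V] [InnerProductSpace ℂ V] [CompleteSpace V]
  {π : UnitaryRep G V} (E : LocalisationObservable H π)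

namespace LocalisationObservable

theorem exists_fold_le {a : G → ℝ} (ha : Continuous a) (hc : HasCompactSupport a) :
    ∃ M, ∀ x : G ⧸ H, |fold μH a x| ≤ M := by
  obtain ⟨c, -, hb⟩ := exists_fold_bound μH hc.isCompact
  obtain ⟨M, hM⟩ := ha.bounded_above_of_compact_support hc
  exact ⟨_, hb a (fun x hx => image_eq_zero_of_notMem_tsupport hx) M
    ((norm_nonneg _).trans (hM 1)) hM⟩

theorem integrable_fold {a : G → ℝ} (ha : Continuous a) (hc : HasCompactSupport a) (v : V) :
    Integrable (fold μH a) (E.measure v) := by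
  obtain ⟨M, hM⟩ := exists_fold_le (H := H) μH ha hc
  exact E.integrable_of_bounded (continuous_fold μH ha hc).measurable hM v

open Classical in
/-- The operator `∫ a♭ dE` where `a♭ = fold μH a` is obtained from `a : G → ℝ`, continuous with
compact support, by integration over the cosets. -/
def lift (a : G → ℝ) : V →L[ℂ] V :=
  if h : ∃ T : V →L[ℂ] V, ∀ v, ⟪T v, v⟫_ℂ = ((∫ x, fold μH a x ∂(E.measure v) : ℝ) : ℂ) then
    h.choose else 0

theorem inner_lift_self {a : G → ℝ} (ha : Continuous a) (hc : HasCompactSupport a) (v : V) :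
    ⟪E.lift μH a v, v⟫_ℂ = ((∫ x, fold μH a x ∂(E.measure v) : ℝ) : ℂ) := by
  obtain ⟨M, hM⟩ := exists_fold_le (H := H) μH ha hc
  have h := E.exists_operator_of_bounded (continuous_fold μH ha hc).measurable hM
  rw [lift, dif_pos h]
  exact h.choose_spec v

theorem eq_lift {a : G → ℝ} (ha : Continuous a) (hc : HasCompactSupport a) {T : V →L[ℂ] V}
    (h : ∀ v, ⟪T v, v⟫_ℂ = ((∫ x, fold μH a x ∂(E.measure v) : ℝ) : ℂ)) : T = E.lift μH a := by
  have := (ext_inner_map (T : V →ₗ[ℂ] V) (E.lift μH a : V →ₗ[ℂ] V)).1 fun v => by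
    simp only [ContinuousLinearMap.coe_coe]
    rw [h, E.inner_lift_self μH ha hc]
  exact ContinuousLinearMap.coe_injective this

theorem lift_sub {a b : G → ℝ} (ha : Continuous a) (hac : HasCompactSupport a)
    (hb : Continuous b) (hbc : HasCompactSupport b) :
    E.lift μH (fun x => a x - b x) = E.lift μH a - E.lift μH b := by
  refine (E.eq_lift μH (a := fun x => a x - b x) (ha.sub hb) (hac.sub hbc) fun v => ?_).symm
  rw [_root_.sub_apply, inner_sub_left, E.inner_lift_self μH ha hac,
    E.inner_lift_self μH hb hbc, ← Complex.ofReal_sub, ← integral_sub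
    (E.integrable_fold μH ha hac v) (E.integrable_fold μH hb hbc v)]
  simp_rw [fold_sub μH ha hac hb hbc]

theorem lift_const_mul (c : ℝ) {a : G → ℝ} (ha : Continuous a) (hac : HasCompactSupport a) :
    E.lift μH (fun x => c * a x) = (c : ℂ) • E.lift μH a := by
  refine (E.eq_lift μH (a := fun x => c * a x) (ha.const_mul c)
    (hac.mul_left (f := fun _ => c)) fun v => ?_).symm
  rw [_root_.smul_apply, inner_smul_left, E.inner_lift_self μH ha hac, Complex.conj_ofReal]
  simp_rw [fold_const_mul]
  rw [integral_const_mul, Complex.ofReal_mul]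

theorem lift_zero : E.lift μH (fun _ => 0) = 0 := by
  refine (E.eq_lift μH (a := fun _ => (0 : ℝ)) continuous_const
    HasCompactSupport.zero fun v => ?_).symm
  have : (fold μH (fun _ => 0) : G ⧸ H → ℝ) = fun _ => 0 := funext fun x => integral_zero _ _
  rw [this, integral_zero]
  simp

theorem inner_lift_comm {a : G → ℝ} (ha : Continuous a) (hc : HasCompactSupport a) (v w : V) :
    ⟪E.lift μH a v, w⟫_ℂ = ⟪v, E.lift μH a w⟫_ℂ := by
  have : (E.lift μH a : V →ₗ[ℂ] V).IsSymmetric := by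
    refine LinearMap.isSymmetric_iff_inner_map_self_real _ |>.2 fun v => ?_
    simp only [ContinuousLinearMap.coe_coe]
    rw [E.inner_lift_self μH ha hc, Complex.conj_ofReal]
  exact this v w

theorem exists_norm_lift_le {C : Set G} (hC : IsCompact C) : ∃ c : ℝ, 0 ≤ c ∧ ∀ a : G → ℝ,
    Continuous a → (∀ x ∉ C, a x = 0) → ∀ M : ℝ, 0 ≤ M → (∀ x, |a x| ≤ M) →
      ‖E.lift μH a‖ ≤ c * M := by
  obtain ⟨c, hc0, hc⟩ := exists_fold_bound μH hC
  refine ⟨2 * (c * ‖E Set.univ‖), by positivity, fun a ha haC M hM hb => ?_⟩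
  have hac : HasCompactSupport a := HasCompactSupport.intro hC haC
  have : ‖E.lift μH a‖ ≤ 2 * (c * M * ‖E Set.univ‖) := by
    refine opNorm_le_of_quadratic_le (by positivity) fun v => ?_
    rw [E.inner_lift_self μH ha hac, Complex.norm_real]
    exact E.norm_integral_measure_le (by positivity) (hc a haC M hM hb) v
  exact this.trans (le_of_eq (by ring))

theorem lift_comp_mul_left {a : G → ℝ} (ha : Continuous a) (hc : HasCompactSupport a) (g : G)
    (v : V) : E.lift μH (fun x => a (g * x)) v = π g⁻¹ (E.lift μH a (π g v)) := by
  let T : V →L[ℂ] V := ((π g⁻¹).toContinuousLinearEquiv : V →L[ℂ] V) ∘L E.lift μH a ∘L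
    ((π g).toContinuousLinearEquiv : V →L[ℂ] V)
  have hT : ∀ v, T v = π g⁻¹ (E.lift μH a (π g v)) := fun v => rfl
  rw [← hT, ← E.eq_lift μH (T := T) (a := fun x => a (g * x)) (ha.comp (continuous_const_mul g))
    (hc.comp_homeomorph (Homeomorph.mulLeft g)) fun w => ?_]
  rw [hT, π.inner_apply_left, inv_inv, E.inner_lift_self μH ha hc, E.measure_map_smul,
    integral_map (continuous_const_smul g).measurable.aemeasurable
      (continuous_fold μH ha hc).aestronglyMeasurable]
  simp_rw [fold_comp_mul_left]

theorem lift_comp_mul_right {a : G → ℝ} (ha : Continuous a) (hc : HasCompactSupport a) (k : H) :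
    E.lift μH (fun x => a (x * k)) = ((modularFunction k⁻¹ : ℝ) : ℂ) • E.lift μH a := by
  refine (E.eq_lift μH (a := fun x => a (x * k)) (ha.comp (continuous_mul_const (k : G)))
    (hc.comp_homeomorph (Homeomorph.mulRight (k : G))) fun v => ?_).symm
  rw [_root_.smul_apply, inner_smul_left, E.inner_lift_self μH ha hc, Complex.conj_ofReal]
  simp_rw [fold_comp_mul_right]
  rw [integral_const_mul, Complex.ofReal_mul]

theorem continuous_lift {Z : Type*} [TopologicalSpace Z] {c : Z → G → ℝ}
    (hc : Continuous c.uncurry)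
    (hs : ∀ z₀, ∃ C : Set G, IsCompact C ∧ ∀ᶠ z in 𝓝 z₀, ∀ x ∉ C, c z x = 0) :
    Continuous fun z => E.lift μH (c z) := by
  rw [continuous_iff_continuousAt]
  intro z₀
  obtain ⟨C, hC, hz⟩ := hs z₀
  obtain ⟨b, hb0, hb⟩ := E.exists_norm_lift_le μH hC
  have hcont : ∀ z, Continuous (c z) := fun z => hc.comp (Continuous.prodMk_right z)
  rw [ContinuousAt, tendsto_iff_norm_sub_tendsto_zero, Metric.tendsto_nhds]
  intro ε hε
  have hδ : 0 < ε / (b + 1) := by positivity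
  have h1 : ∀ᶠ z in 𝓝 z₀, ∀ x ∈ C, |c z x - c z₀ x| < ε / (b + 1) := by
    refine hC.eventually_forall_of_forall_eventually fun x _ => ?_
    have hcc : Continuous fun p : Z × G => |c p.1 p.2 - c z₀ p.2| :=
      (hc.sub ((hcont z₀).comp continuous_snd)).abs
    exact hcc.continuousAt.eventually_lt continuousAt_const (by simpa using hδ)
  filter_upwards [h1, hz] with z h1 h2
  have h3 : ∀ x ∉ C, c z₀ x = 0 := hz.self_of_nhds
  rw [← E.lift_sub μH (hcont z) (HasCompactSupport.intro hC h2) (hcont z₀)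
    (HasCompactSupport.intro hC h3), dist_zero_right, norm_norm]
  calc _ ≤ b * (ε / (b + 1)) := by
        refine hb (fun x => c z x - c z₀ x) ((hcont z).sub (hcont z₀))
          (fun x hx => by rw [h2 x hx, h3 x hx, sub_zero]) _
          hδ.le fun x => ?_
        by_cases hx : x ∈ C
        · exact (h1 x hx).le
        · rw [h2 x hx, h3 x hx, sub_zero, abs_zero]; exact hδ.le
    _ < (b + 1) * (ε / (b + 1)) := by gcongr; linarith
    _ = ε := by field_simp

/-- The measure on `G` that integrates `a` to `⟨(∫ a♭ dE) v, v⟩`. -/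
def liftMeasure (v : V) : Measure G :=
  RealRMK.rieszMeasure
    ⟨{ toFun := fun a : CompactlySupportedContinuousMap G ℝ => ∫ x, fold μH a x ∂(E.measure v)
       map_add' := fun a b => by
        refine Eq.trans ?_ (integral_add (f := fold μH ⇑a) (g := fold μH ⇑b)
          (E.integrable_fold μH a.continuous a.hasCompactSupport v)
          (E.integrable_fold μH b.continuous b.hasCompactSupport v))
        exact integral_congr_ae (Filter.Eventually.of_forall fun x =>
          fold_add μH a.continuous a.hasCompactSupport b.continuous b.hasCompactSupport x)
       map_smul' := fun c a => by
        rw [RingHom.id_apply, smul_eq_mul, ← integral_const_mul]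
        exact integral_congr_ae (Filter.Eventually.of_forall fun x => fold_const_mul μH c a x) },
    fun a b hab => by
      refine integral_mono (E.integrable_fold μH a.continuous a.hasCompactSupport v)
        (E.integrable_fold μH b.continuous b.hasCompactSupport v) fun x => ?_
      exact integral_mono (integrable_coset μH a.continuous a.hasCompactSupport _)
        (integrable_coset μH b.continuous b.hasCompactSupport _) fun h => hab _⟩

instance (v : V) : (E.liftMeasure μH v).Regular := RealRMK.regular_rieszMeasure _

theorem integral_liftMeasure {a : G → ℝ} (ha : Continuous a) (hc : HasCompactSupport a) (v : V) :
    ∫ x, a x ∂(E.liftMeasure μH v) = ∫ x, fold μH a x ∂(E.measure v) :=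
  RealRMK.integral_rieszMeasure _ (⟨⟨a, ha⟩, hc⟩ : CompactlySupportedContinuousMap G ℝ)

theorem inner_lift_self_eq_liftMeasure {a : G → ℝ} (ha : Continuous a) (hc : HasCompactSupport a)
    (v : V) : ⟪v, E.lift μH a v⟫_ℂ = ((∫ x, a x ∂(E.liftMeasure μH v) : ℝ) : ℂ) := by
  rw [← E.inner_lift_comm μH ha hc, E.inner_lift_self μH ha hc, E.integral_liftMeasure μH ha hc]

section Integral
variable {Z : Type*} [TopologicalSpace Z] [MeasurableSpace Z] [OpensMeasurableSpace Z]
  {ν : Measure Z} [IsFiniteMeasureOnCompacts ν] {c : Z → G → ℝ}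

theorem continuous_lift_of_hasCompactSupport (hc : Continuous c.uncurry)
    (hs : HasCompactSupport c.uncurry) : Continuous fun z => E.lift μH (c z) := by
  refine E.continuous_lift μH hc fun z₀ => ⟨Prod.snd '' tsupport c.uncurry,
    hs.isCompact.image continuous_snd, Filter.Eventually.of_forall fun z x hx => ?_⟩
  exact image_eq_zero_of_notMem_tsupport (f := c.uncurry) (x := (z, x))
    fun h => hx ⟨_, h, rfl⟩

theorem hasCompactSupport_lift [T2Space Z] (hs : HasCompactSupport c.uncurry) :
    HasCompactSupport fun z => E.lift μH (c z) := by
  refine HasCompactSupport.intro (hs.isCompact.image continuous_fst) fun z hz => ?_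
  have : c z = fun _ => 0 := funext fun x =>
    image_eq_zero_of_notMem_tsupport (f := c.uncurry) (x := (z, x)) fun h => hz ⟨_, h, rfl⟩
  rw [this, lift_zero]

/-- Integration over a parameter commutes with the operator integral. -/
theorem integral_lift [T2Space Z] (hc : Continuous c.uncurry) (hs : HasCompactSupport c.uncurry) :
    ∫ z, E.lift μH (c z) ∂ν = E.lift μH fun x => ∫ z, c z x ∂ν := by
  have hcont := E.continuous_lift_of_hasCompactSupport μH hc hs
  have hint : Integrable (fun z => E.lift μH (c z)) ν :=
    hcont.integrable_of_hasCompactSupport (E.hasCompactSupport_lift μH hs)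
  have hz : ∀ z x, (z, x) ∉ tsupport c.uncurry → c z x = 0 := fun z x h =>
    image_eq_zero_of_notMem_tsupport (f := c.uncurry) h
  have hcz : ∀ z, Continuous (c z) := fun z => hc.comp (Continuous.prodMk_right z)
  have hcs : ∀ z, HasCompactSupport (c z) := fun z =>
    HasCompactSupport.intro (hs.isCompact.image continuous_snd) fun x hx =>
      hz z x fun h => hx ⟨_, h, rfl⟩
  have hI : Continuous fun x => ∫ z, c z x ∂ν := by
    refine continuous_integral_of_locally_compact_support
      (hc.comp (continuous_snd.prodMk continuous_fst)) fun x₀ =>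
      ⟨_, hs.isCompact.image continuous_fst, Filter.Eventually.of_forall fun x z h =>
        hz z x fun h' => h ⟨_, h', rfl⟩⟩
  have hIs : HasCompactSupport fun x => ∫ z, c z x ∂ν := by
    refine HasCompactSupport.intro (hs.isCompact.image continuous_snd) fun x hx => ?_
    have : ∀ z, c z x = 0 := fun z => hz z x fun h => hx ⟨_, h, rfl⟩
    simp [this]
  refine E.eq_lift μH hI hIs fun v => ?_
  rw [ContinuousLinearMap.integral_apply hint, ← inner_conj_symm, ← integral_inner
    (hint.apply_continuousLinearMap v), ← E.integral_liftMeasure μH hI hIs]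
  simp_rw [E.inner_lift_self_eq_liftMeasure μH (hcz _) (hcs _)]
  rw [integral_complex_ofReal, Complex.conj_ofReal,
    integral_integral_swap_of_hasCompactSupport hc hs]

end Integral
end LocalisationObservable
end Lift

/-! ### The fibre form on smoothed vectors -/

section FibreForm
open scoped InnerProductSpace

variable {G : Type*} [Group G] [TopologicalSpace G] [IsTopologicalGroup G] [LocallyCompactSpace G]
  [T2Space G] [SecondCountableTopology G] [MeasurableSpace G] [BorelSpace G]
  {H : Subgroup G} [hH : IsClosed (H : Set G)]
  (μG : Measure G) [μG.IsHaarMeasure] (μH : Measure H) [μH.IsHaarMeasure]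
  {V : Type*} [NormedAddCommGroup V] [InnerProductSpace ℂ V] [CompleteSpace V]
  {π : UnitaryRep G V} (E : LocalisationObservable H π)

theorem coe_modularFunction_inv (g : G) :
    (modularFunction g⁻¹ : ℝ) = (modularFunction g : ℝ)⁻¹ := by
  refine eq_inv_of_mul_eq_one_left ?_
  rw [← NNReal.coe_mul, ← modularFunction_mul, inv_mul_cancel, modularFunction_one, NNReal.coe_one]

/-- A continuous density of a positive functional on compactly supported functions is nonnegative
everywhere. -/
theorem re_nonneg_of_forall_integral {D : G → ℂ} (hD : Continuous D)
    (h : ∀ a : G → ℝ, Continuous a → HasCompactSupport a → (∀ x, 0 ≤ a x) →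
      0 ≤ (∫ x, (a x : ℂ) * D x ∂μG).re) (g : G) : 0 ≤ (D g).re := by
  by_contra! hneg
  obtain ⟨b, hb, hbc, hb0, hb1, -⟩ := exists_bump (G := G) Filter.univ_mem
  let a : G → ℝ := fun x => b (g⁻¹ * x) * max (-(D x).re) 0
  have hbc' : HasCompactSupport fun x => b (g⁻¹ * x) :=
    hbc.comp_homeomorph (Homeomorph.mulLeft g⁻¹)
  have hre : Continuous fun x => (D x).re := Complex.continuous_re.comp hD
  have ha : Continuous a := by fun_prop
  have hac : HasCompactSupport a := hbc'.mul_right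
  have h1 := h a ha hac fun x => mul_nonneg (hb0 _) (le_max_right _ _)
  have hint : Integrable (fun x => (a x : ℂ) * D x) μG := by
    refine Continuous.integrable_of_hasCompactSupport (by fun_prop) ?_
    exact (hac.comp_left (g := fun r : ℝ => (r : ℂ)) Complex.ofReal_zero).mul_right
  have h2 : (∫ x, (a x : ℂ) * D x ∂μG).re = ∫ x, a x * (D x).re ∂μG := by
    have := integral_re hint
    simp only [RCLike.re_eq_complex_re, Complex.re_ofReal_mul] at this
    exact this.symm
  have h3 : 0 < ∫ x, -(a x * (D x).re) ∂μG := by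
    refine Continuous.integral_pos_of_hasCompactSupport_nonneg_nonzero (x := g) (by fun_prop)
      ?_ (fun x => ?_) ?_
    · exact (hac.mul_right (f' := fun x => (D x).re)).neg
    · change 0 ≤ -(b (g⁻¹ * x) * max (-(D x).re) 0 * (D x).re)
      rcases le_total (D x).re 0 with hx | hx
      · rw [max_eq_left (by linarith)]
        have := mul_nonneg (hb0 (g⁻¹ * x)) (mul_self_nonneg (D x).re)
        linarith
      · rw [max_eq_right (by linarith)]; simp
    · change -(b (g⁻¹ * g) * max (-(D g).re) 0 * (D g).re) ≠ 0
      rw [inv_mul_cancel, hb1, max_eq_left (by linarith)]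
      simp [hneg.ne]
  rw [integral_neg] at h3
  linarith

theorem eq_of_forall_integral {D₁ D₂ : G → ℂ} (hD₁ : Continuous D₁) (hD₂ : Continuous D₂)
    (h : ∀ a : G → ℝ, Continuous a → HasCompactSupport a →
      ∫ x, (a x : ℂ) * D₁ x ∂μG = ∫ x, (a x : ℂ) * D₂ x ∂μG) (g : G) : D₁ g = D₂ g := by
  have hi : ∀ {D : G → ℂ}, Continuous D → ∀ a : G → ℝ, Continuous a → HasCompactSupport a →
      Integrable (fun x => (a x : ℂ) * D x) μG := by
    intro D hD a ha hac
    refine Continuous.integrable_of_hasCompactSupport (by fun_prop) ?_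
    exact (hac.comp_left (g := fun r : ℝ => (r : ℂ)) Complex.ofReal_zero).mul_right
  have key : ∀ c : ℂ, 0 ≤ (c * (D₁ g - D₂ g)).re := by
    intro c
    refine re_nonneg_of_forall_integral μG (D := fun x => c * (D₁ x - D₂ x)) (by fun_prop)
      (fun a ha hac _ => ?_) g
    have : ∀ x, (a x : ℂ) * (c * (D₁ x - D₂ x)) = c * ((a x : ℂ) * D₁ x - (a x : ℂ) * D₂ x) :=
      fun x => by ring
    simp_rw [this]
    rw [integral_const_mul, integral_sub (hi hD₁ a ha hac) (hi hD₂ a ha hac), h a ha hac, sub_self,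
      mul_zero, Complex.zero_re]
  rw [← sub_eq_zero]
  have h1 := key 1
  have h2 := key (-1)
  have h3 := key Complex.I
  have h4 := key (-Complex.I)
  simp only [one_mul, neg_mul, Complex.neg_re, Complex.I_mul_re] at h1 h2 h3 h4
  exact Complex.ext (by rw [Complex.zero_re]; linarith) (by rw [Complex.zero_im]; linarith)

namespace UnitaryRep

/-- The smoothed vector `∫ f(x) π(x) v dx`. -/
def smooth (π : UnitaryRep G V) (f : G → ℝ) (v : V) : V := ∫ x, (f x : ℂ) • π x v ∂μG

theorem integrable_smooth (π : UnitaryRep G V) {f : G → ℝ} (hf : Continuous f)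
    (hfc : HasCompactSupport f) (v : V) : Integrable (fun x => (f x : ℂ) • π x v) μG := by
  have := π.continuous_apply v
  refine Continuous.integrable_of_hasCompactSupport (by fun_prop) ?_
  exact (hfc.comp_left (g := fun r : ℝ => (r : ℂ)) Complex.ofReal_zero).smul_right

theorem apply_smooth (π : UnitaryRep G V) (f : G → ℝ) (g : G) (v : V) :
    π g (π.smooth μG f v) = π.smooth μG (fun x => f (g⁻¹ * x)) v := by
  have h1 : π g (π.smooth μG f v) = ∫ x, π g ((f x : ℂ) • π x v) ∂μG :=
    ((π g).toContinuousLinearEquiv.integral_comp_comm _).symm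
  rw [h1, smooth,
    ← integral_mul_left_eq_self (μ := μG) (fun x => (f (g⁻¹ * x) : ℂ) • π x v) g]
  simp only [map_mul_apply, map_smul, inv_mul_cancel_left]

end UnitaryRep

namespace LocalisationObservable

/-- The integrand `x ↦ Δ(x⁻¹) f(x⁻¹) f'(x⁻¹ y)` of the fibre form. -/
def formKernel (f f' : G → ℝ) (y x : G) : ℝ :=
  modularFunction x⁻¹ * f x⁻¹ * f' (x⁻¹ * y)

/-- The fibre form `∫ ⟨v, (∫ Δ(x⁻¹) f(x⁻¹) f'(x⁻¹ y) dE(x)) π(y) v'⟩ dy`. If the observable is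
represented on an induced space, this is the inner product of the values at `1` of the continuous
functions that represent the smoothed vectors `π(f) v` and `π(f') v'`. -/
def form (f : G → ℝ) (v : V) (f' : G → ℝ) (v' : V) : ℂ :=
  ∫ y, ⟪v, E.lift μH (formKernel f f' y) (π y v')⟫_ℂ ∂μG

section Param
variable {Z : Type*} [TopologicalSpace Z] {F F' : Z → G → ℝ}

theorem continuous_form (hF : Continuous F.uncurry) (hF' : Continuous F'.uncurry)
    (hs : ∀ z₀, ∃ C : Set G, IsCompact C ∧ ∀ᶠ z in 𝓝 z₀, ∀ x ∉ C, F z x = 0)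
    (hs' : ∀ z₀, ∃ C : Set G, IsCompact C ∧ ∀ᶠ z in 𝓝 z₀, ∀ x ∉ C, F' z x = 0)
    {v v' : Z → V} (hv : Continuous v) (hv' : Continuous v') :
    Continuous fun z => E.form μG μH (F z) (v z) (F' z) (v' z) := by
  have hlift : Continuous fun p : Z × G => E.lift μH (formKernel (F p.1) (F' p.1) p.2) := by
    refine E.continuous_lift μH (c := fun p : Z × G => formKernel (F p.1) (F' p.1) p.2) ?_ ?_
    · change Continuous fun q : (Z × G) × G => (modularFunction q.2⁻¹ : ℝ) * F q.1.1 q.2⁻¹ *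
        F' q.1.1 (q.2⁻¹ * q.1.2)
      refine (Continuous.mul (by fun_prop) (hF.comp (?_ : Continuous fun q : (Z × G) × G =>
        (q.1.1, q.2⁻¹)))).mul (hF'.comp (?_ : Continuous fun q : (Z × G) × G =>
        (q.1.1, q.2⁻¹ * q.1.2)))
      · fun_prop
      · fun_prop
    · rintro ⟨z₀, y₀⟩
      obtain ⟨C, hC, hz⟩ := hs z₀
      refine ⟨C⁻¹, hC.inv, ?_⟩
      filter_upwards [(continuous_fst.tendsto (z₀, y₀)).eventually hz] with p hp x hx
      simp only [formKernel]
      rw [hp x⁻¹ (by simpa using hx), mul_zero, zero_mul]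
  refine continuous_integral_of_locally_compact_support ?_ fun z₀ => ?_
  · have hπ : Continuous fun p : Z × G => π p.2 (v' p.1) :=
      π.continuous_uncurry.comp (continuous_snd.prodMk (hv'.comp continuous_fst))
    exact (hv.comp continuous_fst).inner (hlift.clm_apply hπ)
  · obtain ⟨C, hC, hz⟩ := hs z₀
    obtain ⟨C', hC', hz'⟩ := hs' z₀
    refine ⟨C⁻¹ * C', hC.inv.mul hC', ?_⟩
    filter_upwards [hz, hz'] with z h1 h2 y hy
    have : formKernel (F z) (F' z) y = fun _ => 0 := by
      funext x
      by_cases hx : x⁻¹ ∈ C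
      · have : x⁻¹ * y ∉ C' := fun h => hy ⟨x, by simpa using hx, _, h, by simp⟩
        simp [formKernel, h2 _ this]
      · simp [formKernel, h1 _ hx]
    rw [this, lift_zero, _root_.zero_apply, inner_zero_right]

end Param

theorem form_translate {f f' : G → ℝ} (hf : Continuous f) (hfc : HasCompactSupport f)
    (hf' : Continuous f') (k : H) (v v' : V) :
    E.form μG μH (fun x => f (k * x)) v (fun x => f' (k * x)) v' =
      (modularRatio H k : ℝ) * E.form μG μH f v f' v' := by
  rw [form, form, ← integral_const_mul]
  congr 1
  funext y
  have hc : Continuous (formKernel f f' y) := by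
    change Continuous fun x => (modularFunction x⁻¹ : ℝ) * f x⁻¹ * f' (x⁻¹ * y)
    fun_prop
  have hcs : HasCompactSupport (formKernel f f' y) :=
    HasCompactSupport.intro (hfc.isCompact.inv) fun x hx => by
      have : f x⁻¹ = 0 := image_eq_zero_of_notMem_tsupport (by simpa using hx)
      simp [formKernel, this]
  have e : formKernel (fun x => f (k * x)) (fun x => f' (k * x)) y =
      fun x => (modularFunction (k : G)⁻¹ : ℝ) * formKernel f f' y (x * (k⁻¹ : H)) := by
    funext x
    have h1 : (modularFunction (k : G)⁻¹ : ℝ) * modularFunction (k : G) = 1 := by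
      rw [← NNReal.coe_mul, ← modularFunction_mul, inv_mul_cancel, modularFunction_one,
        NNReal.coe_one]
    simp only [formKernel, Subgroup.coe_inv, modularFunction_mul, NNReal.coe_mul, mul_inv_rev,
      inv_inv, mul_assoc]
    rw [← mul_assoc (modularFunction (k : G)⁻¹ : ℝ), h1, one_mul]
  rw [e, E.lift_const_mul μH (a := fun x => formKernel f f' y (x * (k⁻¹ : H))) _
    (hc.comp (continuous_mul_const _))
    (hcs.comp_homeomorph (Homeomorph.mulRight ((k⁻¹ : H) : G))),
    E.lift_comp_mul_right μH hc hcs, inv_inv, smul_smul, _root_.smul_apply, inner_smul_right,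
    modularRatio, NNReal.coe_div, Complex.ofReal_div, coe_modularFunction_inv, Complex.ofReal_inv]
  ring

/-- The fibre form is the density of the observable between smoothed vectors: integrated over
`g` against `a`, the form of the translates by `g` gives the matrix element of `∫ a♭ dE`. -/
theorem integral_mul_form {f f' a : G → ℝ} (hf : Continuous f) (hfc : HasCompactSupport f)
    (hf' : Continuous f') (hfc' : HasCompactSupport f') (ha : Continuous a)
    (hac : HasCompactSupport a) (v v' : V) :
    ∫ g, (a g : ℂ) * E.form μG μH (fun x => f (g * x)) v (fun x => f' (g * x)) v' ∂μG =
      ⟪π.smooth μG f v, E.lift μH a (π.smooth μG f' v')⟫_ℂ := by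
  let A := tsupport a
  let C := tsupport f
  let C' := tsupport f'
  have hA : IsCompact A := hac.isCompact
  have hC : IsCompact C := hfc.isCompact
  have hC' : IsCompact C' := hfc'.isCompact
  have mA : ∀ {x}, a x ≠ 0 → x ∈ A := fun h => subset_tsupport _ h
  have mC : ∀ {x}, f x ≠ 0 → x ∈ C := fun h => subset_tsupport _ h
  have mC' : ∀ {x}, f' x ≠ 0 → x ∈ C' := fun h => subset_tsupport _ h
  -- `d` and `e` are the integrands before and after the substitution `g ↦ g x`
  let d : G × G → G → ℝ := fun p x =>
    a p.1 * ((modularFunction x⁻¹ : ℝ) * f (p.1 * x⁻¹) * f' (p.1 * (x⁻¹ * p.2)))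
  let e : G × G → G → ℝ := fun p x => f p.1 * f' (p.1 * p.2) * a (p.1 * x)
  have hd : Continuous d.uncurry := by
    change Continuous fun q : (G × G) × G => a q.1.1 * ((modularFunction q.2⁻¹ : ℝ) *
      f (q.1.1 * q.2⁻¹) * f' (q.1.1 * (q.2⁻¹ * q.1.2)))
    fun_prop
  have he : Continuous e.uncurry := by
    change Continuous fun q : (G × G) × G =>
      f q.1.1 * f' (q.1.1 * q.1.2) * a (q.1.1 * q.2)
    fun_prop
  have hds : HasCompactSupport d.uncurry := by
    refine HasCompactSupport.intro ((hA.prod (((hC.inv.mul hA).mul hA.inv).mul hC')).prod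
      (hC.inv.mul hA)) fun q hq => ?_
    by_contra hne
    change a q.1.1 * ((modularFunction q.2⁻¹ : ℝ) * f (q.1.1 * q.2⁻¹) *
      f' (q.1.1 * (q.2⁻¹ * q.1.2))) ≠ 0 at hne
    have h1 := mA (left_ne_zero_of_mul hne)
    have h2 := mC (right_ne_zero_of_mul (left_ne_zero_of_mul (right_ne_zero_of_mul hne)))
    have h3 := mC' (right_ne_zero_of_mul (right_ne_zero_of_mul hne))
    have h4 : q.2 ∈ C⁻¹ * A := ⟨(q.1.1 * q.2⁻¹)⁻¹, by simpa using h2, _, h1, by simp⟩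
    exact hq ⟨⟨h1, q.2 * q.1.1⁻¹, ⟨_, h4, _, by simpa using h1, rfl⟩, _, h3, by group⟩, h4⟩
  have hes : HasCompactSupport e.uncurry := by
    refine HasCompactSupport.intro ((hC.prod (hC.inv.mul hC')).prod
      (hC.inv.mul hA)) fun q hq => ?_
    by_contra hne
    change f q.1.1 * f' (q.1.1 * q.1.2) * a (q.1.1 * q.2) ≠ 0 at hne
    have h1 := mC (left_ne_zero_of_mul (left_ne_zero_of_mul hne))
    have h2 := mC' (right_ne_zero_of_mul (left_ne_zero_of_mul hne))
    have h3 := mA (right_ne_zero_of_mul hne)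
    exact hq ⟨⟨h1, q.1.1⁻¹, by simpa using h1, _, h2, by simp⟩, q.1.1⁻¹, by simpa using h1, _, h3,
      by simp⟩
  -- the scalar functions to which Fubini's theorem is applied
  have hswap : ∀ c : G × G → G → ℝ, Continuous c.uncurry → HasCompactSupport c.uncurry →
      ∫ g, ∫ y, ⟪v, E.lift μH (c (g, y)) (π y v')⟫_ℂ ∂μG ∂μG =
        ∫ y, ⟪v, E.lift μH (fun x => ∫ g, c (g, y) x ∂μG) (π y v')⟫_ℂ ∂μG := by
    intro c hc hcs
    have hl := E.continuous_lift_of_hasCompactSupport μH hc hcs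
    have hls := E.hasCompactSupport_lift μH hcs
    rw [integral_integral_swap_of_hasCompactSupport]
    · congr 1
      funext y
      have hc1 : Continuous (Function.uncurry fun g : G => c (g, y)) :=
        hc.comp (f := fun q : G × G => ((q.1, y), q.2)) (by fun_prop)
      have hcs1 : HasCompactSupport (Function.uncurry fun g : G => c (g, y)) := by
        refine HasCompactSupport.intro (hcs.isCompact.image (f := fun q : (G × G) × G =>
          (q.1.1, q.2)) (by fun_prop)) fun q hq => ?_
        exact image_eq_zero_of_notMem_tsupport (f := c.uncurry) (x := ((q.1, y), q.2))
          fun h => hq ⟨_, h, rfl⟩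
      have hint : Integrable (fun g => E.lift μH (c (g, y))) μG :=
        (E.continuous_lift_of_hasCompactSupport μH hc1 hcs1).integrable_of_hasCompactSupport
          (E.hasCompactSupport_lift μH hcs1)
      rw [← E.integral_lift μH hc1 hcs1, ContinuousLinearMap.integral_apply hint,
        integral_inner (hint.apply_continuousLinearMap _)]
    · exact continuous_const.inner
        (hl.clm_apply ((π.continuous_apply v').comp continuous_snd))
    · refine HasCompactSupport.intro hls.isCompact fun p hp => ?_
      have : E.lift μH (c p) = 0 :=
        image_eq_zero_of_notMem_tsupport (f := fun z => E.lift μH (c z)) hp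
      change ⟪v, E.lift μH (c p) (π p.2 v')⟫_ℂ = 0
      rw [this, _root_.zero_apply, inner_zero_right]
  have hsub : ∀ y x : G, ∫ g, d (g, y) x ∂μG = ∫ g, e (g, y) x ∂μG := by
    intro y x
    have h := integral_mul_right_haar μG (fun g => a g * (f (g * x⁻¹) * f' (g * (x⁻¹ * y)))) x
    rw [smul_eq_mul, ← integral_const_mul] at h
    refine Eq.trans ?_ (h.symm.trans ?_)
    · congr 1; funext g; simp only [d]; ring
    · congr 1
      funext g
      simp only [e, mul_assoc, mul_inv_cancel, mul_one, mul_inv_cancel_left]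
      ring
  have hform : ∀ g : G, (a g : ℂ) * E.form μG μH (fun x => f (g * x)) v (fun x => f' (g * x)) v' =
      ∫ y, ⟪v, E.lift μH (d (g, y)) (π y v')⟫_ℂ ∂μG := by
    intro g
    rw [form, ← integral_const_mul]
    congr 1
    funext y
    have h1 : Continuous (formKernel (fun x => f (g * x)) (fun x => f' (g * x)) y) := by
      change Continuous fun x => (modularFunction x⁻¹ : ℝ) * f (g * x⁻¹) * f' (g * (x⁻¹ * y))
      fun_prop
    have h2 : HasCompactSupport (formKernel (fun x => f (g * x)) (fun x => f' (g * x)) y) := by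
      refine HasCompactSupport.intro (hC.inv.mul (isCompact_singleton (x := g))) fun x hx => ?_
      have : f (g * x⁻¹) = 0 := by
        by_contra hne
        exact hx ⟨(g * x⁻¹)⁻¹, by simpa using mC hne, g, rfl, by simp⟩
      simp [formKernel, this]
    rw [show d (g, y) = fun x => a g * formKernel (fun x => f (g * x)) (fun x => f' (g * x)) y x
      from rfl, E.lift_const_mul μH _ h1 h2, _root_.smul_apply, inner_smul_right]
  simp_rw [hform]
  rw [hswap d hd hds]
  simp_rw [hsub]
  rw [← hswap e he hes]
  have hinner : ∀ g : G, ∫ y, ⟪v, E.lift μH (e (g, y)) (π y v')⟫_ℂ ∂μG =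
      (f g : ℂ) * ⟪π g v, E.lift μH a (π.smooth μG f' v')⟫_ℂ := by
    intro g
    have h1 : ∀ y : G, ⟪v, E.lift μH (e (g, y)) (π y v')⟫_ℂ =
        (f g : ℂ) * ⟪π g v, E.lift μH a ((f' (g * y) : ℂ) • π (g * y) v')⟫_ℂ := by
      intro y
      rw [show e (g, y) = fun x => (f g * f' (g * y)) * a (g * x) from rfl,
        E.lift_const_mul μH (a := fun x => a (g * x)) _ (ha.comp (continuous_const_mul g))
        (hac.comp_homeomorph (Homeomorph.mulLeft g)), _root_.smul_apply, inner_smul_right,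
        E.lift_comp_mul_left μH ha hac, π.inner_apply_left, ← π.map_mul_apply, map_smul, map_smul,
        inner_smul_right, Complex.ofReal_mul, mul_assoc]
    simp_rw [h1]
    rw [integral_const_mul, integral_mul_left_eq_self (μ := μG)
      (fun y => ⟪π g v, E.lift μH a ((f' y : ℂ) • π y v')⟫_ℂ) g]
    have hi := π.integrable_smooth μG hf' hfc' v'
    rw [UnitaryRep.smooth, ← ContinuousLinearMap.integral_comp_comm _ hi,
      integral_inner ((E.lift μH a).integrable_comp hi)]
  simp_rw [hinner]
  have hi := π.integrable_smooth μG hf hfc v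
  rw [← inner_conj_symm, UnitaryRep.smooth.eq_def μG π f v, ← integral_inner hi, ← integral_conj]
  congr 1
  funext g
  rw [inner_smul_right, map_mul, inner_conj_symm, Complex.conj_ofReal]

end LocalisationObservable
end FibreForm

/-! ### The fibre Hilbert space and the representation of the subgroup -/

section Fibre
open scoped InnerProductSpace

variable {G : Type*} [Group G] [TopologicalSpace G] [IsTopologicalGroup G] [LocallyCompactSpace G]
  [T2Space G] [SecondCountableTopology G] [MeasurableSpace G] [BorelSpace G]
  {H : Subgroup G} [hH : IsClosed (H : Set G)]
  (μG : Measure G) [μG.IsHaarMeasure] (μH : Measure H) [μH.IsHaarMeasure]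

/-- Operators that define a representation on a total family define a representation. -/
theorem exists_unitaryRep_of_total {Γ K Ω : Type*} [Group Γ] [TopologicalSpace Γ]
    [NormedAddCommGroup K] [InnerProductSpace ℂ K] {κ : Ω → K}
    (hd : Dense (Submodule.span ℂ (Set.range κ) : Set K)) (U : Γ → K ≃ₗᵢ[ℂ] K)
    (hmul : ∀ g k ω, U (g * k) (κ ω) = U g (U k (κ ω)))
    (hc : ∀ ω, Continuous fun g => U g (κ ω)) : ∃ σ : UnitaryRep Γ K, ∀ g, σ g = U g := by
  have hm : ∀ g k v, U (g * k) v = U g (U k v) := fun g k v =>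
    eq_of_eqOn_total hd (S := ((U (g * k)).toContinuousLinearEquiv : K →L[ℂ] K))
      (T := ((U g).toContinuousLinearEquiv : K →L[ℂ] K) ∘L
        ((U k).toContinuousLinearEquiv : K →L[ℂ] K)) (fun ω => hmul g k ω) v
  have h1 : ∀ v, U 1 v = v := fun v => (U 1).injective (by rw [← hm, one_mul])
  have hspan : ∀ v ∈ Submodule.span ℂ (Set.range κ), Continuous fun g => U g v := by
    intro v hv
    induction hv using Submodule.span_induction with
    | mem x hx => obtain ⟨ω, rfl⟩ := hx; exact hc ω
    | zero => simpa using continuous_const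
    | add x y _ _ hx hy => simp only [map_add]; exact hx.add hy
    | smul c x _ hx => simp only [map_smul]; exact hx.const_smul c
  refine ⟨⟨⟨⟨U, LinearIsometryEquiv.ext h1⟩, fun g k => LinearIsometryEquiv.ext (hm g k)⟩,
    fun v => ?_⟩, fun g => rfl⟩
  refine continuous_of_uniform_approx_of_continuous fun u hu => ?_
  obtain ⟨ε, hε, hεu⟩ := Metric.mem_uniformity_dist.1 hu
  obtain ⟨w, hw, hwv⟩ := Metric.dense_iff.1 hd v ε hε
  refine ⟨fun g => U g w, hspan w hwv, fun g => hεu ?_⟩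
  change dist (U g v) (U g w) < ε
  rw [(U g).isometry.dist_eq, dist_comm]
  exact hw

variable {V : Type*} [NormedAddCommGroup V] [InnerProductSpace ℂ V] [CompleteSpace V]
  {π : UnitaryRep G V} (E : LocalisationObservable H π)

/-- Labels for the smoothed vectors `∫ φ_n(g⁻¹ x) π(x) v dx`, for a sequence `φ` of functions. -/
abbrev Label (G V : Type*) := ℕ × G × V

/-- The action of `G` on labels that corresponds to its action on smoothed vectors. -/
def Label.shift (k : G) (ω : Label G V) : Label G V := (ω.1, k * ω.2.1, ω.2.2)

/-- The smoothing function of a label. -/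
def Label.test (φ : ℕ → G → ℝ) (ω : Label G V) (x : G) : ℝ := φ ω.1 (ω.2.1⁻¹ * x)

/-- The smoothed vector of a label. -/
def Label.vec (π : UnitaryRep G V) (φ : ℕ → G → ℝ) (ω : Label G V) : V :=
  π.smooth μG (ω.test φ) ω.2.2

theorem Label.shift_shift (k l : G) (ω : Label G V) :
    (ω.shift l).shift k = ω.shift (k * l) := by
  simp [Label.shift, mul_assoc]

theorem Label.shift_one (ω : Label G V) : ω.shift 1 = ω := by simp [Label.shift]

theorem Label.test_shift (φ : ℕ → G → ℝ) (k : G) (ω : Label G V) :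
    (ω.shift k).test φ = fun x => ω.test φ (k⁻¹ * x) := by
  funext x
  simp [Label.test, Label.shift, mul_assoc]

theorem Label.continuous_shift : Continuous fun p : G × Label G V => p.2.shift p.1 := by
  unfold Label.shift
  fun_prop

theorem Label.vec_shift (φ : ℕ → G → ℝ) (k : G) (ω : Label G V) :
    (ω.shift k).vec μG π φ = π k (ω.vec μG π φ) := by
  rw [Label.vec, Label.vec, UnitaryRep.apply_smooth, Label.test_shift]
  rfl

section Test
variable {φ : ℕ → G → ℝ} (hφ : ∀ n, Continuous (φ n)) (hφc : ∀ n, HasCompactSupport (φ n))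
include hφ

theorem Label.continuous_test : Continuous (Function.uncurry fun ω : Label G V => ω.test φ) := by
  have h : Continuous (Function.uncurry φ) := continuous_prod_of_discrete_left.2 hφ
  change Continuous fun p : Label G V × G => Function.uncurry φ (p.1.1, p.1.2.1⁻¹ * p.2)
  fun_prop

theorem Label.continuous_test_apply (ω : Label G V) : Continuous (ω.test φ) :=
  (hφ ω.1).comp (continuous_const_mul _)

include hφc

omit hφ in
theorem Label.hasCompactSupport_test (ω : Label G V) : HasCompactSupport (ω.test φ) :=
  (hφc ω.1).comp_homeomorph (Homeomorph.mulLeft ω.2.1⁻¹)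

omit hφ in
theorem Label.locally_compact_support_test (ω₀ : Label G V) :
    ∃ C : Set G, IsCompact C ∧ ∀ᶠ ω in 𝓝 ω₀, ∀ x ∉ C, ω.test φ x = 0 := by
  obtain ⟨N, hN, hg⟩ := exists_compact_mem_nhds ω₀.2.1
  refine ⟨N * tsupport (φ ω₀.1), hN.mul (hφc ω₀.1).isCompact, ?_⟩
  have h1 : ∀ᶠ ω : Label G V in 𝓝 ω₀, ω.1 = ω₀.1 :=
    (continuous_fst.tendsto ω₀).eventually
      ((isOpen_discrete {ω₀.1}).mem_nhds rfl)
  have h2 : ∀ᶠ ω : Label G V in 𝓝 ω₀, ω.2.1 ∈ N :=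
    ((continuous_fst.comp continuous_snd).tendsto ω₀).eventually hg
  filter_upwards [h1, h2] with ω h1 h2 x hx
  have h3 : φ ω₀.1 (ω.2.1⁻¹ * x) = 0 := image_eq_zero_of_notMem_tsupport fun h =>
    hx ⟨ω.2.1, h2, _, h, mul_inv_cancel_left _ _⟩
  rw [Label.test, h1, h3]

end Test

namespace LocalisationObservable

/-- The fibre form between labels. -/
def labelForm (φ : ℕ → G → ℝ) (ω ω' : Label G V) : ℂ :=
  E.form μG μH (ω.test φ) ω.2.2 (ω'.test φ) ω'.2.2

variable {φ : ℕ → G → ℝ} (hφ : ∀ n, Continuous (φ n)) (hφc : ∀ n, HasCompactSupport (φ n))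
include hφ hφc

theorem continuous_labelForm :
    Continuous fun p : Label G V × Label G V => E.labelForm μG μH φ p.1 p.2 := by
  have h := Label.continuous_test (V := V) hφ
  refine E.continuous_form μG μH (F := fun p : Label G V × Label G V => p.1.test φ)
    (F' := fun p : Label G V × Label G V => p.2.test φ)
    (h.comp (f := fun q : (Label G V × Label G V) × G => (q.1.1, q.2)) (by fun_prop))
    (h.comp (f := fun q : (Label G V × Label G V) × G => (q.1.2, q.2)) (by fun_prop))
    (fun p => ?_) (fun p => ?_) (by fun_prop) (by fun_prop)
  · obtain ⟨C, hC, hz⟩ := Label.locally_compact_support_test hφc p.1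
    exact ⟨C, hC, (continuous_fst.tendsto p).eventually hz⟩
  · obtain ⟨C, hC, hz⟩ := Label.locally_compact_support_test hφc p.2
    exact ⟨C, hC, (continuous_snd.tendsto p).eventually hz⟩

theorem continuous_labelForm_shift (ω ω' : Label G V) :
    Continuous fun g : G => E.labelForm μG μH φ (ω.shift g⁻¹) (ω'.shift g⁻¹) := by
  have h := Label.continuous_shift (G := G) (V := V)
  exact (E.continuous_labelForm μG μH hφ hφc).comp
    ((h.comp (continuous_inv.prodMk continuous_const)).prodMk
      (h.comp (continuous_inv.prodMk continuous_const)))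

theorem integral_mul_labelForm {a : G → ℝ} (ha : Continuous a) (hac : HasCompactSupport a)
    (ω ω' : Label G V) :
    ∫ g, (a g : ℂ) * E.labelForm μG μH φ (ω.shift g⁻¹) (ω'.shift g⁻¹) ∂μG =
      ⟪ω.vec μG π φ, E.lift μH a (ω'.vec μG π φ)⟫_ℂ := by
  simp only [labelForm, Label.test_shift, inv_inv]
  exact E.integral_mul_form μG μH (Label.continuous_test_apply hφ ω)
    (Label.hasCompactSupport_test hφc ω) (Label.continuous_test_apply hφ ω')
    (Label.hasCompactSupport_test hφc ω') ha hac _ _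

theorem labelForm_symm (ω ω' : Label G V) :
    star (E.labelForm μG μH φ ω ω') = E.labelForm μG μH φ ω' ω := by
  have h := eq_of_forall_integral μG
    (D₁ := fun g => star (E.labelForm μG μH φ (ω.shift g⁻¹) (ω'.shift g⁻¹)))
    (D₂ := fun g => E.labelForm μG μH φ (ω'.shift g⁻¹) (ω.shift g⁻¹))
    (continuous_star.comp (E.continuous_labelForm_shift μG μH hφ hφc ω ω'))
    (E.continuous_labelForm_shift μG μH hφ hφc ω' ω) (fun a ha hac => ?_) 1
  · simpa only [inv_one, Label.shift_one] using h
  · rw [E.integral_mul_labelForm μG μH hφ hφc ha hac, ← E.inner_lift_comm μH ha hac,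
      ← inner_conj_symm, ← E.integral_mul_labelForm μG μH hφ hφc ha hac, ← integral_conj]
    simp

theorem integral_mul_labelForm_sum {a : G → ℝ} (ha : Continuous a) (hac : HasCompactSupport a)
    (s : Label G V →₀ ℂ) :
    ∫ g, (a g : ℂ) * (s.sum fun ω z => s.sum fun ω' w =>
        star z * E.labelForm μG μH φ (ω.shift g⁻¹) (ω'.shift g⁻¹) * w) ∂μG =
      ⟪Finsupp.linearCombination ℂ (fun ω => ω.vec μG π φ) s,
        E.lift μH a (Finsupp.linearCombination ℂ (fun ω => ω.vec μG π φ) s)⟫_ℂ := by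
  have hint : ∀ ω ω' : Label G V, Integrable (fun g => (a g : ℂ) *
      (star (s ω) * E.labelForm μG μH φ (ω.shift g⁻¹) (ω'.shift g⁻¹) * s ω')) μG := by
    intro ω ω'
    have := E.continuous_labelForm_shift μG μH hφ hφc ω ω'
    refine Continuous.integrable_of_hasCompactSupport (by fun_prop) ?_
    exact (hac.comp_left (g := fun r : ℝ => (r : ℂ)) Complex.ofReal_zero).mul_right
  simp only [Finsupp.sum, Finset.mul_sum]
  rw [integral_finsetSum _ fun ω _ => integrable_finsetSum _ fun ω' _ => hint ω ω']
  simp only [Finsupp.linearCombination_apply, Finsupp.sum, sum_inner, _root_.map_sum, inner_sum]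
  refine Eq.trans ?_ Finset.sum_comm
  refine Finset.sum_congr rfl fun ω _ => ?_
  rw [integral_finsetSum _ fun ω' _ => hint ω ω']
  refine Finset.sum_congr rfl fun ω' _ => ?_
  rw [map_smul, inner_smul_left, inner_smul_right,
    ← E.integral_mul_labelForm μG μH hφ hφc ha hac, ← integral_const_mul, ← integral_const_mul]
  congr 1
  funext g
  simp only [Complex.star_def]
  ring

/-- The form is positive semidefinite: along the action of `G` it is the continuous density of a
positive measure. -/
theorem labelForm_nonneg (s : Label G V →₀ ℂ) :
    0 ≤ (s.sum fun ω z => s.sum fun ω' w => star z * E.labelForm μG μH φ ω ω' * w).re := by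
  have h := re_nonneg_of_forall_integral μG
    (D := fun g => s.sum fun ω z => s.sum fun ω' w =>
      star z * E.labelForm μG μH φ (ω.shift g⁻¹) (ω'.shift g⁻¹) * w) ?_ (fun a ha hac ha0 => ?_) 1
  · simpa only [inv_one, Label.shift_one] using h
  · refine continuous_finsetSum _ fun ω _ => continuous_finsetSum _ fun ω' _ => ?_
    have := E.continuous_labelForm_shift μG μH hφ hφc ω ω'
    fun_prop
  · rw [E.integral_mul_labelForm_sum μG μH hφ hφc ha hac,
      E.inner_lift_self_eq_liftMeasure μH ha hac, Complex.ofReal_re]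
    exact integral_nonneg ha0

omit hφ hφc in
theorem labelForm_shift (hφ : ∀ n, Continuous (φ n)) (hφc : ∀ n, HasCompactSupport (φ n))
    (k : H) (ω ω' : Label G V) :
    E.labelForm μG μH φ (ω.shift k) (ω'.shift k) =
      (modularRatio H k⁻¹ : ℝ) * E.labelForm μG μH φ ω ω' := by
  simp only [labelForm, Label.test_shift]
  exact E.form_translate μG μH (Label.continuous_test_apply hφ ω)
    (Label.hasCompactSupport_test hφc ω) (Label.continuous_test_apply hφ ω') k⁻¹ _ _

/-- The fibre Hilbert space: a separable Hilbert space `K` with a total family of vectors whose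
Gram matrix is the labelled form. The subgroup acts on `K` through the action on labels, the
modular ratio compensating the behaviour of the form. -/
theorem exists_fibre.{v'} [TopologicalSpace.SeparableSpace V] :
    ∃ (K : Type v') (_ : NormedAddCommGroup K) (_ : InnerProductSpace ℂ K) (_ : CompleteSpace K)
      (_ : TopologicalSpace.SeparableSpace K) (κ : Label G V → K) (σ : UnitaryRep H K),
      Continuous κ ∧ (∀ ω ω', ⟪κ ω, κ ω'⟫_ℂ = E.labelForm μG μH φ ω ω') ∧
      Dense (Submodule.span ℂ (Set.range κ) : Set K) ∧
      ∀ (h : H) (ω : Label G V),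
        σ h (κ ω) = ((√(modularRatio H h : ℝ) : ℝ) : ℂ) • κ (ω.shift h) := by
  obtain ⟨K, i₁, i₂, i₃, i₄, κ, hκ, hin, hd⟩ := exists_hilbert_of_kernel.{_, v'}
    (E.labelForm μG μH φ) (E.continuous_labelForm μG μH hφ hφc)
    (E.labelForm_symm μG μH hφ hφc) (E.labelForm_nonneg μG μH hφ hφc)
  have hr : ∀ h k : H, ((√(modularRatio H (h * k) : ℝ) : ℝ) : ℂ) =
      ((√(modularRatio H h : ℝ) : ℝ) : ℂ) * ((√(modularRatio H k : ℝ) : ℝ) : ℂ) := by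
    intro h k
    rw [modularRatio_mul, NNReal.coe_mul, Real.sqrt_mul (NNReal.coe_nonneg _),
      Complex.ofReal_mul]
  have hr1 : ∀ h : H, ((√(modularRatio H h : ℝ) : ℝ) : ℂ) ≠ 0 := fun h =>
    Complex.ofReal_ne_zero.2 (Real.sqrt_pos.2 (NNReal.coe_pos.2 (modularRatio_pos h))).ne'
  have hU : ∀ h : H, ∃ U : K ≃ₗᵢ[ℂ] K, ∀ ω,
      U (κ ω) = ((√(modularRatio H h : ℝ) : ℝ) : ℂ) • κ (ω.shift h) := by
    intro h
    refine exists_linearIsometryEquiv_of_inner_eq hd ?_ fun ω ω' => ?_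
    · have : Submodule.span ℂ (Set.range κ) ≤ Submodule.span ℂ (Set.range fun ω : Label G V =>
          ((√(modularRatio H h : ℝ) : ℝ) : ℂ) • κ (ω.shift h)) := by
        refine Submodule.span_le.2 ?_
        rintro _ ⟨ω, rfl⟩
        have e : κ ω = (((√(modularRatio H h : ℝ) : ℝ) : ℂ))⁻¹ •
            (((√(modularRatio H h : ℝ) : ℝ) : ℂ) •
              κ ((ω.shift ((h⁻¹ : H) : G)).shift (h : G))) := by
          rw [smul_smul, inv_mul_cancel₀ (hr1 h), one_smul, Label.shift_shift]
          simp [Label.shift_one]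
        rw [e]
        exact Submodule.smul_mem _ _ (Submodule.subset_span
          (Set.mem_range_self (f := fun ω : Label G V =>
            ((√(modularRatio H h : ℝ) : ℝ) : ℂ) • κ (ω.shift (h : G)))
            (ω.shift ((h⁻¹ : H) : G))))
      exact hd.mono this
    · rw [inner_smul_left, inner_smul_right, hin, hin, E.labelForm_shift μG μH hφ hφc,
        Complex.conj_ofReal, ← mul_assoc, ← mul_assoc, ← Complex.ofReal_mul,
        Real.mul_self_sqrt (NNReal.coe_nonneg _), ← Complex.ofReal_mul, ← NNReal.coe_mul,
        modularRatio_mul_inv]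
      simp
  choose U hU using hU
  obtain ⟨σ, hσ⟩ := exists_unitaryRep_of_total hd U (fun g k ω => by
      rw [hU, hU, map_smul, hU, smul_smul, hr, Label.shift_shift, mul_comm]
      simp [mul_comm]) (fun ω => by
      simp_rw [hU]
      have h1 : Continuous fun h : H => ((√(modularRatio H h : ℝ) : ℝ) : ℂ) :=
        Complex.continuous_ofReal.comp
          (Real.continuous_sqrt.comp (NNReal.continuous_coe.comp continuous_modularRatio))
      have h2 : Continuous fun h : H => κ (ω.shift h) :=
        hκ.comp (Label.continuous_shift.comp (continuous_subtype_val.prodMk continuous_const))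
      exact h1.smul h2)
  exact ⟨K, i₁, i₂, i₃, i₄, κ, σ, hκ, hin, hd, fun h ω => by rw [hσ, hU]⟩

end LocalisationObservable
end Fibre

/-! ### The square root of the total operator -/

section SqrtTotal
open scoped InnerProductSpace

variable {G : Type*} [Group G] [TopologicalSpace G] [IsTopologicalGroup G] [LocallyCompactSpace G]
  [T2Space G] [SecondCountableTopology G] [MeasurableSpace G] [BorelSpace G] {H : Subgroup G}
  {V : Type*} [NormedAddCommGroup V] [InnerProductSpace ℂ V] [CompleteSpace V]
  {V' : Type*} [NormedAddCommGroup V'] [InnerProductSpace ℂ V'] [CompleteSpace V']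
  {π : UnitaryRep G V} (E : LocalisationObservable H π)
  {π' : UnitaryRep G V'} (E' : LocalisationObservable H π')

namespace LocalisationObservable

theorem isPositive_sqrtTotal : E.sqrtTotal.IsPositive :=
  (ContinuousLinearMap.nonneg_iff_isPositive _).1 (CFC.sqrt_nonneg _)

theorem sqrtTotal_sqrtTotal (v : V) : E.sqrtTotal (E.sqrtTotal v) = E Set.univ v :=
  congrArg (fun T : V →L[ℂ] V => T v) (CFC.sqrt_mul_sqrt_self (E Set.univ)
    ((ContinuousLinearMap.nonneg_iff_isPositive _).2 (E.isPositive _ MeasurableSet.univ)))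

theorem inner_sqrtTotal_left (v w : V) : ⟪E.sqrtTotal v, w⟫_ℂ = ⟪v, E.sqrtTotal w⟫_ℂ :=
  E.isPositive_sqrtTotal.isSymmetric v w

theorem injective_sqrtTotal : Function.Injective E.sqrtTotal := fun v w h =>
  E.injective_univ (by rw [← sqrtTotal_sqrtTotal, ← sqrtTotal_sqrtTotal, h])

theorem dense_range_sqrtTotal : DenseRange E.sqrtTotal := by
  have h : Dense (Submodule.span ℂ (Set.range E.sqrtTotal) : Set V) := by
    refine dense_span_of_inner_eq_zero fun u hu => ?_
    refine E.injective_sqrtTotal ?_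
    rw [map_zero, ← inner_self_eq_zero (𝕜 := ℂ), inner_sqrtTotal_left]
    exact hu _
  have e : (Submodule.span ℂ (Set.range E.sqrtTotal) : Set V) = Set.range E.sqrtTotal := by
    have := Submodule.span_eq (LinearMap.range (E.sqrtTotal : V →ₗ[ℂ] V))
    exact congrArg (fun p : Submodule ℂ V => (p : Set V)) this
  rwa [e] at h

theorem norm_sqrtTotal_sq (v : V) : ((‖E.sqrtTotal v‖ ^ 2 : ℝ) : ℂ) = ⟪E Set.univ v, v⟫_ℂ := by
  rw [← sqrtTotal_sqrtTotal, inner_sqrtTotal_left, inner_self_eq_norm_sq_to_K]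
  simp

variable {E E'}

/-- The square root is natural for unitary operators, by uniqueness of positive square roots. -/
theorem sqrtTotal_apply_equiv (T : V ≃ₗᵢ[ℂ] V')
    (hT : ∀ v, E' Set.univ (T v) = T (E Set.univ v)) (v : V) :
    E'.sqrtTotal (T v) = T (E.sqrtTotal v) := by
  let S : V →L[ℂ] V := (T.symm.toContinuousLinearEquiv : V' →L[ℂ] V) ∘L E'.sqrtTotal ∘L
    (T.toContinuousLinearEquiv : V →L[ℂ] V')
  have hS : ∀ u, S u = T.symm (E'.sqrtTotal (T u)) := fun u => rfl
  have hinner : ∀ u w, ⟪T.symm u, w⟫_ℂ = ⟪u, T w⟫_ℂ := fun u w => by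
    rw [← T.inner_map_map, T.apply_symm_apply]
  have hpos : S.IsPositive := by
    rw [ContinuousLinearMap.isPositive_iff_complex]
    intro u
    rw [hS, hinner]
    exact (ContinuousLinearMap.isPositive_iff_complex _).1 E'.isPositive_sqrtTotal (T u)
  have e : E.sqrtTotal = S := by
    refine CFC.sqrt_unique ?_ ((ContinuousLinearMap.nonneg_iff_isPositive _).2 hpos)
    ext u
    change S (S u) = _
    rw [hS, hS, T.apply_symm_apply, sqrtTotal_sqrtTotal, hT, T.symm_apply_apply]
  rw [e, hS, T.apply_symm_apply]

theorem sqrtTotal_apply_rep (E : LocalisationObservable H π) (g : G) (v : V) :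
    E.sqrtTotal (π g v) = π g (E.sqrtTotal v) := by
  refine sqrtTotal_apply_equiv (π g) (fun v => ?_) v
  have h := E.covariant g Set.univ MeasurableSet.univ (π g v)
  rw [UnitaryRep.inv_apply_apply, Set.smul_set_univ] at h
  exact h.symm

end LocalisationObservable
end SqrtTotal

/-! ### The measures on `G ⧸ H` defined by covariant functions -/

section CosetMeasure
open scoped InnerProductSpace

variable {G : Type*} [Group G] [TopologicalSpace G] [IsTopologicalGroup G] [LocallyCompactSpace G]
  [T2Space G] [SecondCountableTopology G] [MeasurableSpace G] [BorelSpace G]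
  {H : Subgroup G} [hH : IsClosed (H : Set G)]
  (μG : Measure G) [μG.IsHaarMeasure] {μH : Measure H} [μH.IsHaarMeasure]
  (θ : BruhatFunction H μH)

/-- Weil's formula: against a function with the covariance of `‖F‖²`, the function `a` may be
replaced by its mean over the cosets of `H`, weighted by `θ`. -/
theorem lintegral_mul_eq_lintegral_bruhat {φ : G → ℝ≥0∞} (hφm : AEMeasurable φ μG)
    (hφ : ∀ h : H, ∀ᵐ g ∂μG, φ (g * h) = modularRatio H h * φ g) {a : G → ℝ≥0∞}
    (ha : Measurable a) :
    ∫⁻ g, φ g * a g ∂μG = ∫⁻ g, φ g * θ.toFun g * ∫⁻ h : H, a (g * h) ∂μH ∂μG := by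
  have mθ : Measurable fun g => (θ.toFun g : ℝ≥0∞) :=
    θ.continuous_toFun.measurable.coe_nnreal_ennreal
  have hc := θ.continuous_toFun
  have mΔ : Measurable fun h : H => (modularFunction h⁻¹ : ℝ≥0∞) :=
    (measurable_modularFunction.comp measurable_inv).coe_nnreal_ennreal
  have hinner : ∀ h : H, ∫⁻ g, φ g * a g * θ.toFun (g * h) ∂μG =
      ∫⁻ g, φ g * θ.toFun g * (modularFunction h⁻¹ * a (g * (h⁻¹ : H))) ∂μG := by
    intro h
    have e := lintegral_mul_right_haar μG (h : G)
      (fun g => φ (g * (h⁻¹ : H)) * a (g * (h⁻¹ : H)) * θ.toFun g)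
    simp only [Subgroup.coe_inv, mul_inv_cancel_right] at e
    rw [e, ← lintegral_const_mul' _ _ ENNReal.coe_ne_top]
    refine lintegral_congr_ae ?_
    filter_upwards [hφ h⁻¹] with g hg
    simp only [Subgroup.coe_inv] at hg ⊢
    rw [hg]
    have hr : modularFunction (h : G)⁻¹ * modularRatio H h⁻¹ = modularFunction h⁻¹ := by
      rw [modularRatio, Subgroup.coe_inv, mul_comm, div_mul_cancel₀ _ (modularFunction_pos _).ne']
    rw [← hr, ENNReal.coe_mul]
    ring
  calc ∫⁻ g, φ g * a g ∂μG
      = ∫⁻ g, ∫⁻ h : H, φ g * a g * θ.toFun (g * h) ∂μH ∂μG := by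
        refine lintegral_congr fun g => ?_
        rw [lintegral_const_mul _ (by fun_prop), θ.lintegral_toFun, mul_one]
    _ = ∫⁻ h : H, ∫⁻ g, φ g * a g * θ.toFun (g * h) ∂μG ∂μH := by
        refine lintegral_lintegral_swap ?_
        refine (hφm.comp_fst.mul (ha.comp measurable_fst).aemeasurable).mul ?_
        exact (mθ.comp (by fun_prop)).aemeasurable
    _ = ∫⁻ h : H, ∫⁻ g, φ g * θ.toFun g * (modularFunction h⁻¹ * a (g * (h⁻¹ : H))) ∂μG ∂μH :=
        lintegral_congr hinner
    _ = ∫⁻ g, ∫⁻ h : H, φ g * θ.toFun g * (modularFunction h⁻¹ * a (g * (h⁻¹ : H))) ∂μH ∂μG := by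
        refine (lintegral_lintegral_swap ?_).symm
        refine (hφm.comp_fst.mul (by fun_prop)).mul ?_
        exact ((mΔ.comp measurable_snd).mul (ha.comp (by fun_prop))).aemeasurable
    _ = ∫⁻ g, φ g * θ.toFun g * ∫⁻ h : H, a (g * h) ∂μH ∂μG := by
        refine lintegral_congr fun g => ?_
        have hm : Measurable fun h : H => (modularFunction h⁻¹ * a (g * (h⁻¹ : H)) : ℝ≥0∞) :=
          mΔ.mul (ha.comp (by fun_prop))
        rw [lintegral_const_mul _ hm, lintegral_inv_haar μH (fun h => a (g * (h : H)))]

variable {K : Type*} [NormedAddCommGroup K] [InnerProductSpace ℂ K] {σ : UnitaryRep H K}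
  {K' : Type*} [NormedAddCommGroup K'] [InnerProductSpace ℂ K'] {σ' : UnitaryRep H K'}

/-- The measure `Y ↦ ∫ χ_Y(gH) ‖F g‖² θ(g) dg` on `G ⧸ H`. -/
def cosetMeasure (F : G → K) : Measure (G ⧸ H) :=
  (μG.withDensity fun g => ‖F g‖ₑ ^ 2 * θ.toFun g).map QuotientGroup.mk

theorem measurable_mk : Measurable (QuotientGroup.mk : G → G ⧸ H) :=
  QuotientGroup.continuous_mk.measurable

variable {μG θ}

theorem cosetMeasure_apply (F : G → K) {Y : Set (G ⧸ H)} (hY : MeasurableSet Y) :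
    cosetMeasure μG θ F Y =
      ∫⁻ g in (QuotientGroup.mk : G → G ⧸ H) ⁻¹' Y, ‖F g‖ₑ ^ 2 * θ.toFun g ∂μG := by
  rw [cosetMeasure, map_apply measurable_mk hY, withDensity_apply _ (measurable_mk hY)]

theorem enorm_inducedPVM_sq (f : inducedSpace μG θ σ) {Y : Set (G ⧸ H)} (hY : MeasurableSet Y) :
    ‖inducedPVM μG θ σ Y hY f‖ₑ ^ 2 = cosetMeasure μG θ (inducedRepr f) Y := by
  rw [cosetMeasure_apply _ hY, enorm_sq_eq, ← lintegral_indicator (measurable_mk hY)]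
  refine lintegral_congr_ae ?_
  filter_upwards [inducedRepr_inducedCutoff Y hY f] with g hg
  change ‖inducedRepr (inducedCutoff Y hY f) g‖ₑ ^ 2 * _ = _
  rw [hg]
  by_cases hx : g ∈ (QuotientGroup.mk : G → G ⧸ H) ⁻¹' Y
  · rw [Set.indicator_of_mem hx, Set.indicator_of_mem hx]
  · rw [Set.indicator_of_notMem hx, Set.indicator_of_notMem hx]
    simp

instance isFiniteMeasure_cosetMeasure (f : inducedSpace μG θ σ) :
    IsFiniteMeasure (cosetMeasure μG θ (inducedRepr f)) :=
  ⟨by rw [← enorm_inducedPVM_sq f MeasurableSet.univ]; exact ENNReal.pow_lt_top enorm_lt_top⟩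

theorem lintegral_cosetMeasure {F : G → K} (hF : AEStronglyMeasurable F μG)
    {ψ : G ⧸ H → ℝ≥0∞} (hψ : Measurable ψ) :
    ∫⁻ x, ψ x ∂(cosetMeasure μG θ F) = ∫⁻ g, ‖F g‖ₑ ^ 2 * θ.toFun g * ψ (g : G ⧸ H) ∂μG := by
  have hc := θ.continuous_toFun
  have hm : AEMeasurable (fun g => ‖F g‖ₑ ^ 2 * (θ.toFun g : ℝ≥0∞)) μG :=
    (hF.enorm.pow_const 2).mul (by fun_prop)
  rw [cosetMeasure, lintegral_map hψ measurable_mk]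
  exact lintegral_withDensity_eq_lintegral_mul₀ hm (hψ.comp measurable_mk).aemeasurable

theorem IsCovariant.lintegral_mul {F : G → K} (hF : AEStronglyMeasurable F μG)
    (hc : IsCovariant μG σ F) (θ : BruhatFunction H μH) {a : G → ℝ≥0} (ha : Continuous a)
    (hac : HasCompactSupport a) :
    ∫⁻ g, ‖F g‖ₑ ^ 2 * a g ∂μG =
      ∫⁻ x, ENNReal.ofReal (fold μH (fun g => (a g : ℝ)) x) ∂(cosetMeasure μG θ F) := by
  have har : Continuous fun g => (a g : ℝ) := by fun_prop
  have hacr : HasCompactSupport fun g => (a g : ℝ) :=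
    hac.comp_left (g := fun r : ℝ≥0 => (r : ℝ)) NNReal.coe_zero
  rw [lintegral_mul_eq_lintegral_bruhat μG θ (hF.enorm.pow_const 2) hc.enorm_sq
      (ha.measurable.coe_nnreal_ennreal),
    lintegral_cosetMeasure hF (continuous_fold μH har hacr).measurable.ennreal_ofReal]
  refine lintegral_congr fun g => ?_
  rw [fold_mk, ofReal_integral_eq_lintegral_ofReal (integrable_coset μH har hacr g)
    (Filter.Eventually.of_forall fun _ => NNReal.coe_nonneg _)]
  simp only [ENNReal.ofReal_coe_nnreal]

theorem IsCovariant.isFiniteMeasureOnCompacts {F : G → K} (hF : AEStronglyMeasurable F μG)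
    (hc : IsCovariant μG σ F) (θ : BruhatFunction H μH)
    [IsFiniteMeasure (cosetMeasure μG θ F)] :
    IsFiniteMeasureOnCompacts (μG.withDensity fun g => ‖F g‖ₑ ^ 2) := by
  refine ⟨fun C hC => ?_⟩
  obtain ⟨a, ha1, hac, -, ha2⟩ := exists_continuousMap_one_of_isCompact_subset_isOpen
    hC isOpen_univ (Set.subset_univ _)
  have har : Continuous fun g => ((a g).toNNReal : ℝ) := by fun_prop
  have hacn : HasCompactSupport fun g => (a g).toNNReal :=
    HasCompactSupport.comp_left (g := Real.toNNReal) hac Real.toNNReal_zero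
  have hacr : HasCompactSupport fun g => ((a g).toNNReal : ℝ) :=
    hacn.comp_left (g := fun r : ℝ≥0 => (r : ℝ)) NNReal.coe_zero
  obtain ⟨M, hM⟩ := LocalisationObservable.exists_fold_le (H := H) μH har hacr
  calc (μG.withDensity fun g => ‖F g‖ₑ ^ 2) C = ∫⁻ g in C, ‖F g‖ₑ ^ 2 ∂μG :=
        withDensity_apply _ hC.measurableSet
    _ = ∫⁻ g in C, ‖F g‖ₑ ^ 2 * (a g).toNNReal ∂μG := by
        refine setLIntegral_congr_fun hC.measurableSet fun g hg => ?_
        simp [ha1 hg]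
    _ ≤ ∫⁻ g, ‖F g‖ₑ ^ 2 * (a g).toNNReal ∂μG := setLIntegral_le_lintegral _ _
    _ = _ := hc.lintegral_mul hF θ (by fun_prop) hacn
    _ ≤ ∫⁻ _, ENNReal.ofReal M ∂(cosetMeasure μG θ F) :=
        lintegral_mono fun x => ENNReal.ofReal_le_ofReal ((le_abs_self _).trans (hM x))
    _ < ∞ := by
        rw [lintegral_const]
        exact ENNReal.mul_lt_top ENNReal.ofReal_lt_top (measure_lt_top _ _)

/-- A covariant function is determined in norm by the measure it defines on `G ⧸ H`: by Weil's
formula the measure determines the integrals of `‖F‖²` against compactly supported functions. -/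
theorem IsCovariant.enorm_ae_eq {F : G → K} (hF : AEStronglyMeasurable F μG)
    (hc : IsCovariant μG σ F) {F' : G → K'} (hF' : AEStronglyMeasurable F' μG)
    (hc' : IsCovariant μG σ' F') (θ : BruhatFunction H μH)
    [IsFiniteMeasure (cosetMeasure μG θ F)]
    (he : cosetMeasure μG θ F = cosetMeasure μG θ F') : ∀ᵐ g ∂μG, ‖F g‖ = ‖F' g‖ := by
  have : IsFiniteMeasure (cosetMeasure μG θ F') := he ▸ inferInstance
  have := hc.isFiniteMeasureOnCompacts hF θ
  have := hc'.isFiniteMeasureOnCompacts hF' θ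
  have m : AEMeasurable (fun g => ‖F g‖ₑ ^ 2) μG := hF.enorm.pow_const 2
  have m' : AEMeasurable (fun g => ‖F' g‖ₑ ^ 2) μG := hF'.enorm.pow_const 2
  have h : (μG.withDensity fun g => ‖F g‖ₑ ^ 2) = μG.withDensity fun g => ‖F' g‖ₑ ^ 2 := by
    refine Measure.ext_of_integral_eq_on_compactlySupported_nnreal fun a => ?_
    have ma : Measurable fun g => (a g : ℝ≥0∞) := a.continuous.measurable.coe_nnreal_ennreal
    have key : ∫⁻ g, (a g : ℝ≥0∞) ∂(μG.withDensity fun g => ‖F g‖ₑ ^ 2) =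
        ∫⁻ g, (a g : ℝ≥0∞) ∂(μG.withDensity fun g => ‖F' g‖ₑ ^ 2) := by
      rw [lintegral_withDensity_eq_lintegral_mul₀ m ma.aemeasurable,
        lintegral_withDensity_eq_lintegral_mul₀ m' ma.aemeasurable]
      refine (hc.lintegral_mul hF θ a.continuous a.hasCompactSupport).trans ?_
      rw [he]
      exact (hc'.lintegral_mul hF' θ a.continuous a.hasCompactSupport).symm
    have har : Continuous fun g => (a g : ℝ) := NNReal.continuous_coe.comp a.continuous
    rw [integral_eq_lintegral_of_nonneg_ae
        (Filter.Eventually.of_forall fun _ => NNReal.coe_nonneg _) har.aestronglyMeasurable,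
      integral_eq_lintegral_of_nonneg_ae
        (Filter.Eventually.of_forall fun _ => NNReal.coe_nonneg _) har.aestronglyMeasurable]
    simp only [ENNReal.ofReal_coe_nnreal]
    rw [key]
  filter_upwards [(withDensity_eq_iff_of_sigmaFinite m m').1 h] with g hg
  have := (ENNReal.pow_right_strictMono two_ne_zero).injective hg
  rw [← toReal_enorm, this, toReal_enorm]

end CosetMeasure

/-! ### The projection valued measure of an induced representation -/

section InducedPVM
open scoped InnerProductSpace

variable {G : Type*} [Group G] [TopologicalSpace G] [IsTopologicalGroup G] [LocallyCompactSpace G]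
  [T2Space G] [SecondCountableTopology G] [MeasurableSpace G] [BorelSpace G]
  {H : Subgroup G} [hH : IsClosed (H : Set G)]
  {μG : Measure G} [μG.IsHaarMeasure] {μH : Measure H} [μH.IsHaarMeasure]
  {θ : BruhatFunction H μH}
  {K : Type*} [NormedAddCommGroup K] [InnerProductSpace ℂ K] {σ : UnitaryRep H K}

theorem inducedRepr_inducedPVM {Y : Set (G ⧸ H)} (hY : MeasurableSet Y)
    (f : inducedSpace μG θ σ) : inducedRepr (inducedPVM μG θ σ Y hY f) =ᵐ[μG]
      ((QuotientGroup.mk : G → G ⧸ H) ⁻¹' Y).indicator (inducedRepr f) :=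
  inducedRepr_inducedCutoff Y hY f

theorem inducedRepr_inducedRep (g : G) (f : inducedSpace μG θ σ) :
    inducedRepr (inducedRep μG θ σ g f) =ᵐ[μG] fun x => inducedRepr f (g⁻¹ * x) :=
  inducedRepr_inducedTranslate g f

theorem inducedPVM_inducedPVM {Y Y' : Set (G ⧸ H)} (hY : MeasurableSet Y)
    (hY' : MeasurableSet Y') (f : inducedSpace μG θ σ) :
    inducedPVM μG θ σ Y hY (inducedPVM μG θ σ Y' hY' f) =
      inducedPVM μG θ σ (Y ∩ Y') (hY.inter hY') f := by
  apply inducedSpace_ext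
  filter_upwards [inducedRepr_inducedPVM hY (inducedPVM μG θ σ Y' hY' f),
    inducedRepr_inducedPVM hY' f, inducedRepr_inducedPVM (hY.inter hY') f] with g h1 h2 h3
  rw [h1, h3, Set.preimage_inter, ← Set.indicator_indicator]
  by_cases hx : g ∈ (QuotientGroup.mk : G → G ⧸ H) ⁻¹' Y
  · rw [Set.indicator_of_mem hx, Set.indicator_of_mem hx, h2]
  · rw [Set.indicator_of_notMem hx, Set.indicator_of_notMem hx]

theorem inducedPVM_univ (f : inducedSpace μG θ σ) :
    inducedPVM μG θ σ Set.univ MeasurableSet.univ f = f := by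
  apply inducedSpace_ext
  filter_upwards [inducedRepr_inducedPVM MeasurableSet.univ f] with g h1
  rw [h1, Set.preimage_univ, Set.indicator_univ]

theorem inducedRep_inducedPVM {Y : Set (G ⧸ H)} (hY : MeasurableSet Y) (g : G)
    (f : inducedSpace μG θ σ) :
    inducedRep μG θ σ g (inducedPVM μG θ σ Y hY f) =
      inducedPVM μG θ σ ((g⁻¹ • ·) ⁻¹' Y) (measurable_const_smul g⁻¹ hY)
        (inducedRep μG θ σ g f) := by
  apply inducedSpace_ext
  filter_upwards [inducedRepr_inducedRep g (inducedPVM μG θ σ Y hY f),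
    (measurePreserving_mul_left μG g⁻¹).quasiMeasurePreserving.ae (inducedRepr_inducedPVM hY f),
    inducedRepr_inducedPVM (measurable_const_smul g⁻¹ hY) (inducedRep μG θ σ g f),
    inducedRepr_inducedRep g f] with x h1 h2 h3 h4
  rw [h1, h2, h3]
  by_cases hx : g⁻¹ * x ∈ (QuotientGroup.mk : G → G ⧸ H) ⁻¹' Y
  · rw [Set.indicator_of_mem hx, Set.indicator_of_mem (by exact hx), h4]
  · rw [Set.indicator_of_notMem hx, Set.indicator_of_notMem (by exact hx)]

theorem inner_inducedPVM_left {Y : Set (G ⧸ H)} (hY : MeasurableSet Y)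
    (f f' : inducedSpace μG θ σ) :
    ⟪inducedPVM μG θ σ Y hY f, f'⟫_ℂ = ⟪f, inducedPVM μG θ σ Y hY f'⟫_ℂ := by
  change inner ℂ ((inducedPVM μG θ σ Y hY f : inducedSpace μG θ σ) :
      Lp K 2 (weightedMeasure μG θ)) (f' : Lp K 2 (weightedMeasure μG θ)) =
    inner ℂ (f : Lp K 2 (weightedMeasure μG θ))
      ((inducedPVM μG θ σ Y hY f' : inducedSpace μG θ σ) : Lp K 2 (weightedMeasure μG θ))
  rw [L2.inner_def, L2.inner_def]
  refine integral_congr_ae ?_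
  have ac := weightedMeasure_absolutelyContinuous (μG := μG) (θ := θ)
  filter_upwards [coe_ae_eq_inducedRepr f, coe_ae_eq_inducedRepr f',
    coe_ae_eq_inducedRepr (inducedPVM μG θ σ Y hY f),
    coe_ae_eq_inducedRepr (inducedPVM μG θ σ Y hY f'),
    ac.ae_le (inducedRepr_inducedPVM hY f), ac.ae_le (inducedRepr_inducedPVM hY f')]
    with x h1 h2 h3 h4 h5 h6
  rw [h1, h2, h3, h4, h5, h6]
  by_cases hx : x ∈ (QuotientGroup.mk : G → G ⧸ H) ⁻¹' Y
  · rw [Set.indicator_of_mem hx, Set.indicator_of_mem hx]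
  · rw [Set.indicator_of_notMem hx, Set.indicator_of_notMem hx, inner_zero_left, inner_zero_right]

theorem norm_inducedPVM_sq {Y : Set (G ⧸ H)} (hY : MeasurableSet Y) (f : inducedSpace μG θ σ) :
    ((‖inducedPVM μG θ σ Y hY f‖ ^ 2 : ℝ) : ℂ) = ⟪inducedPVM μG θ σ Y hY f, f⟫_ℂ := by
  have e := inducedPVM_inducedPVM hY hY f
  simp only [Set.inter_self] at e
  conv_rhs => rw [← e, inner_inducedPVM_left]
  have h := inner_self_eq_norm_sq_to_K (𝕜 := ℂ) (inducedPVM μG θ σ Y hY f)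
  rw [h]
  simp

end InducedPVM

/-! ### Pointwise inner products of covariant functions -/

section Pointwise
open scoped InnerProductSpace

variable {G : Type*} [Group G] [TopologicalSpace G] [IsTopologicalGroup G] [LocallyCompactSpace G]
  [T2Space G] [SecondCountableTopology G] [MeasurableSpace G] [BorelSpace G]
  {H : Subgroup G} [hH : IsClosed (H : Set G)]
  {μG : Measure G} [μG.IsHaarMeasure] {μH : Measure H} [μH.IsHaarMeasure]
  {θ : BruhatFunction H μH}
  {K : Type*} [NormedAddCommGroup K] [InnerProductSpace ℂ K] {σ : UnitaryRep H K}
  {K' : Type*} [NormedAddCommGroup K'] [InnerProductSpace ℂ K'] {σ' : UnitaryRep H K'}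

theorem norm_inducedRepr_ae_eq (f : inducedSpace μG θ σ) (f' : inducedSpace μG θ σ')
    (h : ∀ (Y : Set (G ⧸ H)) (hY : MeasurableSet Y),
      ‖inducedPVM μG θ σ Y hY f‖ = ‖inducedPVM μG θ σ' Y hY f'‖) :
    ∀ᵐ g ∂μG, ‖inducedRepr f g‖ = ‖inducedRepr f' g‖ := by
  refine (isCovariant_inducedRepr f).enorm_ae_eq (aestronglyMeasurable_inducedRepr f)
    (aestronglyMeasurable_inducedRepr f') (isCovariant_inducedRepr f') θ
    (Measure.ext fun Y hY => ?_)
  rw [← enorm_inducedPVM_sq f hY, ← enorm_inducedPVM_sq f' hY, ← ofReal_norm, h Y hY, ofReal_norm]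

/-- The pointwise inner products of covariant functions are determined by the projection valued
measure: polarise the statement for norms. -/
theorem inner_inducedRepr_ae_eq (f₁ f₂ : inducedSpace μG θ σ) (f₁' f₂' : inducedSpace μG θ σ')
    (h : ∀ (c : ℂ) (Y : Set (G ⧸ H)) (hY : MeasurableSet Y),
      ‖inducedPVM μG θ σ Y hY (f₁ + c • f₂)‖ = ‖inducedPVM μG θ σ' Y hY (f₁' + c • f₂')‖) :
    ∀ᵐ g ∂μG, ⟪inducedRepr f₁ g, inducedRepr f₂ g⟫_ℂ =
      ⟪inducedRepr f₁' g, inducedRepr f₂' g⟫_ℂ := by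
  have key : ∀ c : ℂ, ∀ᵐ g ∂μG, ‖inducedRepr f₁ g + c • inducedRepr f₂ g‖ =
      ‖inducedRepr f₁' g + c • inducedRepr f₂' g‖ := by
    intro c
    filter_upwards [norm_inducedRepr_ae_eq _ _ (h c), inducedRepr_add f₁ (c • f₂),
      inducedRepr_add f₁' (c • f₂'), inducedRepr_smul c f₂, inducedRepr_smul c f₂']
      with g h1 h2 h3 h4 h5
    rw [h2, h3, Pi.add_apply, Pi.add_apply, h4, h5] at h1
    exact h1
  filter_upwards [key 1, key (-1), key Complex.I, key (-Complex.I)] with g h1 h2 h3 h4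
  simp only [one_smul, neg_smul, ← sub_eq_add_neg] at h1 h2 h3 h4
  rw [inner_eq_sum_norm_sq_div_four, inner_eq_sum_norm_sq_div_four]
  simp only [RCLike.I_to_complex, h1, h2, h3, h4]

theorem inner_inducedRepr_ae_eq_zero (f₁ f₂ : inducedSpace μG θ σ)
    (h : ∀ (Y : Set (G ⧸ H)) (hY : MeasurableSet Y), ⟪f₁, inducedPVM μG θ σ Y hY f₂⟫_ℂ = 0) :
    ∀ᵐ g ∂μG, ⟪inducedRepr f₁ g, inducedRepr f₂ g⟫_ℂ = 0 := by
  have h1 := inner_inducedRepr_ae_eq f₁ f₂ f₁ ((-1 : ℂ) • f₂) fun c Y hY => by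
    have ho : ∀ z : ℂ, ⟪inducedPVM μG θ σ Y hY f₁, z • inducedPVM μG θ σ Y hY f₂⟫_ℂ = 0 := by
      intro z
      refine (inner_smul_right (𝕜 := ℂ) (inducedPVM μG θ σ Y hY f₁) _ _).trans ?_
      rw [inner_inducedPVM_left, inducedPVM_inducedPVM]
      simp only [Set.inter_self, h Y hY, mul_zero]
    rw [map_add, map_add, smul_smul, map_smul, map_smul, mul_neg_one]
    refine (sq_eq_sq₀ (norm_nonneg _) (norm_nonneg _)).1 ?_
    rw [sq, sq, norm_add_sq_eq_norm_sq_add_norm_sq_of_inner_eq_zero _ _ (ho c),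
      norm_add_sq_eq_norm_sq_add_norm_sq_of_inner_eq_zero _ _ (ho (-c)), neg_smul, norm_neg]
  filter_upwards [h1, inducedRepr_smul (-1 : ℂ) f₂] with g h1 h2
  rw [h2, Pi.smul_apply, inner_smul_right, neg_one_mul] at h1
  exact self_eq_neg.1 h1

end Pointwise

/-! ### Total families of smoothed vectors -/

section Total
open scoped InnerProductSpace

theorem re_integral_mul_pos {X : Type*} [TopologicalSpace X] [MeasurableSpace X]
    [OpensMeasurableSpace X] (μ : Measure X) [μ.IsOpenPosMeasure] [IsFiniteMeasureOnCompacts μ]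
    {f : X → ℝ} (hf : Continuous f) (hfc : HasCompactSupport f) (hf0 : ∀ x, 0 ≤ f x)
    {D : X → ℂ} (hD : Continuous D) (hpos : ∀ x ∈ tsupport f, 0 < (D x).re) {x₀ : X}
    (hx₀ : f x₀ ≠ 0) : 0 < (∫ x, (f x : ℂ) * D x ∂μ).re := by
  have hint : Integrable (fun x => (f x : ℂ) * D x) μ := by
    refine Continuous.integrable_of_hasCompactSupport (by fun_prop) ?_
    exact (hfc.comp_left (g := fun r : ℝ => (r : ℂ)) Complex.ofReal_zero).mul_right
  have h2 : (∫ x, (f x : ℂ) * D x ∂μ).re = ∫ x, f x * (D x).re ∂μ := by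
    have := integral_re hint
    simp only [RCLike.re_eq_complex_re, Complex.re_ofReal_mul] at this
    exact this.symm
  rw [h2]
  have hre : Continuous fun x => (D x).re := Complex.continuous_re.comp hD
  refine Continuous.integral_pos_of_hasCompactSupport_nonneg_nonzero (x := x₀) (by fun_prop)
    hfc.mul_right (fun x => ?_) (mul_ne_zero hx₀ (hpos _ (subset_tsupport _ hx₀)).ne')
  by_cases hx : x ∈ tsupport f
  · exact mul_nonneg (hf0 x) (hpos x hx).le
  · change 0 ≤ f x * _
    rw [image_eq_zero_of_notMem_tsupport hx, zero_mul]

variable {G : Type*} [Group G] [TopologicalSpace G] [IsTopologicalGroup G] [LocallyCompactSpace G]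
  [T2Space G] [SecondCountableTopology G] [MeasurableSpace G] [BorelSpace G]

variable (G) in
theorem exists_bump_sequence : ∃ φ : ℕ → G → ℝ, (∀ n, Continuous (φ n)) ∧
    (∀ n, HasCompactSupport (φ n)) ∧ (∀ n x, 0 ≤ φ n x) ∧ (∀ n, φ n 1 = 1) ∧
    ∀ U ∈ 𝓝 (1 : G), ∃ n, tsupport (φ n) ⊆ U := by
  obtain ⟨U, hU⟩ := (𝓝 (1 : G)).exists_antitone_basis
  choose φ h1 h2 h3 h4 h5 using fun n => exists_bump (hU.mem n)
  refine ⟨φ, h1, h2, h3, h4, fun W hW => ?_⟩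
  obtain ⟨n, hn⟩ := hU.mem_iff.1 hW
  exact ⟨n, (h5 n).trans hn⟩

variable (μG : Measure G) [μG.IsHaarMeasure]
  {V : Type*} [NormedAddCommGroup V] [InnerProductSpace ℂ V] [CompleteSpace V]

theorem Label.dense_span_vec (π : UnitaryRep G V) {φ : ℕ → G → ℝ} (hφ : ∀ n, Continuous (φ n))
    (hφc : ∀ n, HasCompactSupport (φ n)) (hφ0 : ∀ n x, 0 ≤ φ n x) (hφ1 : ∀ n, φ n 1 = 1)
    (hφU : ∀ U ∈ 𝓝 (1 : G), ∃ n, tsupport (φ n) ⊆ U) :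
    Dense (Submodule.span ℂ (Set.range fun ω : Label G V => ω.vec μG π φ) : Set V) := by
  refine dense_span_of_inner_eq_zero fun u hu => ?_
  by_contra hne
  have hD : Continuous fun x => ⟪u, π x u⟫_ℂ := continuous_const.inner (π.continuous_apply u)
  have h1 : 0 < (⟪u, π 1 u⟫_ℂ).re := by
    rw [UnitaryRep.map_one_apply]
    exact (pow_pos (norm_pos_iff.2 hne) 2).trans_eq (inner_self_eq_norm_sq (𝕜 := ℂ) u).symm
  obtain ⟨n, hn⟩ := hφU {x | 0 < (⟪u, π x u⟫_ℂ).re}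
    (((Complex.continuous_re.comp hD).tendsto 1).eventually (lt_mem_nhds h1))
  have h2 := re_integral_mul_pos μG (hφ n) (hφc n) (hφ0 n) hD (fun x hx => hn hx) (x₀ := 1)
    (by simp [hφ1])
  have h3 := hu ((n, 1, u) : Label G V)
  have h4 : Label.test φ ((n, 1, u) : Label G V) = φ n := by funext x; simp [Label.test]
  rw [Label.vec, h4, UnitaryRep.smooth, ← integral_inner
    (UnitaryRep.integrable_smooth μG π (hφ n) (hφc n) u)] at h3
  simp_rw [inner_smul_right] at h3
  rw [h3, Complex.zero_re] at h2
  exact lt_irrefl _ h2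

end Total

/-! ### Existence of the inducing representation -/

section Existence
open scoped InnerProductSpace

variable {G : Type*} [Group G] [TopologicalSpace G] [IsTopologicalGroup G] [LocallyCompactSpace G]
  [T2Space G] [SecondCountableTopology G] [MeasurableSpace G] [BorelSpace G]
  {H : Subgroup G} [hH : IsClosed (H : Set G)]
  {μG : Measure G} [μG.IsHaarMeasure] {μH : Measure H} [μH.IsHaarMeasure]
  {V : Type*} [NormedAddCommGroup V] [InnerProductSpace ℂ V] [CompleteSpace V]
  {π : UnitaryRep G V} {E : LocalisationObservable H π}
  {K : Type*} [NormedAddCommGroup K] [InnerProductSpace ℂ K]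

/-- The covariant function on `G` with values in the fibre that represents a combination of smoothed
vectors. -/
def fibreFun (κ : Label G V → K) (s : Label G V →₀ ℂ) (g : G) : K :=
  Finsupp.linearCombination ℂ (fun ω => κ (ω.shift g⁻¹)) s

theorem continuous_fibreFun {κ : Label G V → K} (hκ : Continuous κ) (s : Label G V →₀ ℂ) :
    Continuous (fibreFun κ s) := by
  unfold fibreFun
  simp only [Finsupp.linearCombination_apply, Finsupp.sum]
  refine continuous_finsetSum _ fun ω _ => continuous_const.smul (hκ.comp ?_)
  exact Label.continuous_shift.comp (continuous_inv.prodMk continuous_const)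

theorem fibreFun_mul {κ : Label G V → K} {σ : UnitaryRep H K}
    (hσ : ∀ (h : H) (ω : Label G V),
      σ h (κ ω) = ((√(modularRatio H h : ℝ) : ℝ) : ℂ) • κ (ω.shift h))
    (s : Label G V →₀ ℂ) (g : G) (h : H) :
    fibreFun κ s (g * h) = ((√(modularRatio H h : ℝ) : ℝ) : ℂ) • σ h⁻¹ (fibreFun κ s g) := by
  have e : ((√(modularRatio H h : ℝ) : ℝ) : ℂ) * ((√(modularRatio H h⁻¹ : ℝ) : ℝ) : ℂ) = 1 := by
    rw [← Complex.ofReal_mul, ← Real.sqrt_mul (NNReal.coe_nonneg _), ← NNReal.coe_mul,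
      modularRatio_mul_inv]
    simp
  simp only [fibreFun, Finsupp.linearCombination_apply, Finsupp.sum, _root_.map_sum,
    Finset.smul_sum, map_smul]
  refine Finset.sum_congr rfl fun ω _ => ?_
  rw [hσ, smul_comm, smul_smul _ _ (κ _), e, one_smul, Label.shift_shift, mul_inv_rev,
    Subgroup.coe_inv]

theorem isCovariant_fibreFun {κ : Label G V → K} {σ : UnitaryRep H K}
    (hσ : ∀ (h : H) (ω : Label G V),
      σ h (κ ω) = ((√(modularRatio H h : ℝ) : ℝ) : ℂ) • κ (ω.shift h))
    (s : Label G V →₀ ℂ) : IsCovariant μG σ (fibreFun κ s) := fun h =>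
  Filter.Eventually.of_forall fun g => fibreFun_mul hσ s g h

section Measure
variable {φ : ℕ → G → ℝ} (hφ : ∀ n, Continuous (φ n)) (hφc : ∀ n, HasCompactSupport (φ n))
  {κ : Label G V → K} (hκ : Continuous κ)
  (hin : ∀ ω ω', ⟪κ ω, κ ω'⟫_ℂ = E.labelForm μG μH φ ω ω')
include hφ hφc hκ hin

theorem integral_mul_norm_fibreFun_sq {a : G → ℝ} (ha : Continuous a) (hac : HasCompactSupport a)
    (s : Label G V →₀ ℂ) :
    ∫ g, a g * ‖fibreFun κ s g‖ ^ 2 ∂μG = ∫ x, fold μH a x ∂(E.measure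
      (Finsupp.linearCombination ℂ (fun ω => ω.vec μG π φ) s)) := by
  have h1 := E.integral_mul_labelForm_sum μG μH hφ hφc ha hac s
  rw [E.inner_lift_self_eq_liftMeasure μH ha hac, E.integral_liftMeasure μH ha hac] at h1
  rw [← Complex.ofReal_inj, ← h1, ← integral_complex_ofReal]
  refine integral_congr_ae (Filter.Eventually.of_forall fun g => ?_)
  have h2 : ∀ u : K, ((‖u‖ : ℝ) : ℂ) ^ 2 = ⟪u, u⟫_ℂ := fun u => by
    rw [inner_self_eq_norm_sq_to_K]
    simp
  simp only [Complex.ofReal_mul, Complex.ofReal_pow, h2]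
  congr 1
  simp only [fibreFun, Finsupp.linearCombination_apply, Finsupp.sum, sum_inner, inner_sum,
    inner_smul_left, inner_smul_right, hin, Finset.mul_sum]
  rw [Finset.sum_comm]
  refine Finset.sum_congr rfl fun ω _ => Finset.sum_congr rfl fun ω' _ => ?_
  simp only [Complex.star_def]
  ring

theorem lintegral_cosetMeasure_fibreFun (θ : BruhatFunction H μH) {ψ : G ⧸ H → ℝ≥0}
    (hψ : Continuous ψ) (hψc : HasCompactSupport ψ) (s : Label G V →₀ ℂ) :
    ∫⁻ x, ψ x ∂(cosetMeasure μG θ (fibreFun κ s)) = ENNReal.ofReal (∫ x, (ψ x : ℝ) ∂(E.measure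
      (Finsupp.linearCombination ℂ (fun ω => ω.vec μG π φ) s))) := by
  have hc := θ.continuous_toFun
  have hF := continuous_fibreFun hκ s
  have hψr : HasCompactSupport fun x => (ψ x : ℝ) :=
    hψc.comp_left (g := fun r : ℝ≥0 => (r : ℝ)) NNReal.coe_zero
  have ha : Continuous fun g => (θ.toFun g : ℝ) * (ψ (g : G ⧸ H) : ℝ) := by
    have := hψ.comp (QuotientGroup.continuous_mk (N := H))
    exact (NNReal.continuous_coe.comp hc).mul (NNReal.continuous_coe.comp this)
  have hac := hasCompactSupport_bruhat_mul μH θ hψr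
  have h1 := integral_mul_norm_fibreFun_sq hφ hφc hκ hin ha hac s
  simp only [fold_bruhat_mul μH θ fun x => (ψ x : ℝ)] at h1
  rw [← h1, lintegral_cosetMeasure hF.aestronglyMeasurable hψ.measurable.coe_nnreal_ennreal,
    ofReal_integral_eq_lintegral_ofReal]
  · refine lintegral_congr fun g => ?_
    rw [ENNReal.ofReal_mul (by positivity), ENNReal.ofReal_mul (by positivity),
      ENNReal.ofReal_pow (norm_nonneg _), ofReal_norm, ENNReal.ofReal_coe_nnreal,
      ENNReal.ofReal_coe_nnreal]
    ring
  · exact Continuous.integrable_of_hasCompactSupport (ha.mul (by fun_prop)) hac.mul_right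
  · exact Filter.Eventually.of_forall fun g => by positivity

/-- The covariant function of a combination `v` of smoothed vectors defines the measure
`Y ↦ ⟨E(Y) v, v⟩`. -/
theorem cosetMeasure_fibreFun (θ : BruhatFunction H μH) (s : Label G V →₀ ℂ) :
    cosetMeasure μG θ (fibreFun κ s) =
      E.measure (Finsupp.linearCombination ℂ (fun ω => ω.vec μG π φ) s) := by
  have hfin : IsFiniteMeasureOnCompacts (cosetMeasure μG θ (fibreFun κ s)) := by
    refine ⟨fun C hC => ?_⟩
    obtain ⟨a, ha1, hac, -, ha2⟩ := exists_continuousMap_one_of_isCompact_subset_isOpen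
      hC isOpen_univ (Set.subset_univ _)
    have hacn : HasCompactSupport fun g => (a g).toNNReal :=
      HasCompactSupport.comp_left (g := Real.toNNReal) hac Real.toNNReal_zero
    calc cosetMeasure μG θ (fibreFun κ s) C
        = ∫⁻ _ in C, 1 ∂(cosetMeasure μG θ (fibreFun κ s)) := by simp
      _ = ∫⁻ x in C, (a x).toNNReal ∂(cosetMeasure μG θ (fibreFun κ s)) := by
          refine setLIntegral_congr_fun hC.measurableSet fun g hg => ?_
          simp [ha1 hg]
      _ ≤ ∫⁻ x, (a x).toNNReal ∂(cosetMeasure μG θ (fibreFun κ s)) :=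
          setLIntegral_le_lintegral _ _
      _ = _ := lintegral_cosetMeasure_fibreFun hφ hφc hκ hin θ (by fun_prop) hacn s
      _ < ∞ := ENNReal.ofReal_lt_top
  refine Measure.ext_of_integral_eq_on_compactlySupported_nnreal fun ψ => ?_
  have hr : Continuous fun x => (ψ x : ℝ) := NNReal.continuous_coe.comp ψ.continuous
  rw [integral_eq_lintegral_of_nonneg_ae
    (Filter.Eventually.of_forall fun _ => NNReal.coe_nonneg _) hr.aestronglyMeasurable]
  simp only [ENNReal.ofReal_coe_nnreal]
  exact (congrArg ENNReal.toReal (lintegral_cosetMeasure_fibreFun hφ hφc hκ hin θ ψ.continuous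
    ψ.hasCompactSupport s)).trans
      (ENNReal.toReal_ofReal (integral_nonneg fun _ => NNReal.coe_nonneg _))

theorem memLp_fibreFun (θ : BruhatFunction H μH) (s : Label G V →₀ ℂ) :
    MemLp (fibreFun κ s) 2 (weightedMeasure μG θ) := by
  refine ⟨(continuous_fibreFun hκ s).aestronglyMeasurable, ?_⟩
  have h : eLpNorm (fibreFun κ s) 2 (weightedMeasure μG θ) ^ 2 < ∞ := by
    have e := cosetMeasure_apply (μG := μG) (θ := θ) (fibreFun κ s) MeasurableSet.univ
    rw [Set.preimage_univ, setLIntegral_univ, ← eLpNorm_weighted_sq] at e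
    rw [← e, cosetMeasure_fibreFun hφ hφc hκ hin θ s]
    exact measure_lt_top _ _
  exact (ENNReal.pow_lt_top_iff.1 h).resolve_right two_ne_zero

end Measure

/-- The existence part of the theorem, for the fibre space `K` spanned by vectors `κ ω` whose Gram
matrix is the labelled form. The isometry `W` sends `E(X)^{1/2} v`, for a combination `v` of
smoothed vectors, to the function `fibreFun κ v`. -/
theorem exists_isMackeyPair_of_fibre [TopologicalSpace.SeparableSpace V] [CompleteSpace K]
    (θ : BruhatFunction H μH)
    {φ : ℕ → G → ℝ} (hφ : ∀ n, Continuous (φ n)) (hφc : ∀ n, HasCompactSupport (φ n))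
    (hd : Dense (Submodule.span ℂ (Set.range fun ω : Label G V => ω.vec μG π φ) : Set V))
    {κ : Label G V → K} (hκ : Continuous κ)
    (hin : ∀ ω ω', ⟪κ ω, κ ω'⟫_ℂ = E.labelForm μG μH φ ω ω')
    (hκd : Dense (Submodule.span ℂ (Set.range κ) : Set K)) (σ : UnitaryRep H K)
    (hσ : ∀ (h : H) (ω : Label G V),
      σ h (κ ω) = ((√(modularRatio H h : ℝ) : ℝ) : ℂ) • κ (ω.shift h)) :
    ∃ W : V →ₗᵢ[ℂ] inducedSpace μG θ σ, IsMackeyPair μG θ E σ W := by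
  let vec : (Label G V →₀ ℂ) →ₗ[ℂ] V := Finsupp.linearCombination ℂ fun ω => ω.vec μG π φ
  have hvd : DenseRange vec := denseRange_linearCombination hd
  have hm : ∀ s, AEStronglyMeasurable (fibreFun κ s) μG := fun s =>
    (continuous_fibreFun hκ s).aestronglyMeasurable
  let J₀ : (Label G V →₀ ℂ) → inducedSpace μG θ σ := fun s =>
    inducedMk θ (fibreFun κ s) (hm s) (isCovariant_fibreFun hσ s)
      (memLp_fibreFun hφ hφc hκ hin θ s)
  have hJ₀ : ∀ s, inducedRepr (J₀ s) =ᵐ[μG] fibreFun κ s := fun s => inducedRepr_inducedMk _ _ _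
  let J : (Label G V →₀ ℂ) →ₗ[ℂ] inducedSpace μG θ σ :=
    { toFun := J₀
      map_add' := fun s t => by
        apply inducedSpace_ext
        filter_upwards [hJ₀ s, hJ₀ t, hJ₀ (s + t), inducedRepr_add (J₀ s) (J₀ t)]
          with g h1 h2 h3 h4
        rw [h4, h3, Pi.add_apply, h1, h2, fibreFun, map_add]
        rfl
      map_smul' := fun c s => by
        apply inducedSpace_ext
        filter_upwards [hJ₀ s, hJ₀ (c • s), inducedRepr_smul c (J₀ s)] with g h1 h2 h3
        rw [RingHom.id_apply, h3, h2, Pi.smul_apply, h1, fibreFun, map_smul]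
        rfl }
  have hJ : ∀ s, inducedRepr (J s) =ᵐ[μG] fibreFun κ s := hJ₀
  have hcut : ∀ s (Y : Set (G ⧸ H)) (hY : MeasurableSet Y),
      ((‖inducedPVM μG θ σ Y hY (J s)‖ ^ 2 : ℝ) : ℂ) = ⟪E Y (vec s), vec s⟫_ℂ := by
    intro s Y hY
    rw [← E.measureReal_eq _ hY, Measure.real, ← cosetMeasure_fibreFun hφ hφc hκ hin θ s]
    have e : cosetMeasure μG θ (fibreFun κ s) Y = cosetMeasure μG θ (inducedRepr (J s)) Y := by
      rw [cosetMeasure_apply _ hY, cosetMeasure_apply _ hY]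
      refine lintegral_congr_ae (ae_restrict_of_ae ?_)
      filter_upwards [hJ s] with g hg
      rw [hg]
    rw [e, ← enorm_inducedPVM_sq _ hY, ENNReal.toReal_pow, toReal_enorm]
  have hnorm : ∀ s, ‖J s‖ = ‖E.sqrtTotal (vec s)‖ := by
    intro s
    refine (sq_eq_sq₀ (norm_nonneg _) (norm_nonneg _)).1 ?_
    rw [← Complex.ofReal_inj, E.norm_sqrtTotal_sq, ← hcut s Set.univ MeasurableSet.univ,
      inducedPVM_univ]
  obtain ⟨W, hW⟩ := exists_linearIsometry_of_norm_eq ((E.sqrtTotal : V →ₗ[ℂ] V) ∘ₗ vec) J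
    (E.dense_range_sqrtTotal.comp hvd E.sqrtTotal.continuous) hnorm
  replace hW : ∀ s, W (E.sqrtTotal (vec s)) = J s := hW
  have hvec : ∀ ω, vec (Finsupp.single ω 1) = ω.vec μG π φ := fun ω => by simp [vec]
  have hfib : ∀ ω g, fibreFun κ (Finsupp.single ω 1) g = κ (ω.shift g⁻¹) := fun ω g => by
    simp [fibreFun]
  refine ⟨W, fun g => ?_, fun Y hY => ?_, ?_⟩
  · have hd' : Dense (Submodule.span ℂ (Set.range fun ω : Label G V =>
        E.sqrtTotal (ω.vec μG π φ)) : Set V) := by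
      refine dense_span_of_inner_eq_zero fun u hu => E.injective_sqrtTotal ?_
      rw [map_zero]
      exact eq_zero_of_inner_total hd fun ω => by rw [E.inner_sqrtTotal_left]; exact hu ω
    refine eq_of_eqOn_total hd'
      (S := W.toContinuousLinearMap ∘L ((π g).toContinuousLinearEquiv : V →L[ℂ] V))
      (T := ((inducedRep μG θ σ g).toContinuousLinearEquiv :
        inducedSpace μG θ σ →L[ℂ] inducedSpace μG θ σ) ∘L W.toContinuousLinearMap) fun ω => ?_
    change W (π g (E.sqrtTotal (ω.vec μG π φ))) =
      inducedRep μG θ σ g (W (E.sqrtTotal (ω.vec μG π φ)))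
    rw [← E.sqrtTotal_apply_rep, ← Label.vec_shift, ← hvec, ← hvec, hW, hW]
    apply inducedSpace_ext
    filter_upwards [hJ (Finsupp.single (ω.shift g) 1),
      inducedRepr_inducedRep g (J (Finsupp.single ω 1)),
      (measurePreserving_mul_left μG g⁻¹).quasiMeasurePreserving.ae
        (hJ (Finsupp.single ω 1))] with x h1 h2 h3
    rw [h1, h2, h3, hfib, hfib, Label.shift_shift, mul_inv_rev, inv_inv]
  · refine ContinuousLinearMap.ext fun v => ?_
    have hq : ∀ v : V, ⟪E Y v, v⟫_ℂ =
        ((‖inducedPVM μG θ σ Y hY (W (E.sqrtTotal v))‖ ^ 2 : ℝ) : ℂ) := by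
      have c1 : Continuous fun v => ⟪E Y v, v⟫_ℂ := by fun_prop
      have c2 : Continuous fun v =>
          ((‖inducedPVM μG θ σ Y hY (W (E.sqrtTotal v))‖ ^ 2 : ℝ) : ℂ) := by
        have := W.continuous
        fun_prop
      refine fun v => congrFun (hvd.equalizer c1 c2 (funext fun s => ?_)) v
      simp only [Function.comp_apply]
      rw [hW, hcut]
    refine congrArg (fun T : V →ₗ[ℂ] V => T v) ((ext_inner_map (E Y : V →ₗ[ℂ] V)
      (T := ((E.sqrtTotal ∘L ContinuousLinearMap.adjoint W.toContinuousLinearMap ∘L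
      inducedPVM μG θ σ Y hY ∘L W.toContinuousLinearMap ∘L E.sqrtTotal : V →L[ℂ] V) :
        V →ₗ[ℂ] V))).1 fun v => ?_)
    refine (hq v).trans ?_
    change _ = ⟪E.sqrtTotal (ContinuousLinearMap.adjoint W.toContinuousLinearMap
      (inducedPVM μG θ σ Y hY (W (E.sqrtTotal v)))), v⟫_ℂ
    rw [E.inner_sqrtTotal_left, ContinuousLinearMap.adjoint_inner_left]
    change _ = ⟪inducedPVM μG θ σ Y hY (W (E.sqrtTotal v)), W (E.sqrtTotal v)⟫_ℂ
    exact norm_inducedPVM_sq hY _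
  · rw [Submodule.topologicalClosure_eq_top_iff, Submodule.eq_bot_iff]
    intro F hF
    -- `F` is orthogonal pointwise to the functions that represent smoothed vectors
    have h1 : ∀ ω : Label G V, ∀ᵐ g ∂μG, ⟪κ (ω.shift g⁻¹), inducedRepr F g⟫_ℂ = 0 := by
      intro ω
      have h2 := inner_inducedRepr_ae_eq_zero (J (Finsupp.single ω 1)) F fun Y hY => by
        rw [← inner_inducedPVM_left, ← hW]
        exact (Submodule.mem_orthogonal _ F).1 hF _ (Submodule.subset_span ⟨Y, hY, _, rfl⟩)
      filter_upwards [h2, hJ (Finsupp.single ω 1)] with g h3 h4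
      rwa [h4, hfib] at h3
    apply inducedSpace_ext
    have h0 : inducedRepr (0 : inducedSpace μG θ σ) =ᵐ[μG] 0 := by
      have := inducedRepr_smul (0 : ℂ) (0 : inducedSpace μG θ σ)
      rw [zero_smul] at this
      exact this.trans (by rw [zero_smul])
    -- a countable dense set of labels suffices, by continuity
    filter_upwards [ae_all_iff.2 fun n => h1 (TopologicalSpace.denseSeq (Label G V) n), h0]
      with g hg h0
    rw [h0]
    refine eq_zero_of_inner_total hκd fun ω => ?_
    have c : Continuous fun ω : Label G V => ⟪inducedRepr F g, κ (ω.shift g⁻¹)⟫_ℂ :=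
      continuous_const.inner (hκ.comp
        (Label.continuous_shift.comp (continuous_const.prodMk continuous_id)))
    have h2 := congrFun ((TopologicalSpace.denseRange_denseSeq (Label G V)).equalizer c
      (continuous_const (y := (0 : ℂ))) (funext fun n => inner_eq_zero_symm.1 (hg n))) (ω.shift g)
    simpa [Label.shift_shift, Label.shift_one] using h2

theorem exists_isMackeyPair.{v'} {V : Type v'} [NormedAddCommGroup V] [InnerProductSpace ℂ V]
    [CompleteSpace V] [TopologicalSpace.SeparableSpace V] {π : UnitaryRep G V}
    (E : LocalisationObservable H π) (θ : BruhatFunction H μH) :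
    ∃ (K : Type v') (_ : NormedAddCommGroup K) (_ : InnerProductSpace ℂ K)
      (_ : CompleteSpace K) (_ : TopologicalSpace.SeparableSpace K)
      (σ : UnitaryRep H K) (W : V →ₗᵢ[ℂ] inducedSpace μG θ σ), IsMackeyPair μG θ E σ W := by
  obtain ⟨φ, hφ, hφc, hφ0, hφ1, hφU⟩ := exists_bump_sequence G
  obtain ⟨K, i₁, i₂, i₃, i₄, κ, σ, hκ, hin, hκd, hσ⟩ := E.exists_fibre μG μH hφ hφc
  exact ⟨K, i₁, i₂, i₃, i₄, σ, exists_isMackeyPair_of_fibre θ hφ hφc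
    (Label.dense_span_vec μG π hφ hφc hφ0 hφ1 hφU) hκ hin hκd σ hσ⟩

end Existence

/-! ### Averages of covariant functions -/

section Average
open scoped InnerProductSpace

variable {G : Type*} [Group G] [TopologicalSpace G] [IsTopologicalGroup G] [LocallyCompactSpace G]
  [T2Space G] [SecondCountableTopology G] [MeasurableSpace G] [BorelSpace G]
  {H : Subgroup G} [hH : IsClosed (H : Set G)]
  {μG : Measure G} [μG.IsHaarMeasure] {μH : Measure H} [μH.IsHaarMeasure]
  {θ : BruhatFunction H μH}
  {K : Type*} [NormedAddCommGroup K] [InnerProductSpace ℂ K] {σ : UnitaryRep H K}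
  {K' : Type*} [NormedAddCommGroup K'] [InnerProductSpace ℂ K'] {σ' : UnitaryRep H K'}

/-- The average `∫ k(g) F(g) dg` of an element of the induced space. -/
def average (k : G → ℝ) (f : inducedSpace μG θ σ) : K := ∫ g, (k g : ℂ) • inducedRepr f g ∂μG

theorem integrable_average {k : G → ℝ} (hk : Continuous k) (hkc : HasCompactSupport k)
    (f : inducedSpace μG θ σ) : Integrable (fun g => (k g : ℂ) • inducedRepr f g) μG := by
  have hF := aestronglyMeasurable_inducedRepr f
  have := (isCovariant_inducedRepr f).isFiniteMeasureOnCompacts hF θ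
  have hk' : Continuous fun g => (k g : ℂ) := by fun_prop
  refine ⟨hk'.aestronglyMeasurable.smul hF, ?_⟩
  have h1 : ∫⁻ g, ‖k g‖ₑ ∂μG < ∞ := (hk.integrable_of_hasCompactSupport hkc).2
  have h2 : ∫⁻ g, ‖inducedRepr f g‖ₑ ^ 2 * ‖k g‖ₑ ∂μG < ∞ := by
    have h3 : Integrable k (μG.withDensity fun g => ‖inducedRepr f g‖ₑ ^ 2) :=
      hk.integrable_of_hasCompactSupport hkc
    have h4 := h3.2
    rw [HasFiniteIntegral, lintegral_withDensity_eq_lintegral_mul₀ (hF.enorm.pow_const 2)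
      (by fun_prop)] at h4
    exact h4
  calc ∫⁻ g, ‖(k g : ℂ) • inducedRepr f g‖ₑ ∂μG
      ≤ ∫⁻ g, (‖k g‖ₑ + ‖inducedRepr f g‖ₑ ^ 2 * ‖k g‖ₑ) ∂μG := by
        refine lintegral_mono fun g => ?_
        have e : ‖(k g : ℂ)‖ₑ = ‖k g‖ₑ := by
          rw [← ofReal_norm, Complex.norm_real, ofReal_norm]
        have hx : ‖inducedRepr f g‖ₑ ≤ 1 + ‖inducedRepr f g‖ₑ ^ 2 := by
          rcases le_total ‖inducedRepr f g‖ₑ 1 with h | h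
          · exact h.trans le_self_add
          · calc ‖inducedRepr f g‖ₑ = 1 * ‖inducedRepr f g‖ₑ := (one_mul _).symm
              _ ≤ ‖inducedRepr f g‖ₑ * ‖inducedRepr f g‖ₑ := by gcongr
              _ ≤ _ := by rw [← sq]; exact le_add_self
        rw [enorm_smul, e]
        calc ‖k g‖ₑ * ‖inducedRepr f g‖ₑ ≤ ‖k g‖ₑ * (1 + ‖inducedRepr f g‖ₑ ^ 2) := by gcongr
          _ = _ := by ring
    _ = ∫⁻ g, ‖k g‖ₑ ∂μG + ∫⁻ g, ‖inducedRepr f g‖ₑ ^ 2 * ‖k g‖ₑ ∂μG :=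
        lintegral_add_left (by fun_prop) _
    _ < ∞ := ENNReal.add_lt_top.2 ⟨h1, h2⟩

theorem inner_average_right [CompleteSpace K] {k : G → ℝ} (hk : Continuous k)
    (hkc : HasCompactSupport k) (u : K) (f : inducedSpace μG θ σ) :
    ⟪u, average k f⟫_ℂ = ∫ g, (k g : ℂ) * ⟪u, inducedRepr f g⟫_ℂ ∂μG := by
  rw [average, ← integral_inner (integrable_average hk hkc f)]
  simp_rw [inner_smul_right]

theorem inner_average_left [CompleteSpace K] {k : G → ℝ} (hk : Continuous k)
    (hkc : HasCompactSupport k) (u : K) (f : inducedSpace μG θ σ) :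
    ⟪average k f, u⟫_ℂ = ∫ g, (k g : ℂ) * ⟪inducedRepr f g, u⟫_ℂ ∂μG := by
  rw [← inner_conj_symm, inner_average_right hk hkc, ← integral_conj]
  simp only [map_mul, Complex.conj_ofReal, inner_conj_symm]

/-- The inner products of the values of two covariant functions at *different* points are preserved
by operators between induced spaces that respect translations and projections: compare `F₁` with
the translates of `F₂` and apply Fubini's theorem. -/
theorem inner_inducedRepr_ae_ae_eq (S : inducedSpace μG θ σ ≃ₗᵢ[ℂ] inducedSpace μG θ σ')
    (hL : Intertwines (inducedRep μG θ σ) (inducedRep μG θ σ') S)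
    (hE : ∀ (Y : Set (G ⧸ H)) (hY : MeasurableSet Y) (f : inducedSpace μG θ σ),
      S (inducedPVM μG θ σ Y hY f) = inducedPVM μG θ σ' Y hY (S f))
    (f₁ f₂ : inducedSpace μG θ σ) :
    ∀ᵐ g ∂μG, ∀ᵐ g' ∂μG, ⟪inducedRepr f₁ g, inducedRepr f₂ g'⟫_ℂ =
      ⟪inducedRepr (S f₁) g, inducedRepr (S f₂) g'⟫_ℂ := by
  have h1 : ∀ (f₁ f₂ : inducedSpace μG θ σ), ∀ᵐ g ∂μG, ⟪inducedRepr f₁ g, inducedRepr f₂ g⟫_ℂ =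
      ⟪inducedRepr (S f₁) g, inducedRepr (S f₂) g⟫_ℂ := fun f₁ f₂ =>
    inner_inducedRepr_ae_eq _ _ _ _ fun c Y hY => by
      rw [← map_smul, ← map_add, ← hE, LinearIsometryEquiv.norm_map]
  have hm₁ := aestronglyMeasurable_inducedRepr f₁
  have hm₂ := aestronglyMeasurable_inducedRepr f₂
  have hm₁' := aestronglyMeasurable_inducedRepr (S f₁)
  have hm₂' := aestronglyMeasurable_inducedRepr (S f₂)
  have h2 : ∀ᵐ z ∂μG, ∀ᵐ g ∂μG, ⟪hm₁.mk _ g, hm₂.mk _ (z * g)⟫_ℂ =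
      ⟪hm₁'.mk _ g, hm₂'.mk _ (z * g)⟫_ℂ := by
    refine Filter.Eventually.of_forall fun z => ?_
    have q := (measurePreserving_mul_left μG z).quasiMeasurePreserving
    have hz : S (inducedRep μG θ σ z⁻¹ f₂) = inducedRep μG θ σ' z⁻¹ (S f₂) := hL _ _
    filter_upwards [h1 f₁ (inducedRep μG θ σ z⁻¹ f₂), inducedRepr_inducedRep z⁻¹ f₂,
      inducedRepr_inducedRep z⁻¹ (S f₂), hm₁.ae_eq_mk, hm₁'.ae_eq_mk, q.ae hm₂.ae_eq_mk,
      q.ae hm₂'.ae_eq_mk] with g e1 e2 e3 e4 e5 e6 e7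
    rw [hz, e2, e3, inv_inv] at e1
    rw [← e4, ← e5, ← e6, ← e7, e1]
  rw [Measure.ae_ae_comm] at h2
  · filter_upwards [h2, hm₁.ae_eq_mk, hm₁'.ae_eq_mk] with g e1 e2 e3
    have e4 := (quasiMeasurePreserving_mul_right μG g⁻¹).ae e1
    filter_upwards [e4, hm₂.ae_eq_mk, hm₂'.ae_eq_mk] with x e5 e6 e7
    rw [inv_mul_cancel_right] at e5
    rw [e2, e3, e6, e7, e5]
  · refine measurableSet_eq_fun ?_ ?_
    · exact ((hm₁.stronglyMeasurable_mk.comp_measurable measurable_snd).inner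
        (hm₂.stronglyMeasurable_mk.comp_measurable
          (measurable_fst.mul measurable_snd))).measurable
    · exact ((hm₁'.stronglyMeasurable_mk.comp_measurable measurable_snd).inner
        (hm₂'.stronglyMeasurable_mk.comp_measurable
          (measurable_fst.mul measurable_snd))).measurable

theorem inner_average_eq [CompleteSpace K] [CompleteSpace K']
    (S : inducedSpace μG θ σ ≃ₗᵢ[ℂ] inducedSpace μG θ σ')
    (hL : Intertwines (inducedRep μG θ σ) (inducedRep μG θ σ') S)
    (hE : ∀ (Y : Set (G ⧸ H)) (hY : MeasurableSet Y) (f : inducedSpace μG θ σ),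
      S (inducedPVM μG θ σ Y hY f) = inducedPVM μG θ σ' Y hY (S f))
    {k k' : G → ℝ} (hk : Continuous k) (hkc : HasCompactSupport k) (hk' : Continuous k')
    (hkc' : HasCompactSupport k') (f₁ f₂ : inducedSpace μG θ σ) :
    ⟪average k f₁, average k' f₂⟫_ℂ = ⟪average k (S f₁), average k' (S f₂)⟫_ℂ := by
  rw [inner_average_left hk hkc, inner_average_left hk hkc]
  refine integral_congr_ae ?_
  filter_upwards [inner_inducedRepr_ae_ae_eq S hL hE f₁ f₂] with g hg
  rw [inner_average_right hk' hkc', inner_average_right hk' hkc']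
  congr 1
  refine integral_congr_ae ?_
  filter_upwards [hg] with g' hg'
  rw [hg']

/-- The action of `H` on averages: it translates and rescales the weight, in a way that does not
depend on the representation. -/
theorem apply_average [CompleteSpace K] (h : H) (k : G → ℝ) (f : inducedSpace μG θ σ) :
    σ h (average k f) = average (fun g => √(modularRatio H h : ℝ) *
      (modularFunction (h : G) : ℝ) * k (g * h)) f := by
  have e1 : σ h (average k f) = ∫ g, (k g : ℂ) • σ h (inducedRepr f g) ∂μG := by
    have := (σ h).toContinuousLinearEquiv.integral_comp_comm (μ := μG)
      fun g => (k g : ℂ) • inducedRepr f g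
    rw [average]
    refine this.symm.trans (integral_congr_ae (Filter.Eventually.of_forall fun g => ?_))
    exact map_smul (σ h) _ _
  have e2 : ∫ g, (k g : ℂ) • σ h (inducedRepr f g) ∂μG =
      ∫ g, (k g : ℂ) • ((√(modularRatio H h : ℝ) : ℝ) : ℂ) • inducedRepr f (g * (h : G)⁻¹) ∂μG := by
    refine integral_congr_ae ?_
    filter_upwards [isCovariant_inducedRepr f h⁻¹] with g hg
    rw [Subgroup.coe_inv] at hg
    rw [hg, inv_inv, smul_smul ((√(modularRatio H h : ℝ) : ℝ) : ℂ), ← Complex.ofReal_mul,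
      ← Real.sqrt_mul (NNReal.coe_nonneg _), ← NNReal.coe_mul, modularRatio_mul_inv]
    simp
  rw [e1, e2]
  have e3 := integral_mul_right_haar μG (fun g => (k (g * h) : ℂ) •
    ((√(modularRatio H h : ℝ) : ℝ) : ℂ) • inducedRepr f g) (h : G)⁻¹
  simp only [inv_mul_cancel_right, inv_inv] at e3
  rw [e3, average, ← integral_smul]
  refine integral_congr_ae (Filter.Eventually.of_forall fun g => ?_)
  simp only [Complex.ofReal_mul]
  rw [← Complex.coe_smul, smul_smul, smul_smul]
  congr 1
  ring

/-- The covariant function `g ↦ ∫ f(g h) √(Δ_G h / Δ_H h) σ(h) u dh`. -/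
def cosetAverage (μH : Measure H) (σ : UnitaryRep H K) (f : G → ℝ) (u : K) (g : G) : K :=
  ∫ h : H, ((f (g * h) * √(modularRatio H h⁻¹ : ℝ) : ℝ) : ℂ) • σ h u ∂μH

theorem continuous_cosetAverage {f : G → ℝ} (hf : Continuous f) (hfc : HasCompactSupport f)
    (u : K) : Continuous (cosetAverage μH σ f u) := by
  have hδ : Continuous fun h : H => √(modularRatio H h⁻¹ : ℝ) :=
    Real.continuous_sqrt.comp (NNReal.continuous_coe.comp
      (continuous_modularRatio.comp continuous_inv))
  refine continuous_integral_of_locally_compact_support ?_ fun g₀ => ?_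
  · have h1 : Continuous fun p : G × H => f (p.1 * p.2) * √(modularRatio H p.2⁻¹ : ℝ) :=
      (hf.comp (by fun_prop)).mul (hδ.comp continuous_snd)
    exact (Complex.continuous_ofReal.comp h1).smul ((σ.continuous_apply u).comp continuous_snd)
  · obtain ⟨C, hC, hg⟩ := exists_compact_mem_nhds g₀
    refine ⟨(↑) ⁻¹' (C⁻¹ * tsupport f),
      hH.isClosedEmbedding_subtypeVal.isCompact_preimage (hC.inv.mul hfc),
      Filter.mem_of_superset hg fun g hgC h hh => ?_⟩
    have : f (g * h) = 0 := image_eq_zero_of_notMem_tsupport fun hm => hh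
      ⟨g⁻¹, by simpa using hgC, g * h, hm, by simp⟩
    simp [this]

theorem isCovariant_cosetAverage [CompleteSpace K] (f : G → ℝ) (u : K) :
    IsCovariant μG σ (cosetAverage μH σ f u) := by
  intro k
  refine Filter.Eventually.of_forall fun g => ?_
  have e1 := integral_mul_left_eq_self (μ := μH) (fun h : H =>
    ((f (g * h) * √(modularRatio H (k⁻¹ * h)⁻¹ : ℝ) : ℝ) : ℂ) • σ (k⁻¹ * h) u) k
  simp only [inv_mul_cancel_left, Subgroup.coe_mul] at e1
  simp only [← mul_assoc g] at e1
  rw [cosetAverage, e1, cosetAverage]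
  have e2 := (σ k⁻¹).toContinuousLinearEquiv.integral_comp_comm (μ := μH)
      fun h : H => ((f (g * h) * √(modularRatio H h⁻¹ : ℝ) : ℝ) : ℂ) • σ h u
  refine Eq.trans ?_ (congrArg (fun x => ((√(modularRatio H k : ℝ) : ℝ) : ℂ) • x) e2)
  rw [← integral_smul]
  refine integral_congr_ae (Filter.Eventually.of_forall fun h => ?_)
  change _ = ((√(modularRatio H k : ℝ) : ℝ) : ℂ) • σ k⁻¹ (_ • σ h u)
  simp only
  rw [map_smul, ← UnitaryRep.map_mul_apply, smul_smul, ← Complex.ofReal_mul, mul_inv_rev, inv_inv,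
    modularRatio_mul, NNReal.coe_mul, Real.sqrt_mul (NNReal.coe_nonneg _)]
  congr 2
  ring

theorem memLp_cosetAverage (θ : BruhatFunction H μH) {f : G → ℝ} (hf : Continuous f)
    (hfc : HasCompactSupport f) (u : K) :
    MemLp (cosetAverage μH σ f u) 2 (weightedMeasure μG θ) := by
  have hF : Continuous (cosetAverage μH σ f u) := continuous_cosetAverage hf hfc u
  have hc := θ.continuous_toFun
  refine ⟨hF.aestronglyMeasurable, ?_⟩
  have h : eLpNorm (cosetAverage μH σ f u) 2 (weightedMeasure μG θ) ^ 2 < ∞ := by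
    have hi : Integrable (fun g => ‖cosetAverage μH σ f u g‖ ^ 2 * (θ.toFun g : ℝ)) μG := by
      refine Continuous.integrable_of_hasCompactSupport (by fun_prop) (HasCompactSupport.intro
        (θ.isCompact_inter_tsupport _ hfc.isCompact) fun g hg => ?_)
      by_contra hne
      have h1 : θ.toFun g ≠ 0 := fun h => hne (by simp [h])
      have h2 : ∃ h : H, f (g * h) ≠ 0 := by
        by_contra! h0
        exact hne (by simp [cosetAverage, h0])
      obtain ⟨h, hh⟩ := h2
      exact hg ⟨⟨g * h, subset_tsupport _ hh, (h : G)⁻¹, H.inv_mem h.2, by simp⟩,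
        subset_tsupport _ h1⟩
    rw [eLpNorm_weighted_sq]
    refine lt_of_eq_of_lt (lintegral_congr fun g => ?_) hi.2
    rw [enorm_mul, enorm_pow, enorm_norm]
    congr 1
    rw [← ofReal_norm, Real.norm_of_nonneg (NNReal.coe_nonneg _), ENNReal.ofReal_coe_nnreal]
  exact (ENNReal.pow_lt_top_iff.1 h).resolve_right two_ne_zero

/-- The averages of the elements of the induced space are total in the fibre: there are enough
continuous covariant functions. -/
theorem dense_span_average [CompleteSpace K] :
    Dense (Submodule.span ℂ (Set.range
      fun p : CompactlySupportedContinuousMap G ℝ × inducedSpace μG θ σ => average p.1 p.2) :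
        Set K) := by
  refine dense_span_of_inner_eq_zero fun u hu => ?_
  by_contra hne
  have hD : Continuous fun h : H => ⟪u, σ h u⟫_ℂ := continuous_const.inner (σ.continuous_apply u)
  have h1 : 0 < (⟪u, σ 1 u⟫_ℂ).re := by
    rw [UnitaryRep.map_one_apply]
    exact (pow_pos (norm_pos_iff.2 hne) 2).trans_eq (inner_self_eq_norm_sq (𝕜 := ℂ) u).symm
  have hU : {h : H | 0 < (⟪u, σ h u⟫_ℂ).re} ∈ 𝓝 (1 : H) :=
    ((Complex.continuous_re.comp hD).tendsto 1).eventually (lt_mem_nhds h1)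
  rw [nhds_subtype_eq_comap, Filter.mem_comap] at hU
  obtain ⟨U, hU1, hU2⟩ := hU
  obtain ⟨f, hf, hfc, hf0, hf1, hfU⟩ := exists_bump (G := G) hU1
  have hF : Continuous (cosetAverage μH σ f u) := continuous_cosetAverage hf hfc u
  have hδ : Continuous fun h : H => √(modularRatio H h⁻¹ : ℝ) :=
    Real.continuous_sqrt.comp (NNReal.continuous_coe.comp
      (continuous_modularRatio.comp continuous_inv))
  have hfH : Continuous fun h : H => f (1 * h) := by fun_prop
  -- the averages of the covariant function of the bump `f` detect its value at `1`
  have h2 : ⟪u, cosetAverage μH σ f u 1⟫_ℂ = 0 := by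
    refine eq_of_forall_integral μG (D₁ := fun g => ⟪u, cosetAverage μH σ f u g⟫_ℂ)
      (D₂ := fun _ => 0) (continuous_const.inner hF) continuous_const (fun a ha hac => ?_) 1
    have h3 := hu (⟨⟨a, ha⟩, hac⟩, inducedMk θ _ hF.aestronglyMeasurable
      (isCovariant_cosetAverage f u) (memLp_cosetAverage θ hf hfc u))
    rw [show ⇑(⟨⟨a, ha⟩, hac⟩ : CompactlySupportedContinuousMap G ℝ) = a from rfl,
      inner_average_right ha hac] at h3
    simp only [mul_zero, integral_zero]
    rw [← h3]
    refine integral_congr_ae ?_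
    filter_upwards [inducedRepr_inducedMk hF.aestronglyMeasurable
      (isCovariant_cosetAverage (μG := μG) f u) (memLp_cosetAverage θ hf hfc u)] with g hg
    rw [hg]
  have h4 := re_integral_mul_pos μH (hfH.mul hδ) (hasCompactSupport_coset hfc 1).mul_right
    (fun h => mul_nonneg (hf0 _) (Real.sqrt_nonneg _)) hD (fun h hh => ?_) (x₀ := 1) ?_
  · have hi : Integrable (fun h : H =>
        ((f (1 * h) * √(modularRatio H h⁻¹ : ℝ) : ℝ) : ℂ) • σ h u) μH := by
      refine Continuous.integrable_of_hasCompactSupport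
        ((Complex.continuous_ofReal.comp (hfH.mul hδ)).smul (σ.continuous_apply u)) ?_
      exact HasCompactSupport.smul_right (HasCompactSupport.comp_left
        (g := fun r : ℝ => (r : ℂ)) (hasCompactSupport_coset hfc 1).mul_right Complex.ofReal_zero)
    rw [cosetAverage, ← integral_inner hi] at h2
    simp only [inner_smul_right] at h2
    have h5 := h4.trans_eq (congrArg Complex.re h2)
    rw [Complex.zero_re] at h5
    exact lt_irrefl _ h5
  · refine hU2 (hfU ?_)
    have h5 := tsupport_mul_subset_left hh
    have h6 := tsupport_comp_subset_preimage f (f := fun h : H => (1 * h : G)) (by fun_prop) h5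
    simpa using h6
  · simpa [hf1] using (Real.sqrt_pos.2 (NNReal.coe_pos.2 (modularRatio_pos (1 : H)⁻¹))).ne'

/-- A representation of `H` is determined, up to equivalence, by the induced system of
imprimitivity. -/
theorem equivalent_of_inducedSpace_equiv [CompleteSpace K] [CompleteSpace K']
    (S : inducedSpace μG θ σ ≃ₗᵢ[ℂ] inducedSpace μG θ σ')
    (hL : Intertwines (inducedRep μG θ σ) (inducedRep μG θ σ') S)
    (hE : ∀ (Y : Set (G ⧸ H)) (hY : MeasurableSet Y) (f : inducedSpace μG θ σ),
      S (inducedPVM μG θ σ Y hY f) = inducedPVM μG θ σ' Y hY (S f)) : σ.Equivalent σ' := by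
  let κ : CompactlySupportedContinuousMap G ℝ × inducedSpace μG θ σ → K := fun p => average p.1 p.2
  let κ' : CompactlySupportedContinuousMap G ℝ × inducedSpace μG θ σ → K' :=
    fun p => average p.1 (S p.2)
  have hκ : Dense (Submodule.span ℂ (Set.range κ) : Set K) := dense_span_average
  have hκ' : Dense (Submodule.span ℂ (Set.range κ') : Set K') := by
    have h := dense_span_average (μG := μG) (θ := θ) (σ := σ')
    have e : Set.range κ' = Set.range
        fun p : CompactlySupportedContinuousMap G ℝ × inducedSpace μG θ σ' => average p.1 p.2 := by
      ext x
      constructor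
      · rintro ⟨p, rfl⟩
        exact ⟨(p.1, S p.2), rfl⟩
      · rintro ⟨p, rfl⟩
        exact ⟨(p.1, S.symm p.2), by simp [κ']⟩
    rwa [e]
  obtain ⟨B, hB⟩ := exists_linearIsometryEquiv_of_inner_eq hκ hκ' fun p q =>
    (inner_average_eq S hL hE p.1.continuous p.1.hasCompactSupport q.1.continuous
      q.1.hasCompactSupport p.2 q.2)
  refine ⟨B, fun h => ?_⟩
  refine eq_of_eqOn_total hκ
      (S := (B.toContinuousLinearEquiv : K →L[ℂ] K') ∘L
        ((σ h).toContinuousLinearEquiv : K →L[ℂ] K))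
      (T := ((σ' h).toContinuousLinearEquiv : K' →L[ℂ] K') ∘L
        (B.toContinuousLinearEquiv : K →L[ℂ] K')) fun p => ?_
  change B (σ h (κ p)) = σ' h (B (κ p))
  have hk := p.1.continuous
  let k : CompactlySupportedContinuousMap G ℝ := ⟨⟨fun g => √(modularRatio H h : ℝ) *
      (modularFunction (h : G) : ℝ) * p.1 (g * h), by fun_prop⟩,
    (p.1.hasCompactSupport.comp_homeomorph (Homeomorph.mulRight (h : G))).mul_left⟩
  have e1 : σ h (κ p) = κ (k, p.2) := apply_average h _ _
  have e2 : σ' h (κ' p) = κ' (k, p.2) := apply_average h _ _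
  rw [e1, hB, hB, e2]

end Average

/-! ### Uniqueness, projective observables and equivalent observables -/

section Pairs
open scoped InnerProductSpace

variable {G : Type*} [Group G] [TopologicalSpace G] [IsTopologicalGroup G] [LocallyCompactSpace G]
  [T2Space G] [SecondCountableTopology G] [MeasurableSpace G] [BorelSpace G]
  {H : Subgroup G} [hH : IsClosed (H : Set G)]
  {μG : Measure G} [μG.IsHaarMeasure] {μH : Measure H} [μH.IsHaarMeasure]
  {θ : BruhatFunction H μH}
  {V : Type*} [NormedAddCommGroup V] [InnerProductSpace ℂ V] [CompleteSpace V]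
  {π : UnitaryRep G V} {E : LocalisationObservable H π}
  {V' : Type*} [NormedAddCommGroup V'] [InnerProductSpace ℂ V'] [CompleteSpace V']
  {π' : UnitaryRep G V'} {E' : LocalisationObservable H π'}
  {K : Type*} [NormedAddCommGroup K] [InnerProductSpace ℂ K] [CompleteSpace K]
  {σ : UnitaryRep H K} {W : V →ₗᵢ[ℂ] inducedSpace μG θ σ}
  {K' : Type*} [NormedAddCommGroup K'] [InnerProductSpace ℂ K'] [CompleteSpace K']
  {σ' : UnitaryRep H K'} {W' : V →ₗᵢ[ℂ] inducedSpace μG θ σ'}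

theorem eq_compression_iff {Y : Set (G ⧸ H)} (hY : MeasurableSet Y) :
    E Y = E.sqrtTotal ∘L ContinuousLinearMap.adjoint W.toContinuousLinearMap ∘L
      inducedPVM μG θ σ Y hY ∘L W.toContinuousLinearMap ∘L E.sqrtTotal ↔
    ∀ v w, ⟪E Y v, w⟫_ℂ = ⟪inducedPVM μG θ σ Y hY (W (E.sqrtTotal v)), W (E.sqrtTotal w)⟫_ℂ := by
  have h : ∀ v w, ⟪(E.sqrtTotal ∘L ContinuousLinearMap.adjoint W.toContinuousLinearMap ∘L
      inducedPVM μG θ σ Y hY ∘L W.toContinuousLinearMap ∘L E.sqrtTotal) v, w⟫_ℂ =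
      ⟪inducedPVM μG θ σ Y hY (W (E.sqrtTotal v)), W (E.sqrtTotal w)⟫_ℂ := by
    intro v w
    change ⟪E.sqrtTotal (ContinuousLinearMap.adjoint W.toContinuousLinearMap
      (inducedPVM μG θ σ Y hY (W (E.sqrtTotal v)))), w⟫_ℂ = _
    rw [E.inner_sqrtTotal_left, ContinuousLinearMap.adjoint_inner_left]
    rfl
  constructor
  · intro e v w
    rw [← h, ← e]
  · intro e
    refine ContinuousLinearMap.ext fun v => ext_inner_right ℂ fun w => ?_
    rw [h, e]

theorem IsMackeyPair.inner_apply (hW : IsMackeyPair μG θ E σ W) {Y : Set (G ⧸ H)}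
    (hY : MeasurableSet Y) (v w : V) :
    ⟪E Y v, w⟫_ℂ = ⟪inducedPVM μG θ σ Y hY (W (E.sqrtTotal v)), W (E.sqrtTotal w)⟫_ℂ :=
  (eq_compression_iff hY).1 (hW.eq_compression Y hY) v w

theorem IsMackeyPair.dense_span (hW : IsMackeyPair μG θ E σ W) :
    Dense (Submodule.span ℂ (Set.range fun p : {Y : Set (G ⧸ H) // MeasurableSet Y} × V =>
      inducedPVM μG θ σ p.1 p.1.2 (W p.2)) : Set (inducedSpace μG θ σ)) := by
  have h := Submodule.dense_iff_topologicalClosure_eq_top.2 hW.closure_span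
  refine h.mono (Submodule.span_mono ?_)
  rintro _ ⟨Y, hY, v, rfl⟩
  exact ⟨(⟨Y, hY⟩, v), rfl⟩

/-- The compressions `W* E^σ(Y) W` are determined by the observable, because `E(X)^{1/2}` is
injective with dense range. -/
theorem IsMackeyPair.inner_eq (hW : IsMackeyPair μG θ E σ W) (hW' : IsMackeyPair μG θ E σ' W')
    {Y : Set (G ⧸ H)} (hY : MeasurableSet Y) (v w : V) :
    ⟪inducedPVM μG θ σ Y hY (W v), W w⟫_ℂ = ⟪inducedPVM μG θ σ' Y hY (W' v), W' w⟫_ℂ := by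
  have c := W.continuous
  have c' := W'.continuous
  have hv : ∀ v w, ⟪inducedPVM μG θ σ Y hY (W (E.sqrtTotal v)), W w⟫_ℂ =
      ⟪inducedPVM μG θ σ' Y hY (W' (E.sqrtTotal v)), W' w⟫_ℂ := by
    intro v w
    refine congrFun (E.dense_range_sqrtTotal.equalizer
      (g := fun w => ⟪inducedPVM μG θ σ Y hY (W (E.sqrtTotal v)), W w⟫_ℂ)
      (h := fun w => ⟪inducedPVM μG θ σ' Y hY (W' (E.sqrtTotal v)), W' w⟫_ℂ)
      (continuous_const.inner c) (continuous_const.inner c') (funext fun w => ?_)) w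
    exact (hW.inner_apply hY v w).symm.trans (hW'.inner_apply hY v w)
  exact congrFun (E.dense_range_sqrtTotal.equalizer
    (g := fun v => ⟪inducedPVM μG θ σ Y hY (W v), W w⟫_ℂ)
    (h := fun v => ⟪inducedPVM μG θ σ' Y hY (W' v), W' w⟫_ℂ)
    (((inducedPVM μG θ σ Y hY).continuous.comp c).inner continuous_const)
    (((inducedPVM μG θ σ' Y hY).continuous.comp c').inner continuous_const)
    (funext fun v => hv v w)) v

theorem IsMackeyPair.equivalent (hW : IsMackeyPair μG θ E σ W)
    (hW' : IsMackeyPair μG θ E σ' W') : σ.Equivalent σ' := by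
  obtain ⟨S, hS⟩ := exists_linearIsometryEquiv_of_inner_eq hW.dense_span hW'.dense_span
    fun p q => by
      rw [← inner_inducedPVM_left, inducedPVM_inducedPVM, ← inner_inducedPVM_left,
        inducedPVM_inducedPVM]
      exact hW.inner_eq hW' _ _ _
  replace hS : ∀ (Y : Set (G ⧸ H)) (hY : MeasurableSet Y) (v : V),
      S (inducedPVM μG θ σ Y hY (W v)) = inducedPVM μG θ σ' Y hY (W' v) :=
    fun Y hY v => hS (⟨Y, hY⟩, v)
  refine equivalent_of_inducedSpace_equiv S (fun g => ?_) (fun Y hY => ?_)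
  · refine eq_of_eqOn_total hW.dense_span
      (S := (S.toContinuousLinearEquiv : inducedSpace μG θ σ →L[ℂ] inducedSpace μG θ σ') ∘L
        ((inducedRep μG θ σ g).toContinuousLinearEquiv :
          inducedSpace μG θ σ →L[ℂ] inducedSpace μG θ σ))
      (T := ((inducedRep μG θ σ' g).toContinuousLinearEquiv :
          inducedSpace μG θ σ' →L[ℂ] inducedSpace μG θ σ') ∘L
        (S.toContinuousLinearEquiv : inducedSpace μG θ σ →L[ℂ] inducedSpace μG θ σ')) fun p => ?_
    change S (inducedRep μG θ σ g (inducedPVM μG θ σ p.1 p.1.2 (W p.2))) =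
      inducedRep μG θ σ' g (S (inducedPVM μG θ σ p.1 p.1.2 (W p.2)))
    rw [hS, inducedRep_inducedPVM, inducedRep_inducedPVM, ← hW.intertwines, ← hW'.intertwines, hS]
  · refine eq_of_eqOn_total hW.dense_span
      (S := (S.toContinuousLinearEquiv : inducedSpace μG θ σ →L[ℂ] inducedSpace μG θ σ') ∘L
        inducedPVM μG θ σ Y hY)
      (T := inducedPVM μG θ σ' Y hY ∘L
        (S.toContinuousLinearEquiv : inducedSpace μG θ σ →L[ℂ] inducedSpace μG θ σ')) fun p => ?_
    change S (inducedPVM μG θ σ Y hY (inducedPVM μG θ σ p.1 p.1.2 (W p.2))) =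
      inducedPVM μG θ σ' Y hY (S (inducedPVM μG θ σ p.1 p.1.2 (W p.2)))
    rw [hS, inducedPVM_inducedPVM, inducedPVM_inducedPVM, hS]

/-- An injective projection is the identity, so the total operator of a projective observable is
the identity. -/
theorem LocalisationObservable.IsProjective.sqrtTotal_eq (hE : E.IsProjective) (v : V) :
    E.sqrtTotal v = v := by
  have h1 : E Set.univ = 1 := by
    ext v
    refine E.injective_univ ?_
    exact congrArg (fun T : V →L[ℂ] V => T v) (hE Set.univ MeasurableSet.univ).isIdempotentElem
  rw [LocalisationObservable.sqrtTotal, h1, CFC.sqrt_one]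
  rfl

theorem IsMackeyPair.isProjective_iff (hW : IsMackeyPair μG θ E σ W) :
    E.IsProjective ↔ ∃ U : V ≃ₗᵢ[ℂ] inducedSpace μG θ σ, ∀ v : V, U v = W (E.sqrtTotal v) := by
  constructor
  · intro hE
    -- `W` intertwines the two projection valued measures, so its range contains all `E^σ(Y) W v`
    have h1 : ∀ (Y : Set (G ⧸ H)) (hY : MeasurableSet Y) (v : V),
        inducedPVM μG θ σ Y hY (W v) = W (E Y v) := by
      intro Y hY v
      have hid : E Y (E Y v) = E Y v :=
        congrArg (fun T : V →L[ℂ] V => T v) (hE Y hY).isIdempotentElem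
      have hin : ∀ v w, ⟪inducedPVM μG θ σ Y hY (W v), W w⟫_ℂ = ⟪E Y v, w⟫_ℂ := fun v w => by
        rw [hW.inner_apply hY, hE.sqrtTotal_eq, hE.sqrtTotal_eq]
      have hsa : ⟪E Y v, E Y v⟫_ℂ = ⟪E Y v, v⟫_ℂ := by
        have := (E.isPositive Y hY).isSymmetric (E Y v) v
        exact this.symm.trans (by rw [ContinuousLinearMap.coe_coe, hid])
      have hP : ⟪inducedPVM μG θ σ Y hY (W v), inducedPVM μG θ σ Y hY (W v)⟫_ℂ = ⟪E Y v, v⟫_ℂ := by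
        rw [← inner_inducedPVM_left, inducedPVM_inducedPVM]
        simp only [Set.inter_self, hin]
      have hin' : ∀ v w, ⟪W w, inducedPVM μG θ σ Y hY (W v)⟫_ℂ = ⟪w, E Y v⟫_ℂ := fun v w => by
        rw [← inner_conj_symm (W w), hin, inner_conj_symm]
      rw [← sub_eq_zero, ← inner_self_eq_zero (𝕜 := ℂ), inner_sub_left, inner_sub_right,
        inner_sub_right, hP, hin, hin', W.inner_map_map, hsa]
      ring
    have hr : IsClosed (LinearMap.range W.toLinearMap : Set (inducedSpace μG θ σ)) := by
      have := W.isometry.isClosedEmbedding.isClosed_range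
      exact this
    have hs : Function.Surjective W := by
      intro F
      have h2 : (Submodule.span ℂ (Set.range fun p : {Y : Set (G ⧸ H) // MeasurableSet Y} × V =>
          inducedPVM μG θ σ p.1 p.1.2 (W p.2))) ≤ LinearMap.range W.toLinearMap := by
        refine Submodule.span_le.2 ?_
        rintro _ ⟨p, rfl⟩
        exact ⟨E p.1 p.2, (h1 _ _ _).symm⟩
      exact hr.closure_subset_iff.2 h2 (hW.dense_span F)
    refine ⟨LinearIsometryEquiv.ofSurjective W hs, fun v => ?_⟩
    rw [hE.sqrtTotal_eq]
    rfl
  · rintro ⟨U, hU⟩ Y hY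
    have h1 : ∀ v, E Y v = U.symm (inducedPVM μG θ σ Y hY (U v)) := by
      intro v
      refine ext_inner_right ℂ fun w => ?_
      rw [hW.inner_apply hY, ← hU, ← hU, ← U.inner_map_map (U.symm _), U.apply_symm_apply]
    refine ⟨?_, (E.isPositive Y hY).isSelfAdjoint⟩
    refine ContinuousLinearMap.ext fun v => ?_
    change E Y (E Y v) = E Y v
    rw [h1 (E Y v), h1 v, U.apply_symm_apply, inducedPVM_inducedPVM]
    simp only [Set.inter_self]

/-- A pair for an equivalent observable gives a pair for the observable itself, with the same
representation of `H`: compose the isometry with the equivalence. -/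
theorem IsMackeyPair.comp_equiv {W₁ : V' →ₗᵢ[ℂ] inducedSpace μG θ σ}
    (hW : IsMackeyPair μG θ E' σ W₁) (T : V ≃ₗᵢ[ℂ] V') (hT : Intertwines π π' T)
    (hTE : ∀ Y, MeasurableSet Y → ∀ v : V, E' Y (T v) = T (E Y v)) :
    IsMackeyPair μG θ E σ (W₁.comp T.toLinearIsometry) := by
  have hs : ∀ v, E'.sqrtTotal (T v) = T (E.sqrtTotal v) :=
    LocalisationObservable.sqrtTotal_apply_equiv T (hTE _ MeasurableSet.univ)
  refine ⟨fun g v => ?_, fun Y hY => (eq_compression_iff hY).2 fun v w => ?_, ?_⟩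
  · change W₁ (T (π g v)) = inducedRep μG θ σ g (W₁ (T v))
    rw [hT, hW.intertwines]
  · change _ = ⟪inducedPVM μG θ σ Y hY (W₁ (T (E.sqrtTotal v))), W₁ (T (E.sqrtTotal w))⟫_ℂ
    rw [← hs, ← hs, ← hW.inner_apply hY, hTE Y hY, T.inner_map_map]
  · rw [← hW.closure_span]
    congr 2
    ext F
    constructor
    · rintro ⟨Y, hY, v, rfl⟩
      exact ⟨Y, hY, T v, rfl⟩
    · rintro ⟨Y, hY, v, rfl⟩
      refine ⟨Y, hY, T.symm v, ?_⟩
      change _ = inducedPVM μG θ σ Y hY (W₁ (T (T.symm v)))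
      rw [T.apply_symm_apply]

end Pairs

/-! ### Existence of Bruhat functions -/

section Bruhat

variable {G : Type*} [Group G] [TopologicalSpace G] [IsTopologicalGroup G] [LocallyCompactSpace G]
  [T2Space G] [SecondCountableTopology G] [MeasurableSpace G] [BorelSpace G]
  (H : Subgroup G) [hH : IsClosed (H : Set G)] (μH : Measure H) [μH.IsHaarMeasure]

variable {H} in
/-- Dividing a function that is positive somewhere on each coset by its integrals over the cosets
gives a Bruhat function. -/
theorem nonempty_bruhatFunction_of_pos {φ : G → ℝ} (hφ : Continuous φ) (hφ0 : ∀ x, 0 ≤ φ x)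
    (hpos : ∀ x : G, ∃ h : H, φ (x * h) ≠ 0)
    (hsupp : ∀ K : Set G, IsCompact K → IsCompact (K * (H : Set G) ∩ tsupport φ)) :
    Nonempty (BruhatFunction H μH) := by
  have hcs : ∀ x : G, HasCompactSupport fun h : H => φ (x * h) := by
    intro x
    refine HasCompactSupport.intro (K := (↑) ⁻¹' ({x⁻¹} *
      (({x} : Set G) * (H : Set G) ∩ tsupport φ)))
      (hH.isClosedEmbedding_subtypeVal.isCompact_preimage
        (isCompact_singleton.mul (hsupp _ isCompact_singleton))) fun h hh => ?_
    by_contra hne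
    exact hh ⟨x⁻¹, rfl, x * h, ⟨⟨x, rfl, h, h.2, rfl⟩, subset_tsupport _ hne⟩, by simp⟩
  let Φ : G → ℝ := fun x => ∫ h : H, φ (x * h) ∂μH
  have hΦ : Continuous Φ := by
    refine continuous_integral_of_locally_compact_support (by
      change Continuous fun p : G × H => φ (p.1 * p.2)
      fun_prop) fun x₀ => ?_
    obtain ⟨C, hC, hx⟩ := exists_compact_mem_nhds x₀
    refine ⟨(↑) ⁻¹' (C⁻¹ * (C * (H : Set G) ∩ tsupport φ)),
      hH.isClosedEmbedding_subtypeVal.isCompact_preimage (hC.inv.mul (hsupp C hC)),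
      Filter.mem_of_superset hx fun x hxC h hh => ?_⟩
    by_contra hne
    exact hh ⟨x⁻¹, by simpa using hxC, x * h, ⟨⟨x, hxC, h, h.2, rfl⟩, subset_tsupport _ hne⟩,
      by simp⟩
  have hΦ0 : ∀ x, 0 < Φ x := by
    intro x
    obtain ⟨h, hh⟩ := hpos x
    exact Continuous.integral_pos_of_hasCompactSupport_nonneg_nonzero (by fun_prop) (hcs x)
      (fun h => hφ0 _) hh
  have hΦi : ∀ (x : G) (h : H), Φ (x * h) = Φ x := by
    intro x h
    have := integral_mul_left_eq_self (μ := μH) (fun k : H => φ (x * k)) h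
    simpa only [Subgroup.coe_mul, ← mul_assoc] using this
  refine ⟨⟨fun x => (φ x / Φ x).toNNReal,
    continuous_real_toNNReal.comp (hφ.div hΦ fun x => (hΦ0 x).ne'), fun g => ?_, fun K hK => ?_⟩⟩
  · change ∫⁻ h : H, ENNReal.ofReal (φ (g * h) / Φ (g * h)) ∂μH = 1
    simp_rw [hΦi]
    have hi : Integrable (fun h : H => φ (g * h)) μH :=
      Continuous.integrable_of_hasCompactSupport (by fun_prop) (hcs g)
    rw [← ofReal_integral_eq_lintegral_ofReal (hi.div_const _)
      (Filter.Eventually.of_forall fun h => div_nonneg (hφ0 _) (hΦ0 _).le), integral_div]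
    change ENNReal.ofReal (Φ g / Φ g) = 1
    rw [div_self (hΦ0 g).ne', ENNReal.ofReal_one]
  · have hsub : tsupport (fun x => (φ x / Φ x).toNNReal) ⊆ tsupport φ := by
      refine closure_mono fun x hx h0 => hx ?_
      simp [h0]
    refine (hsupp K hK).of_isClosed_subset ?_ (Set.inter_subset_inter_right _ hsub)
    exact (hH.mul_left_of_isCompact hK).inter (isClosed_tsupport _)

/-- A function as in the preceding lemma is glued from translates of a bump function by means of a
partition of unity on `G ⧸ H`. -/
theorem nonempty_bruhatFunction : Nonempty (BruhatFunction H μH) := by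
  obtain ⟨b, hb, hbc, hb0, hb1, -⟩ := exists_bump (G := G) Filter.univ_mem
  let U : G → Set (G ⧸ H) := fun g => (QuotientGroup.mk : G → G ⧸ H) '' {x | b (g⁻¹ * x) ≠ 0}
  have hUo : ∀ g, IsOpen (U g) := fun g => QuotientGroup.isOpenMap_coe _
    (isOpen_ne_fun (by fun_prop) continuous_const)
  obtain ⟨ρ, hρ⟩ := PartitionOfUnity.exists_isSubordinate (isClosed_univ (X := G ⧸ H)) U hUo
    fun x _ => by
      obtain ⟨g, rfl⟩ := QuotientGroup.mk_surjective x
      exact Set.mem_iUnion.2 ⟨g, g, by simp [hb1], rfl⟩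
  let f : G → G → ℝ := fun g x => ρ g (x : G ⧸ H) * b (g⁻¹ * x)
  have hmk : Continuous (QuotientGroup.mk : G → G ⧸ H) := QuotientGroup.continuous_mk
  have hf : ∀ g, Continuous (f g) := fun g => ((ρ g).continuous.comp hmk).mul (by fun_prop)
  have hf0 : ∀ g x, 0 ≤ f g x := fun g x => mul_nonneg (ρ.nonneg g _) (hb0 _)
  have hlf : LocallyFinite fun g => Function.support (f g) :=
    (ρ.locallyFinite.preimage_continuous hmk).subset fun g x hx h0 => hx (by
      have h0' : ρ g (x : G ⧸ H) = 0 := h0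
      simp only [f, h0', zero_mul])
  refine nonempty_bruhatFunction_of_pos μH (φ := fun x => ∑ᶠ g, f g x) (continuous_finsum hf hlf)
    (fun x => finsum_nonneg fun g => hf0 g x) (fun x => ?_) fun K hK => ?_
  · obtain ⟨g, hg⟩ := ρ.exists_pos (Set.mem_univ (x : G ⧸ H))
    obtain ⟨y, hy, hyx⟩ := hρ g (subset_tsupport _ hg.ne')
    refine ⟨⟨x⁻¹ * y, QuotientGroup.eq.1 hyx.symm⟩, ?_⟩
    rw [mul_inv_cancel_left]
    have h1 : 0 < f g y := by
      refine mul_pos ?_ ((hb0 _).lt_of_ne' hy)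
      rw [hyx]
      exact hg
    exact (h1.trans_le (single_le_finsum g (hlf.point_finite y) fun g => hf0 g y)).ne'
  · -- over a compact set of cosets only finitely many terms matter
    have hfin := ρ.locallyFinite_tsupport.finite_nonempty_inter_compact (hK.image hmk)
    refine (hfin.isCompact_biUnion fun g _ =>
      (hbc.comp_homeomorph (Homeomorph.mulLeft g⁻¹)).isCompact).of_isClosed_subset
        ((hH.mul_left_of_isCompact hK).inter (isClosed_tsupport _)) ?_
    rintro y ⟨⟨k, hk, h, hh, rfl⟩, hy⟩
    have h1 : tsupport (fun x => ∑ᶠ g, f g x) ⊆ ⋃ g, tsupport (f g) := by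
      refine (closure_mono ?_).trans hlf.closure_iUnion.subset
      intro x hx
      by_contra h0
      refine hx ((finsum_congr fun g => ?_).trans finsum_zero)
      exact not_not.1 fun hg => h0 (Set.mem_iUnion.2 ⟨g, hg⟩)
    obtain ⟨g, hg⟩ := Set.mem_iUnion.1 (h1 hy)
    refine Set.mem_biUnion (x := g) ?_ (tsupport_mul_subset_right hg)
    refine ⟨(k * h : G), ?_, k, hk, (QuotientGroup.mk_mul_of_mem k hh).symm⟩
    exact tsupport_comp_subset_preimage (ρ g) hmk (tsupport_mul_subset_left hg)

end Bruhat

end Imprimitivity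

end

theorem mainTheorem1 {G : Type*} [Group G] [TopologicalSpace G] [IsTopologicalGroup G]
    [LocallyCompactSpace G] [T2Space G] [SecondCountableTopology G] [MeasurableSpace G]
    [BorelSpace G] (H : Subgroup G) [IsClosed (H : Set G)]
    (μG : Measure G) [μG.IsHaarMeasure] (μH : Measure H) [μH.IsHaarMeasure]
    {V : Type v} [NormedAddCommGroup V] [InnerProductSpace ℂ V] [CompleteSpace V]
    [TopologicalSpace.SeparableSpace V]
    (π : UnitaryRep G V) (E : LocalisationObservable H π) :
    Nonempty (BruhatFunction H μH) ∧
    ∀ θ : BruhatFunction H μH,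
      -- existence of the pair `(σ, W)`
      (∃ (K : Type v) (_ : NormedAddCommGroup K) (_ : InnerProductSpace ℂ K)
        (_ : CompleteSpace K) (_ : TopologicalSpace.SeparableSpace K)
        (σ : UnitaryRep H K) (W : V →ₗᵢ[ℂ] inducedSpace μG θ σ), IsMackeyPair μG θ E σ W) ∧
      -- uniqueness of `σ` up to equivalence
      (∀ {K₁ : Type*} [NormedAddCommGroup K₁] [InnerProductSpace ℂ K₁] [CompleteSpace K₁]
        [TopologicalSpace.SeparableSpace K₁]
        {K₂ : Type*} [NormedAddCommGroup K₂] [InnerProductSpace ℂ K₂] [CompleteSpace K₂]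
        [TopologicalSpace.SeparableSpace K₂]
        (σ₁ : UnitaryRep H K₁) (W₁ : V →ₗᵢ[ℂ] inducedSpace μG θ σ₁)
        (σ₂ : UnitaryRep H K₂) (W₂ : V →ₗᵢ[ℂ] inducedSpace μG θ σ₂),
        IsMackeyPair μG θ E σ₁ W₁ → IsMackeyPair μG θ E σ₂ W₂ → σ₁.Equivalent σ₂) ∧
      -- `E` is projective if and only if `W E(X)^{1/2}` is unitary
      (∀ {K : Type*} [NormedAddCommGroup K] [InnerProductSpace ℂ K] [CompleteSpace K]
        [TopologicalSpace.SeparableSpace K]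
        (σ : UnitaryRep H K) (W : V →ₗᵢ[ℂ] inducedSpace μG θ σ), IsMackeyPair μG θ E σ W →
        (E.IsProjective ↔
          ∃ U : V ≃ₗᵢ[ℂ] inducedSpace μG θ σ, ∀ v : V, U v = W (E.sqrtTotal v))) ∧
      -- equivalent observables have equivalent representations of `H`
      (∀ {V' : Type*} [NormedAddCommGroup V'] [InnerProductSpace ℂ V'] [CompleteSpace V']
        [TopologicalSpace.SeparableSpace V']
        (π' : UnitaryRep G V') (E' : LocalisationObservable H π'), E.Equivalent E' →
        ∀ {K : Type*} [NormedAddCommGroup K] [InnerProductSpace ℂ K] [CompleteSpace K]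
          [TopologicalSpace.SeparableSpace K]
          {K' : Type*} [NormedAddCommGroup K'] [InnerProductSpace ℂ K'] [CompleteSpace K']
          [TopologicalSpace.SeparableSpace K']
          (σ : UnitaryRep H K) (W : V →ₗᵢ[ℂ] inducedSpace μG θ σ)
          (σ' : UnitaryRep H K') (W' : V' →ₗᵢ[ℂ] inducedSpace μG θ σ'),
          IsMackeyPair μG θ E σ W → IsMackeyPair μG θ E' σ' W' → σ.Equivalent σ') := by
  refine ⟨nonempty_bruhatFunction H μH, fun θ => ⟨exists_isMackeyPair E θ, ?_, ?_, ?_⟩⟩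
  · intro K₁ _ _ _ _ K₂ _ _ _ _ σ₁ W₁ σ₂ W₂ h₁ h₂
    exact h₁.equivalent h₂
  · intro K _ _ _ _ σ W h
    exact h.isProjective_iff
  · rintro V' _ _ _ _ π' E' ⟨T, hT, hTE⟩ K _ _ _ _ K' _ _ _ _ σ W σ' W' h h'
    exact h.equivalent (h'.comp_equiv T hT hTE)
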